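/- **Massive Hadamard's formula.** Let $\Omega\subset\mathbb C$ be a bounded domain, let $\phi:\Omega\to\mathbb H$ be a conformal bijection onto the upper half-plane $\mathbb H$ (so $\Omega$ is simply connected), let $\xi:[0,\infty)\to\mathbb R$ be continuous, and let $m\in\mathbb R$. For $z\in\mathbb H$ let $t\mapsto g_t(z)$ be the solution of the Loewner equation $$\partial_t g_t(z)=\frac{2}{g_t(z)-\xi_t},\qquad g_0(z)=z,$$ and let $\mathbb H\smallsetminus K_t$ be the set of $z\in\mathbb H$ for which this solution exists on the whole closed interval $[0,t]$. Put $$\Omega_t:=\phi^{-1}(\mathbb H\smallsetminus K_t),\qquad \phi_t:=(g_t-\xi_t)\circ\phi:\Omega_t\to\mathbb H,\qquad P_t(z):=-\frac1\pi\,\mathrm{Im}\,\frac1{\phi_t(z)}.$$ Let $G^{(m)}_t(w,z)$ be the massive Green function of $\Omega_t$, i.e. the integral kernel of $(-\Delta+m^2)^{-1}$ with Dirichlet boundary conditions: for each $w\in\Omega_t$ the function $G^{(m)}_t(w,\cdot)$ is locally integrable on $\Omega_t$, continuous on $\Omega_t\smallsetminus\{w\}$, satisfies $(-\Delta+m^2)G^{(m)}_t(w,\cdot)=\delta_w$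 in the sense of distributions on $\Omega_t$, and tends to $0$ at every point of $\partial\Omega_t$. Define the massive Poisson kernel by $$P^{(m)}_t(z):=P_t(z)-m^2\int_{\Omega_t}P_t(w)\,G^{(m)}_t(w,z)\,dA(w),\qquad z\in\Omega_t,$$ where $dA$ is the Lebesgue measure. Then, for every $t\ge 0$, the massive Green function of $\Omega_t$ exists for each pole $w\in\Omega_t$, and the integral defining $P^{(m)}_t(z)$ converges absolutely for each $z\in\Omega_t$. Moreover, for all distinct $w,z\in\Omega_t$ the function $s\mapsto G^{(m)}_s(w,z)$ is differentiable at $s=t$ (from the right if $t=0$), with $$\partial_t G^{(m)}_t(w,z)=-2\pi\,P^{(m)}_t(w)\,P^{(m)}_t(z).$$ -/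

import Mathlib

open scoped Topology ContDiff

noncomputable section

namespace MassiveHadamard

/-- The open upper half-plane. -/
def upperHalf : Set ℂ := {z | 0 < z.im}

/-- `u` solves the Loewner equation `∂ₛ u = 2 / (u - ξ)`, `u 0 = z`, on the whole of `[0, t]`. -/
structure IsLoewnerTrajectory (ξ : ℝ → ℝ) (z : ℂ) (t : ℝ) (u : ℝ → ℂ) : Prop where
  init : u 0 = z
  ne : ∀ s ∈ Set.Icc 0 t, u s ≠ (ξ s : ℂ)
  deriv : ∀ s ∈ Set.Icc 0 t, HasDerivWithinAt u (2 / (u s - (ξ s : ℂ))) (Set.Icc 0 t) s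

/-- `ℍ ∖ K_t`: the points of the upper half-plane from which the solution of the Loewner equation
exists up to and including the time `t`. -/
def loewnerDomain (ξ : ℝ → ℝ) (t : ℝ) : Set ℂ :=
  {z | z ∈ upperHalf ∧ ∃ u, IsLoewnerTrajectory ξ z t u}

open Classical in
/-- The Loewner map `g_t : ℍ ∖ K_t → ℍ` (the value off `ℍ ∖ K_t` is irrelevant). -/
def loewnerMap (ξ : ℝ → ℝ) (t : ℝ) (z : ℂ) : ℂ :=
  if h : ∃ u, IsLoewnerTrajectory ξ z t u then h.choose t else 0

/-- `Ω_t`, the preimage of `ℍ ∖ K_t` under the uniformization `φ` of `Ω`. -/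
def evolvedDomain (Ω : Set ℂ) (φ : ℂ → ℂ) (ξ : ℝ → ℝ) (t : ℝ) : Set ℂ :=
  {w | w ∈ Ω ∧ φ w ∈ loewnerDomain ξ t}

/-- The uniformization `φ_t = (g_t - ξ_t) ∘ φ` of `Ω_t`. -/
def evolvedMap (φ : ℂ → ℂ) (ξ : ℝ → ℝ) (t : ℝ) (w : ℂ) : ℂ :=
  loewnerMap ξ t (φ w) - (ξ t : ℂ)

/-- `g` is the Green function of `-Δ + m²` with pole `w` and Dirichlet boundary conditions in the
bounded domain `Λ`: it is continuous off the pole, solves `(-Δ + m²) g = δ_w` in the sense of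
distributions, and tends to zero at every boundary point. -/
structure IsMassiveGreen (m : ℝ) (Λ : Set ℂ) (w : ℂ) (g : ℂ → ℝ) : Prop where
  continuousOn : ContinuousOn g (Λ \ {w})
  locallyIntegrableOn : MeasureTheory.LocallyIntegrableOn g Λ MeasureTheory.volume
  weak : ∀ ψ : ℂ → ℝ, ContDiff ℝ ∞ ψ → HasCompactSupport ψ → tsupport ψ ⊆ Λ →
    ∫ z in Λ, g z * (m ^ 2 * ψ z - Laplacian.laplacian ψ z) = ψ w
  boundary : ∀ ζ ∈ frontier Λ, Filter.Tendsto g (𝓝[Λ] ζ) (𝓝 0)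

open Classical in
/-- The massive Green function `G^{(m)}_Λ(w, z)`, that is, the integral kernel of the inverse of
`-Δ + m²` with Dirichlet boundary conditions. Its value at `z = w` is irrelevant. -/
def massiveGreen (m : ℝ) (Λ : Set ℂ) (w z : ℂ) : ℝ :=
  if h : ∃ g, IsMassiveGreen m Λ w g then h.choose z else 0

/-- The Poisson kernel `P(z) = -π⁻¹ Im (1 / φ(z))` attached to a uniformization `φ`. -/
def poisson (φ : ℂ → ℂ) (z : ℂ) : ℝ := -(1 / Real.pi) * (1 / φ z).im

/-- The massive Poisson kernel `P^{(m)}(z) = P(z) - m² ∫_Λ P(w) G^{(m)}_Λ(w, z) dA(w)` attached to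
a uniformization `φ` of `Λ`. -/
def massivePoisson (m : ℝ) (Λ : Set ℂ) (φ : ℂ → ℂ) (z : ℂ) : ℝ :=
  poisson φ z - m ^ 2 * ∫ w in Λ, poisson φ w * massiveGreen m Λ w z

end MassiveHadamard

end

namespace MassiveHadamard

noncomputable section

open Set Filter MeasureTheory Metric InnerProductSpace
open scoped Laplacian Convolution

/-! ### The Laplacian in coordinates. -/

section Laplacian

/-! At mass zero everything is explicit. The Green function of Ω_t is pulled back from the
half-plane, G_t(x,y) = (4π)⁻¹ log(1 + 4 Im X Im Y / |X - Y|²). Only differences of g_t enter, so the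
rough driving function cancels, and the Loewner equation gives ∂_t G_t(x,y) = -2π P_t(x) P_t(y)
(`hasDerivWithinAt_evolvedGreen`). With mass, G^{(m)} is obtained from the resolvent equation
G^{(m)} + m² G G^{(m)} = G, solved by a continuity method whose a priori bound comes from the
minimum principle (`weak_minimum_principle`, `exists_isMassiveGreen`); the same principle gives
uniqueness, positivity and G^{(m)} ≤ G.

Subtracting the resolvent equations at two times a ≤ b shows that the decrement D = G^{(m)}_a -
G^{(m)}_b satisfies D + m² G_b D = `greenSource` on Ω_b, where the source contains only the massless
decrement G_a - G_b. Inverting gives `massiveGreen_sub_eq`. After division by b - a the source tends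
to 2π P_t(y) P^{(m)}_t(w), and the inversion turns the remaining P_t(z) into P^{(m)}_t(z).

The limits need domination up to the boundary. Let V_t = Im g_t ∘ φ (`height`). Near the boundary
G_t decays like V_t, the decrement of G_t is controlled by that of V_t, and ∂_t V² ≥ -4. Hence the
product of a massless decrement and a massive Green function is at most V_a² - V_b² ≤ 4(b - a) times
an integrable logarithmic weight.

The delicate point is the left derivative: Ω_a ∖ Ω_t may keep positive area as a ↑ t, and V_a² ≤ 4(t
- a) only bounds its contribution by O(t - a), while o(t - a) is required
(`tendsto_integral_sq_height`). Since V² decreases at rate 4V²/|φ_r|², V_a² is comparable to t - a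
only if |φ_r|² is O(t - a) during a good part of [a, t]. Where the conformal radius stays bounded
below, this forces it to drop; it is monotone and bounded, so late drops are small in mean. Where
the conformal radius is small, |φ_r'| is large while φ_r takes values in a disc of area O(t - a), so
such points occupy little area. -/

lemma two_le_infty : (2 : WithTop ℕ∞) ≤ ∞ := WithTop.coe_le_coe.2 le_top

lemma contDiff_fderiv_apply {f : ℂ → ℝ} (hf : ContDiff ℝ ∞ f) (v : ℂ) :
    ContDiff ℝ ∞ (fun y => fderiv ℝ f y v) :=
  (hf.fderiv_right (m := ∞) (by simp)).clm_apply contDiff_const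

lemma laplacian_eq_fderiv_fderiv {f : ℂ → ℝ} {x : ℂ} (hf : ContDiffAt ℝ 2 f x) :
    Δ f x = fderiv ℝ (fun y => fderiv ℝ f y 1) x 1 +
      fderiv ℝ (fun y => fderiv ℝ f y Complex.I) x Complex.I := by
  have h1 : DifferentiableAt ℝ (fderiv ℝ f) x :=
    (hf.fderiv_right (m := 1) (by norm_num)).differentiableAt (by norm_num)
  rw [laplacian_eq_iteratedFDeriv_complexPlane]
  simp only [iteratedFDeriv_two_apply]
  rw [fderiv_clm_apply h1 (by fun_prop), fderiv_clm_apply h1 (by fun_prop)]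
  simp

lemma contDiff_laplacian {f : ℂ → ℝ} (hf : ContDiff ℝ ∞ f) : ContDiff ℝ ∞ (Δ f) := by
  have : Δ f = fun x => fderiv ℝ (fun y => fderiv ℝ f y 1) x 1 +
      fderiv ℝ (fun y => fderiv ℝ f y Complex.I) x Complex.I := by
    funext x
    exact laplacian_eq_fderiv_fderiv (hf.contDiffAt.of_le two_le_infty)
  rw [this]
  exact (contDiff_fderiv_apply (contDiff_fderiv_apply hf _) _).add
    (contDiff_fderiv_apply (contDiff_fderiv_apply hf _) _)

lemma tsupport_laplacian_subset (f : ℂ → ℝ) : tsupport (Δ f) ⊆ tsupport f := by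
  refine closure_minimal (fun x hx => ?_) (isClosed_tsupport f)
  by_contra h
  have h0 : f =ᶠ[𝓝 x] fun _ => (0 : ℝ) := notMem_tsupport_iff_eventuallyEq.mp h
  exact hx (by rw [(laplacian_congr_nhds h0).eq_of_nhds]; simp)

lemma hasCompactSupport_laplacian {f : ℂ → ℝ} (hf : HasCompactSupport f) :
    HasCompactSupport (Δ f) :=
  hf.mono' ((subset_tsupport _).trans (tsupport_laplacian_subset f))

lemma laplacian_normSq (x : ℂ) : Δ (fun z : ℂ => Complex.normSq z) x = 4 := by
  have hd : ∀ z : ℂ, HasFDerivAt (fun z : ℂ => Complex.normSq z)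
      ((2 * z.re) • Complex.reCLM + (2 * z.im) • Complex.imCLM) z := by
    intro z
    have h := ((Complex.reCLM.hasFDerivAt (x := z)).mul (Complex.reCLM.hasFDerivAt (x := z))).add
      ((Complex.imCLM.hasFDerivAt (x := z)).mul (Complex.imCLM.hasFDerivAt (x := z)))
    refine (h.congr_fderiv ?_)
    ext v
    simp
    ring
  have hc : ContDiff ℝ 2 (fun z : ℂ => Complex.normSq z) := by
    have : (fun z : ℂ => Complex.normSq z) =
        fun z : ℂ => Complex.reCLM z * Complex.reCLM z + Complex.imCLM z * Complex.imCLM z := by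
      funext z; simp [Complex.normSq_apply]
    rw [this]; fun_prop
  rw [laplacian_eq_fderiv_fderiv hc.contDiffAt]
  have e1 : (fun y : ℂ => fderiv ℝ (fun z : ℂ => Complex.normSq z) y 1) =
      fun y => (2 : ℝ) * Complex.reCLM y := by
    funext y; rw [(hd y).fderiv]; simp
  have e2 : (fun y : ℂ => fderiv ℝ (fun z : ℂ => Complex.normSq z) y Complex.I) =
      fun y => (2 : ℝ) * Complex.imCLM y := by
    funext y; rw [(hd y).fderiv]; simp
  rw [e1, e2, ((Complex.reCLM.hasFDerivAt (x := x)).const_mul 2).fderiv,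
    ((Complex.imCLM.hasFDerivAt (x := x)).const_mul 2).fderiv]
  simp; norm_num

end Laplacian

/-! ### The classical minimum principle. -/

section MaximumPrinciple

/-- Restrict to the line through `x` in direction `v`. A negative second derivative would make the
local minimum also a local maximum, hence the restriction locally constant, with second derivative
zero. -/
lemma fderiv_fderiv_nonneg_of_isLocalMin {f : ℂ → ℝ} (hf : ContDiff ℝ 2 f) {x : ℂ}
    (hmin : IsLocalMin f x) (v : ℂ) : 0 ≤ fderiv ℝ (fun y => fderiv ℝ f y v) x v := by
  set γ : ℝ → ℂ := fun s => x + s • v with hγ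
  have hγd : ∀ s, HasDerivAt γ v s := fun s => by
    have := ((hasDerivAt_id s).smul_const v).const_add x
    rw [one_smul] at this
    exact this
  have hγc : Continuous γ := by fun_prop
  have hγ0 : γ 0 = x := by simp [hγ]
  have hdf : Differentiable ℝ f := hf.differentiable (by norm_num)
  have hddf : Differentiable ℝ (fun y => fderiv ℝ f y v) :=
    ((hf.fderiv_right (m := 1) (by norm_num)).clm_apply contDiff_const).differentiable (by norm_num)
  have h1 : ∀ s, HasDerivAt (f ∘ γ) (fderiv ℝ f (γ s) v) s := fun s =>
    (hdf (γ s)).hasFDerivAt.comp_hasDerivAt s (hγd s)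
  have h1' : deriv (f ∘ γ) = fun s => fderiv ℝ f (γ s) v := funext fun s => (h1 s).deriv
  have h2 : deriv (deriv (f ∘ γ)) 0 = fderiv ℝ (fun y => fderiv ℝ f y v) x v := by
    rw [h1', ← hγ0]
    exact ((hddf (γ 0)).hasFDerivAt.comp_hasDerivAt 0 (hγd 0)).deriv
  have hm : IsLocalMin (f ∘ γ) 0 := by
    have : Tendsto γ (𝓝 0) (𝓝 x) := by rw [← hγ0]; exact hγc.tendsto 0
    simpa [IsLocalMin, IsMinFilter, hγ0] using this.eventually hmin
  by_contra hneg
  push Not at hneg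
  rw [← h2] at hneg
  have hmax : IsLocalMax (f ∘ γ) 0 :=
    isLocalMax_of_deriv_deriv_neg hneg hm.deriv_eq_zero (h1 0).continuousAt
  have hconst : (f ∘ γ) =ᶠ[𝓝 0] fun _ => (f ∘ γ) 0 := by
    filter_upwards [hm, hmax] with s a b using le_antisymm b a
  have : deriv (deriv (f ∘ γ)) 0 = 0 := by
    have h3 : deriv (f ∘ γ) =ᶠ[𝓝 0] fun _ => (0 : ℝ) := by
      filter_upwards [hconst.eventually_nhds] with s hs
      rw [Filter.EventuallyEq.deriv_eq hs]; simp
    rw [h3.deriv_eq]; simp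
  linarith

lemma laplacian_nonneg_of_isLocalMin {f : ℂ → ℝ} (hf : ContDiff ℝ 2 f) {x : ℂ}
    (hmin : IsLocalMin f x) : 0 ≤ Δ f x := by
  rw [laplacian_eq_fderiv_fderiv hf.contDiffAt]
  exact add_nonneg (fderiv_fderiv_nonneg_of_isLocalMin hf hmin 1)
    (fderiv_fderiv_nonneg_of_isLocalMin hf hmin Complex.I)

/-- The classical minimum principle for supersolutions of `-Δ + lam`. -/
lemma smooth_minimum_principle {f : ℂ → ℝ} (hf : ContDiff ℝ 2 f) {U : Set ℂ} (hU : IsOpen U)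
    (hUb : Bornology.IsBounded U) {lam c : ℝ} (hlam : 0 ≤ lam) (hc : 0 ≤ c)
    (hsup : ∀ z ∈ U, Δ f z ≤ lam * f z) (hfr : ∀ z ∈ frontier U, -c ≤ f z) :
    ∀ z ∈ U, -c ≤ f z := by
  intro z₁ hz₁
  by_contra hlt
  push Not at hlt
  have hK : IsCompact (closure U) := hUb.isCompact_closure
  obtain ⟨M, hM⟩ : ∃ M, ∀ z ∈ closure U, Complex.normSq z ≤ M := by
    obtain ⟨M, hM⟩ := hK.bddAbove_image (f := fun z : ℂ => Complex.normSq z)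
      Complex.continuous_normSq.continuousOn
    exact ⟨M, fun z hz => hM ⟨z, hz, rfl⟩⟩
  have hM0 : 0 ≤ M := (Complex.normSq_nonneg z₁).trans (hM z₁ (subset_closure hz₁))
  -- Subtracting d|z|² makes the inequality strict: at a minimum of the perturbed function Δf ≥ 4d >
  -- 0, whereas Δf ≤ lam f ≤ 0 there. The size of `d` keeps f below -c at that minimum, which
  -- therefore is not on the frontier.
  obtain ⟨d, hd0, hd⟩ : ∃ d : ℝ, 0 < d ∧ f z₁ < -c - d * M := by
    refine ⟨(-c - f z₁) / (2 * (M + 1)), by apply div_pos <;> linarith, ?_⟩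
    have : (-c - f z₁) / (2 * (M + 1)) * M ≤ (-c - f z₁) / 2 := by
      rw [div_mul_eq_mul_div, div_le_div_iff₀ (by linarith) (by norm_num)]
      nlinarith
    linarith
  set q : ℂ → ℝ := f - d • fun z : ℂ => Complex.normSq z with hq
  have hnc : ContDiff ℝ 2 (fun z : ℂ => Complex.normSq z) := by
    have : (fun z : ℂ => Complex.normSq z) =
        fun z : ℂ => Complex.reCLM z * Complex.reCLM z + Complex.imCLM z * Complex.imCLM z := by
      funext z; simp [Complex.normSq_apply]
    rw [this]; fun_prop
  have hqc : ContDiff ℝ 2 q := hf.sub (hnc.const_smul d)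
  obtain ⟨z₀, hz₀, hmin⟩ := hK.exists_isMinOn ⟨z₁, subset_closure hz₁⟩ hqc.continuous.continuousOn
  have hqv : ∀ z, q z = f z - d * Complex.normSq z := fun z => by simp [hq]
  have h01 : q z₀ ≤ f z₁ := by
    have := hmin (subset_closure hz₁)
    simp only [mem_ofPred_eq, hqv z₁] at this
    nlinarith [Complex.normSq_nonneg z₁]
  have hf0 : f z₀ < -c := by
    have := hqv z₀
    nlinarith [hM z₀ hz₀]
  have hz₀U : z₀ ∈ U := by
    by_contra hn
    have : z₀ ∈ frontier U := ⟨hz₀, by rwa [hU.interior_eq]⟩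
    linarith [hfr z₀ this]
  have hloc : IsLocalMin q z₀ := by
    filter_upwards [hU.mem_nhds hz₀U] with z hz using hmin (subset_closure hz)
  have h1 := laplacian_nonneg_of_isLocalMin hqc hloc
  rw [hq, ContDiffAt.laplacian_sub hf.contDiffAt (f₂ := d • fun z : ℂ => Complex.normSq z)
    (hnc.const_smul d).contDiffAt, laplacian_smul d hnc.contDiffAt, laplacian_normSq] at h1
  have h2 := hsup z₀ hz₀U
  simp only [smul_eq_mul] at h1
  nlinarith

end MaximumPrinciple

/-! ### Differentiating mollifications. -/

section Mollification

lemma fderiv_convolution_apply {f k : ℂ → ℝ} (hf : LocallyIntegrable f) (hk : ContDiff ℝ ∞ k)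
    (hkc : HasCompactSupport k) (v x : ℂ) :
    fderiv ℝ (f ⋆[ContinuousLinearMap.lsmul ℝ ℝ] k) x v =
      (f ⋆[ContinuousLinearMap.lsmul ℝ ℝ] fun y => fderiv ℝ k y v) x := by
  rw [(hkc.hasFDerivAt_convolution_right _ hf (hk.of_le (by exact_mod_cast le_top)) x).fderiv]
  exact convolution_precompR_apply _ hf (hkc.fderiv ℝ)
    (hk.continuous_fderiv (by simp)) x v

lemma laplacian_convolution {f k : ℂ → ℝ} (hf : LocallyIntegrable f) (hk : ContDiff ℝ ∞ k)
    (hkc : HasCompactSupport k) (x : ℂ) :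
    Δ (f ⋆[ContinuousLinearMap.lsmul ℝ ℝ] k) x =
      (f ⋆[ContinuousLinearMap.lsmul ℝ ℝ] Δ k) x := by
  have hsm : ContDiff ℝ ∞ (f ⋆[ContinuousLinearMap.lsmul ℝ ℝ] k) :=
    hkc.contDiff_convolution_right _ hf hk
  rw [laplacian_eq_fderiv_fderiv (hsm.contDiffAt.of_le two_le_infty)]
  have e : ∀ v : ℂ, fderiv ℝ (fun y => fderiv ℝ (f ⋆[ContinuousLinearMap.lsmul ℝ ℝ] k) y v) x v =
      (f ⋆[ContinuousLinearMap.lsmul ℝ ℝ] fun y => fderiv ℝ (fun y => fderiv ℝ k y v) y v) x := by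
    intro v
    have : (fun y => fderiv ℝ (f ⋆[ContinuousLinearMap.lsmul ℝ ℝ] k) y v) =
        (f ⋆[ContinuousLinearMap.lsmul ℝ ℝ] fun y => fderiv ℝ k y v) :=
      funext fun y => fderiv_convolution_apply hf hk hkc v y
    rw [this, fderiv_convolution_apply hf (contDiff_fderiv_apply hk v) (hkc.fderiv_apply (𝕜 := ℝ) v)]
  have hex : ∀ v : ℂ, ConvolutionExistsAt f (fun y => fderiv ℝ (fun y => fderiv ℝ k y v) y v) x
      (ContinuousLinearMap.lsmul ℝ ℝ) := fun v =>
    ((hkc.fderiv_apply (𝕜 := ℝ) v).fderiv_apply (𝕜 := ℝ) v).convolutionExists_right _ hf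
      (contDiff_fderiv_apply (contDiff_fderiv_apply hk v) v).continuous x
  have hΔ : Δ k = (fun y => fderiv ℝ (fun y => fderiv ℝ k y 1) y 1) +
      fun y => fderiv ℝ (fun y => fderiv ℝ k y Complex.I) y Complex.I :=
    funext fun y => laplacian_eq_fderiv_fderiv (hk.contDiffAt.of_le two_le_infty)
  rw [e, e, hΔ, (hex 1).distrib_add (hex Complex.I)]

lemma laplacian_comp_sub_left {k : ℂ → ℝ} (hk : ContDiff ℝ ∞ k) (z y : ℂ) :
    Δ (fun y => k (z - y)) y = Δ k (z - y) := by
  have h1 : ∀ (g : ℂ → ℝ), ContDiff ℝ ∞ g → ∀ v y,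
      fderiv ℝ (fun y => g (z - y)) y v = - fderiv ℝ g (z - y) v := by
    intro g hg v y
    have := ((hg.differentiable (by simp)) (z - y)).hasFDerivAt.comp y
      ((hasFDerivAt_id y).const_sub z)
    rw [show (fun y => g (z - y)) = g ∘ (fun y => z - y) from rfl]
    erw [this.fderiv]
    simp
  have hk' : ContDiff ℝ ∞ (fun y => k (z - y)) := hk.comp (contDiff_const.sub contDiff_id)
  rw [laplacian_eq_fderiv_fderiv (hk'.contDiffAt.of_le two_le_infty),
    laplacian_eq_fderiv_fderiv (hk.contDiffAt.of_le two_le_infty)]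
  have e : ∀ v, fderiv ℝ (fun y => fderiv ℝ (fun y => k (z - y)) y v) y v =
      fderiv ℝ (fun y => fderiv ℝ k y v) (z - y) v := by
    intro v
    have : (fun y => fderiv ℝ (fun y => k (z - y)) y v) =
        fun y => -(fun y => fderiv ℝ k y v) (z - y) := funext fun y => h1 k hk v y
    rw [this, fderiv_fun_neg]
    simp only [neg_apply]
    rw [h1 _ (contDiff_fderiv_apply hk v)]
    simp
  rw [e, e]

end Mollification

end

end MassiveHadamard

namespace MassiveHadamard

noncomputable section

open Set Filter MeasureTheory Metric InnerProductSpace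
open scoped Laplacian Convolution

/-! ### The minimum principle for distributional supersolutions. -/

section WeakMinimumPrinciple

/-- Convolution with a normalised bump is an average over the ball of radius `b.rOut`. -/
lemma convolution_normed_ge {f : ℂ → ℝ} (hf : Integrable f) (b : ContDiffBump (0 : ℂ)) {z : ℂ}
    {c : ℝ} (hc : ∀ t ∈ ball z b.rOut, c ≤ f t) :
    c ≤ (f ⋆[ContinuousLinearMap.lsmul ℝ ℝ] b.normed volume) z := by
  have hk : Integrable (fun t => b.normed volume (z - t)) :=
    (b.integrable_normed (μ := volume)).comp_sub_left z
  have h1 : ∫ t, c * b.normed volume (z - t) = c := by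
    rw [integral_const_mul, integral_sub_left_eq_self (b.normed volume) volume z,
      b.integral_normed, mul_one]
  have hex : Integrable (fun t => f t * b.normed volume (z - t)) := by
    have := b.hasCompactSupport_normed (μ := volume).convolutionExists_right
      (ContinuousLinearMap.lsmul ℝ ℝ) hf.locallyIntegrable b.continuous_normed z
    simpa [ConvolutionExistsAt] using this
  rw [convolution_def, ← h1]
  simp only [ContinuousLinearMap.lsmul_apply, smul_eq_mul]
  refine integral_mono (hk.const_mul c) hex fun t => ?_
  by_cases ht : t ∈ ball z b.rOut
  · exact mul_le_mul_of_nonneg_right (hc t ht) (b.nonneg_normed _)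
  · have : b.normed volume (z - t) = 0 := by
      have hs := b.support_normed_eq (μ := volume)
      by_contra hne
      have : z - t ∈ Function.support (b.normed volume) := hne
      rw [hs, mem_ball_zero_iff, ← dist_eq_norm, dist_comm] at this
      exact ht this
    simp [this]

/-- The minimum principle for weak supersolutions of `-Δ + lam` on a bounded open set which are
continuous off one point. -/
lemma weak_minimum_principle {Λ : Set ℂ} (hΛ : IsOpen Λ) (hb : Bornology.IsBounded Λ) {lam : ℝ}
    (hlam : 0 ≤ lam) {w : ℂ} {h : ℂ → ℝ} (hc : ContinuousOn h (Λ \ {w}))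
    (hi : LocallyIntegrableOn h Λ)
    (hweak : ∀ ψ : ℂ → ℝ, ContDiff ℝ ∞ ψ → HasCompactSupport ψ → tsupport ψ ⊆ Λ →
      (∀ z, 0 ≤ ψ z) → 0 ≤ ∫ z in Λ, h z * (lam * ψ z - Δ ψ z))
    (hfr : ∀ ζ ∈ frontier Λ, ∀ η > 0, ∀ᶠ z in 𝓝[Λ] ζ, -η < h z) :
    ∀ z ∈ Λ, z ≠ w → 0 ≤ h z := by
  intro z₀ hz₀ hz₀w
  suffices H : ∀ η > 0, -(2 * η) ≤ h z₀ by
    by_contra hn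
    push Not at hn
    have := H (-h z₀ / 4) (by linarith)
    linarith
  intro η hη
  set A : Set ℂ := {z | z ∈ Λ ∧ h z ≤ -η} with hA
  have hAΛ : closure A ⊆ Λ := by
    intro z hz
    by_contra hzΛ
    have hzf : z ∈ frontier Λ :=
      ⟨closure_mono (fun x hx => hx.1) hz, by rwa [hΛ.interior_eq]⟩
    obtain ⟨O, hO, hzO, hOs⟩ := mem_nhdsWithin.1 (hfr z hzf η hη)
    obtain ⟨y, hyO, hyA⟩ := mem_closure_iff.1 hz O hO hzO
    have : -η < h y := hOs ⟨hyO, hyA.1⟩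
    linarith [hyA.2]
  set K : Set ℂ := closure A ∪ ({w} ∩ Λ) ∪ {z₀} with hKdef
  have hKc : IsCompact K := by
    refine ((hb.subset fun x hx => hx.1).isCompact_closure.union ?_).union isCompact_singleton
    exact ((finite_singleton w).inter_of_left Λ).isCompact
  have hKΛ : K ⊆ Λ := by
    rintro x ((hx | hx) | hx)
    exacts [hAΛ hx, hx.2, by rwa [mem_singleton_iff.1 hx]]
  have hz₀K : z₀ ∈ K := Or.inr rfl
  obtain ⟨d, hd, hdΛ⟩ := hKc.exists_cthickening_subset_open hΛ hKΛ
  set C := cthickening d K with hC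
  have hCc : IsCompact C := hKc.cthickening
  set g : ℂ → ℝ := C.indicator h with hg
  have hgi : Integrable g :=
    (integrable_indicator_iff hCc.measurableSet).2 (hi.integrableOn_compact_subset hdΛ hCc)
  set U := thickening (d / 2) K with hU
  have hUcl : closure U ⊆ cthickening (d / 2) K := closure_thickening_subset_cthickening _ _
  have hballC : ∀ {ε : ℝ}, ε ≤ d / 2 → ∀ z ∈ cthickening (d / 2) K, closedBall z ε ⊆ C := by
    intro ε hε z hz t ht
    have h1 : t ∈ cthickening (d / 2) (cthickening (d / 2) K) :=
      closedBall_subset_cthickening hz (d / 2) (closedBall_subset_closedBall hε ht)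
    have := cthickening_cthickening_subset (by positivity) (by positivity) K h1
    rwa [add_halves] at this
  have hcz : ∀ᶠ z in 𝓝 z₀, h z < h z₀ + η := by
    have : ContinuousAt h z₀ :=
      hc.continuousAt ((hΛ.sdiff isClosed_singleton).mem_nhds ⟨hz₀, hz₀w⟩)
    exact this.eventually (gt_mem_nhds (by linarith))
  obtain ⟨e, he, hez⟩ := Metric.eventually_nhds_iff_ball.1 hcz
  -- A radius below d/2 keeps the mollifier inside `C` and, on the frontier of `U`, away from `K`; a
  -- radius at most `e` keeps the mollified value at z₀ within η of h z₀.
  set ε := min (d / 4) e with hεdef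
  have hε : 0 < ε := lt_min (by linarith) he
  have hεd : ε < d / 2 := (min_le_left _ _).trans_lt (by linarith)
  set b : ContDiffBump (0 : ℂ) := ⟨ε / 2, ε, by linarith, by linarith⟩ with hbdef
  have hbr : b.rOut = ε := rfl
  set k := b.normed volume with hk
  have hks : ContDiff ℝ ∞ k := b.contDiff_normed
  have hkc : HasCompactSupport k := b.hasCompactSupport_normed
  set f := g ⋆[ContinuousLinearMap.lsmul ℝ ℝ] k with hf
  have hfs : ContDiff ℝ ∞ f := hkc.contDiff_convolution_right _ hgi.locallyIntegrable hks
  -- Testing the weak inequality against the translated mollifier t ↦ k(z - t) is exactly the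
  -- pointwise inequality for the mollification.
  have hsup : ∀ z ∈ U, Δ f z ≤ lam * f z := by
    intro z hz
    have hzc : z ∈ cthickening (d / 2) K := thickening_subset_cthickening _ _ hz
    set ψ : ℂ → ℝ := fun t => k (z - t) with hψ
    have hψs : ContDiff ℝ ∞ ψ := hks.comp (contDiff_const.sub contDiff_id)
    have hψt : tsupport ψ ⊆ closedBall z ε := by
      refine closure_minimal (fun t ht => ?_) isClosed_closedBall
      have : z - t ∈ Function.support k := ht
      rw [hk, b.support_normed_eq, mem_ball_zero_iff, ← dist_eq_norm, dist_comm] at this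
      exact ball_subset_closedBall this
    have hψc : HasCompactSupport ψ :=
      HasCompactSupport.intro' (isCompact_closedBall z ε) isClosed_closedBall fun t ht =>
        image_eq_zero_of_notMem_tsupport fun h' => ht (hψt h')
    have hεC : closedBall z ε ⊆ C := hballC hεd.le z hzc
    have h0 := hweak ψ hψs hψc ((hψt.trans hεC).trans hdΛ) fun t => b.nonneg_normed _
    have hΔψ : ∀ t, Δ ψ t = Δ k (z - t) := fun t => laplacian_comp_sub_left hks z t
    have i1 : Integrable (fun t => g t * k (z - t)) := by
      have := hkc.convolutionExists_right (ContinuousLinearMap.lsmul ℝ ℝ) hgi.locallyIntegrable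
        hks.continuous z
      simpa [ConvolutionExistsAt] using this
    have i2 : Integrable (fun t => g t * Δ k (z - t)) := by
      have := (hasCompactSupport_laplacian hkc).convolutionExists_right
        (ContinuousLinearMap.lsmul ℝ ℝ) hgi.locallyIntegrable (contDiff_laplacian hks).continuous z
      simpa [ConvolutionExistsAt] using this
    have h1 : ∫ t in Λ, h t * (lam * ψ t - Δ ψ t) = lam * f z - Δ f z := by
      have hz' : ∀ t ∈ Λ \ C, h t * (lam * ψ t - Δ ψ t) = 0 := by
        intro t ht
        have htn : t ∉ tsupport ψ := fun h' => ht.2 (hεC (hψt h'))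
        rw [image_eq_zero_of_notMem_tsupport htn,
          image_eq_zero_of_notMem_tsupport fun h' => htn (tsupport_laplacian_subset ψ h')]
        simp
      rw [setIntegral_eq_of_subset_of_forall_sdiff_eq_zero hΛ.measurableSet hdΛ hz',
        hf, laplacian_convolution hgi.locallyIntegrable hks hkc, convolution_def, convolution_def]
      simp only [ContinuousLinearMap.lsmul_apply, smul_eq_mul]
      rw [← integral_const_mul, ← integral_sub (i1.const_mul lam) i2,
        ← integral_indicator hCc.measurableSet]
      congr 1 with t
      by_cases ht : t ∈ C
      · rw [indicator_of_mem ht, hΔψ]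
        simp only [hg, indicator_of_mem ht, hψ]
        ring
      · simp [hg, indicator_of_notMem ht]
    linarith
  -- A frontier point of `U` lies at distance d/2 from `K`, hence its ε-ball misses A and h > -η on
  -- it.
  have hfr' : ∀ z ∈ frontier U, -η ≤ f z := by
    intro z hz
    have hz1 : infEDist z K = ENNReal.ofReal (d / 2) := frontier_thickening_subset K hz
    have hzc : z ∈ cthickening (d / 2) K := hUcl hz.1
    refine convolution_normed_ge hgi b fun t ht => ?_
    have htC : t ∈ C := hballC hεd.le z hzc (ball_subset_closedBall ht)
    have htK : t ∉ K := by
      intro htK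
      have h2 : infEDist z K ≤ edist z t := infEDist_le_edist_of_mem htK
      rw [hz1, edist_dist, ENNReal.ofReal_le_ofReal_iff dist_nonneg] at h2
      rw [mem_ball, dist_comm, hbr] at ht
      linarith
    simp only [hg, indicator_of_mem htC]
    by_contra hlt
    push Not at hlt
    exact htK (Or.inl (Or.inl (subset_closure ⟨hdΛ htC, hlt.le⟩)))
  have hUb : Bornology.IsBounded U :=
    hKc.isBounded.thickening
  have h1 := smooth_minimum_principle (hfs.of_le two_le_infty) isOpen_thickening hUb hlam hη.le
    hsup hfr' z₀ (self_subset_thickening (by linarith) K hz₀K)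
  have h2 : -(h z₀ + η) ≤ -f z₀ := by
    have := convolution_normed_ge (f := -g) hgi.neg b (z := z₀) (c := -(h z₀ + η)) fun t ht => by
      have htC : t ∈ C :=
        hballC hεd.le z₀ (self_subset_cthickening K hz₀K) (ball_subset_closedBall ht)
      have := hez t (ball_subset_ball (min_le_right _ _) ht)
      simp only [Pi.neg_apply, hg, indicator_of_mem htC]
      linarith
    refine this.trans_eq ?_
    simp only [hf, convolution_def, ContinuousLinearMap.lsmul_apply, smul_eq_mul, Pi.neg_apply,
      neg_mul, integral_neg, hk]
  linarith

end WeakMinimumPrinciple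

/-! ### Uniqueness of the massive Green function. -/

section Green

lemma integrable_mul_of_tsupport_subset {Λ : Set ℂ} {g k : ℂ → ℝ} (hg : LocallyIntegrableOn g Λ)
    (hk : Continuous k) (hkc : HasCompactSupport k) (hkΛ : tsupport k ⊆ Λ) :
    Integrable (fun z => g z * k z) := by
  have h1 : IntegrableOn g (tsupport k) := hg.integrableOn_compact_subset hkΛ hkc
  refine (integrableOn_iff_integrable_of_support_subset ?_).1 (h1.mul_continuousOn hk.continuousOn
    hkc)
  exact fun z hz => subset_tsupport _ (right_ne_zero_of_mul hz)

lemma integrableOn_mul_helmholtz {Λ : Set ℂ} {g ψ : ℂ → ℝ} (hg : LocallyIntegrableOn g Λ)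
    (lam : ℝ) (hψ : ContDiff ℝ ∞ ψ) (hψc : HasCompactSupport ψ) (hψΛ : tsupport ψ ⊆ Λ) :
    IntegrableOn (fun z => g z * (lam * ψ z - Δ ψ z)) Λ := by
  have h1 := integrable_mul_of_tsupport_subset hg hψ.continuous hψc hψΛ
  have h2 := integrable_mul_of_tsupport_subset hg (contDiff_laplacian hψ).continuous
    (hasCompactSupport_laplacian hψc) ((tsupport_laplacian_subset ψ).trans hψΛ)
  refine ((h1.const_mul lam).sub h2).integrableOn.congr_fun_ae (ae_of_all _ fun z => ?_)
  simp only [Pi.sub_apply]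
  ring

/-- The poles cancel in the difference, which is a weak solution with zero boundary values; the
minimum principle applies to both signs. -/
lemma IsMassiveGreen.eqOn {Λ : Set ℂ} (hΛ : IsOpen Λ) (hb : Bornology.IsBounded Λ) {m : ℝ} {w : ℂ}
    {g₁ g₂ : ℂ → ℝ} (h₁ : IsMassiveGreen m Λ w g₁) (h₂ : IsMassiveGreen m Λ w g₂) :
    EqOn g₁ g₂ (Λ \ {w}) := by
  have key : ∀ {g₁ g₂ : ℂ → ℝ}, IsMassiveGreen m Λ w g₁ → IsMassiveGreen m Λ w g₂ →
      ∀ z ∈ Λ, z ≠ w → g₂ z ≤ g₁ z := by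
    intro g₁ g₂ h₁ h₂ z hz hzw
    have := weak_minimum_principle hΛ hb (lam := m ^ 2) (sq_nonneg m) (w := w)
      (h := fun z => g₁ z - g₂ z) (h₁.continuousOn.sub h₂.continuousOn)
      (h₁.locallyIntegrableOn.sub h₂.locallyIntegrableOn) ?_ ?_ z hz hzw
    · simpa using this
    · intro ψ hψ hψc hψΛ _
      have hint : ∀ {g : ℂ → ℝ}, LocallyIntegrableOn g Λ →
          IntegrableOn (fun z => g z * (m ^ 2 * ψ z - Δ ψ z)) Λ := fun hg =>
        integrableOn_mul_helmholtz hg (m ^ 2) hψ hψc hψΛ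
      simp_rw [sub_mul]
      rw [integral_sub (hint h₁.locallyIntegrableOn) (hint h₂.locallyIntegrableOn),
        h₁.weak ψ hψ hψc hψΛ, h₂.weak ψ hψ hψc hψΛ, sub_self]
    · intro ζ hζ η hη
      have := (h₁.boundary ζ hζ).sub (h₂.boundary ζ hζ)
      rw [sub_zero] at this
      exact this.eventually (lt_mem_nhds (by linarith))
  intro z hz
  exact le_antisymm (key h₂ h₁ z hz.1 hz.2) (key h₁ h₂ z hz.1 hz.2)

/-- The choice made in `massiveGreen` does not depend on z, so it is a single function satisfying
`IsMassiveGreen`, and uniqueness identifies it with any other off the pole. -/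
lemma massiveGreen_eq {Λ : Set ℂ} (hΛ : IsOpen Λ) (hb : Bornology.IsBounded Λ) {m : ℝ} {w : ℂ}
    {g : ℂ → ℝ} (h : IsMassiveGreen m Λ w g) :
    IsMassiveGreen m Λ w (massiveGreen m Λ w) ∧ EqOn (massiveGreen m Λ w) g (Λ \ {w}) := by
  have hex : ∃ g, IsMassiveGreen m Λ w g := ⟨g, h⟩
  have he : massiveGreen m Λ w = hex.choose := by
    funext z
    rw [massiveGreen, dif_pos hex]
  rw [he]
  exact ⟨hex.choose_spec, hex.choose_spec.eqOn hΛ hb h⟩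

end Green

end

end MassiveHadamard

namespace MassiveHadamard

noncomputable section

open Set Filter MeasureTheory Metric InnerProductSpace
open scoped Laplacian Convolution

/-! ### Integration by parts against test functions. -/

section IntegrationByParts

lemma tsupport_fderiv_apply_subset_tsupport (f : ℂ → ℝ) (v : ℂ) :
    tsupport (fun y => fderiv ℝ f y v) ⊆ tsupport f :=
  tsupport_fderiv_apply_subset ℝ v

/-- Two integrations by parts. Since f is regular only on Λ, differentiability is used only on the
support of the test function. -/
lemma integral_mul_fderiv_fderiv {Λ : Set ℂ} (hΛ : IsOpen Λ) {f : ℂ → ℝ}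
    (hf : ∀ x ∈ Λ, ContDiffAt ℝ 2 f x) {ψ : ℂ → ℝ} (hψ : ContDiff ℝ ∞ ψ)
    (hψc : HasCompactSupport ψ) (hψΛ : tsupport ψ ⊆ Λ) (v : ℂ) :
    ∫ z, f z * fderiv ℝ (fun y => fderiv ℝ ψ y v) z v =
      ∫ z, fderiv ℝ (fun y => fderiv ℝ f y v) z v * ψ z := by
  have hf2 : ContDiffOn ℝ 2 f Λ := fun x hx => (hf x hx).contDiffWithinAt
  have hf1 : ContDiffOn ℝ 1 (fun y => fderiv ℝ f y v) Λ :=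
    (hf2.fderiv_of_isOpen hΛ (by norm_num)).clm_apply contDiffOn_const
  have hf0 : ContDiffOn ℝ 0 (fun z => fderiv ℝ (fun y => fderiv ℝ f y v) z v) Λ :=
    (hf1.fderiv_of_isOpen hΛ (by norm_num)).clm_apply contDiffOn_const
  have li : ∀ {g : ℂ → ℝ}, ContinuousOn g Λ → LocallyIntegrableOn g Λ := fun hg =>
    hg.locallyIntegrableOn hΛ.measurableSet
  have hψ1 := contDiff_fderiv_apply hψ v
  have hψ2 := contDiff_fderiv_apply hψ1 v
  have hψ1c : HasCompactSupport fun y => fderiv ℝ ψ y v := hψc.fderiv_apply (𝕜 := ℝ) v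
  have hψ2c : HasCompactSupport fun z => fderiv ℝ (fun y => fderiv ℝ ψ y v) z v :=
    hψ1c.fderiv_apply (𝕜 := ℝ) v
  have hψ1Λ := (tsupport_fderiv_apply_subset_tsupport ψ v).trans hψΛ
  have hψ2Λ := (tsupport_fderiv_apply_subset_tsupport (fun y => fderiv ℝ ψ y v) v).trans hψ1Λ
  rw [integral_mul_fderiv_eq_neg_fderiv_mul_of_integrable (f := f)
    (g := fun y => fderiv ℝ ψ y v) (v := v)
    (integrable_mul_of_tsupport_subset (li hf1.continuousOn) hψ1.continuous hψ1c hψ1Λ)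
    (integrable_mul_of_tsupport_subset (li hf2.continuousOn) hψ2.continuous hψ2c hψ2Λ)
    (integrable_mul_of_tsupport_subset (li hf2.continuousOn) hψ1.continuous hψ1c hψ1Λ)
    (fun x hx => (hf x (hψ1Λ hx)).differentiableAt (by norm_num))
    (fun x _ => hψ1.differentiable (by simp) x),
    integral_mul_fderiv_eq_neg_fderiv_mul_of_integrable (f := fun y => fderiv ℝ f y v)
    (g := ψ) (v := v)
    (integrable_mul_of_tsupport_subset (li hf0.continuousOn) hψ.continuous hψc hψΛ)
    (integrable_mul_of_tsupport_subset (li hf1.continuousOn) hψ1.continuous hψ1c hψ1Λ)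
    (integrable_mul_of_tsupport_subset (li hf1.continuousOn) hψ.continuous hψc hψΛ)
    (fun x hx => (hf1.differentiableOn (by norm_num)).differentiableAt (hΛ.mem_nhds (hψΛ hx)))
    (fun x _ => hψ.differentiable (by simp) x), neg_neg]

/-- Green's second identity against a test function. -/
lemma integral_mul_laplacian {Λ : Set ℂ} (hΛ : IsOpen Λ) {f : ℂ → ℝ}
    (hf : ∀ x ∈ Λ, ContDiffAt ℝ 2 f x) {ψ : ℂ → ℝ} (hψ : ContDiff ℝ ∞ ψ)
    (hψc : HasCompactSupport ψ) (hψΛ : tsupport ψ ⊆ Λ) :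
    ∫ z, f z * Δ ψ z = ∫ z, Δ f z * ψ z := by
  have hf2 : ContDiffOn ℝ 2 f Λ := fun x hx => (hf x hx).contDiffWithinAt
  have hf0 : ∀ v : ℂ, ContinuousOn (fun z => fderiv ℝ (fun y => fderiv ℝ f y v) z v) Λ := by
    intro v
    have hf1 : ContDiffOn ℝ 1 (fun y => fderiv ℝ f y v) Λ :=
      (hf2.fderiv_of_isOpen hΛ (by norm_num)).clm_apply contDiffOn_const
    have : ContDiffOn ℝ 0 (fun z => fderiv ℝ (fun y => fderiv ℝ f y v) z v) Λ :=
      (hf1.fderiv_of_isOpen hΛ (by norm_num)).clm_apply contDiffOn_const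
    exact this.continuousOn
  have i1 : ∀ v : ℂ, Integrable fun z => f z * fderiv ℝ (fun y => fderiv ℝ ψ y v) z v := fun v =>
    integrable_mul_of_tsupport_subset (hf2.continuousOn.locallyIntegrableOn hΛ.measurableSet)
      (contDiff_fderiv_apply (contDiff_fderiv_apply hψ v) v).continuous
      ((hψc.fderiv_apply (𝕜 := ℝ) v).fderiv_apply (𝕜 := ℝ) v)
      ((tsupport_fderiv_apply_subset_tsupport _ v).trans
        ((tsupport_fderiv_apply_subset_tsupport ψ v).trans hψΛ))
  have i2 : ∀ v : ℂ, Integrable fun z => fderiv ℝ (fun y => fderiv ℝ f y v) z v * ψ z := fun v =>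
    integrable_mul_of_tsupport_subset ((hf0 v).locallyIntegrableOn hΛ.measurableSet)
      hψ.continuous hψc hψΛ
  have e1 : ∀ z, f z * Δ ψ z = f z * fderiv ℝ (fun y => fderiv ℝ ψ y 1) z 1 +
      f z * fderiv ℝ (fun y => fderiv ℝ ψ y Complex.I) z Complex.I := fun z => by
    rw [laplacian_eq_fderiv_fderiv (hψ.contDiffAt.of_le two_le_infty), mul_add]
  have e2 : ∀ z, Δ f z * ψ z = fderiv ℝ (fun y => fderiv ℝ f y 1) z 1 * ψ z +
      fderiv ℝ (fun y => fderiv ℝ f y Complex.I) z Complex.I * ψ z := fun z => by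
    by_cases hz : z ∈ Λ
    · rw [laplacian_eq_fderiv_fderiv (hf z hz), add_mul]
    · rw [image_eq_zero_of_notMem_tsupport fun h => hz (hψΛ h)]; simp
  simp_rw [e1, e2]
  rw [integral_add (i1 1) (i1 Complex.I), integral_add (i2 1) (i2 Complex.I),
    integral_mul_fderiv_fderiv hΛ hf hψ hψc hψΛ, integral_mul_fderiv_fderiv hΛ hf hψ hψc hψΛ]

end IntegrationByParts

/-! ### The logarithmic kernel and its integrability. -/

section LogKernel

/-- The free logarithmic kernel `(2π)⁻¹ log (R / |z|)`. -/
def logKernel (R : ℝ) (z : ℂ) : ℝ := (2 * Real.pi)⁻¹ * Real.log (R / ‖z‖)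

lemma logKernel_nonneg {R : ℝ} {z : ℂ} (hz : ‖z‖ ≤ R) : 0 ≤ logKernel R z := by
  refine mul_nonneg (by positivity) ?_
  rcases eq_or_ne z 0 with rfl | h
  · simp
  · exact Real.log_nonneg ((one_le_div (norm_pos_iff.2 h)).2 hz)

lemma measurable_logKernel (R : ℝ) : Measurable (logKernel R) := by
  unfold logKernel; fun_prop

lemma continuousAt_logKernel {R : ℝ} (hR : 0 < R) {z : ℂ} (hz : z ≠ 0) :
    ContinuousAt (logKernel R) z := by
  unfold logKernel
  have h1 : ContinuousAt (fun z : ℂ => R / ‖z‖) z :=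
    continuousAt_const.div continuous_norm.continuousAt (norm_ne_zero_iff.2 hz)
  exact continuousAt_const.mul (h1.log (by positivity))

lemma logKernel_sub_comm (R : ℝ) (x y : ℂ) : logKernel R (x - y) = logKernel R (y - x) := by
  rw [logKernel, logKernel, norm_sub_rev]

lemma logKernel_eq {R : ℝ} (hR : 0 < R) {z : ℂ} (hz : z ≠ 0) :
    logKernel R z = (2 * Real.pi)⁻¹ * (Real.log R - Real.log ‖z‖) := by
  rw [logKernel, Real.log_div hR.ne' (norm_ne_zero_iff.2 hz)]

lemma integrableOn_inv_norm_ball (R : ℝ) :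
    IntegrableOn (fun z : ℂ => ‖z‖⁻¹) (ball 0 R) := by
  rw [← integrable_indicator_iff measurableSet_ball]
  have : (ball (0 : ℂ) R).indicator (fun z : ℂ => ‖z‖⁻¹) =
      fun z : ℂ => (Iio R).indicator (fun r : ℝ => r⁻¹) ‖z‖ := by
    funext z
    by_cases h : ‖z‖ < R
    · rw [indicator_of_mem (by simpa using h), indicator_of_mem (by simpa using h)]
    · rw [indicator_of_notMem (by simpa using h), indicator_of_notMem (by simpa using h)]
  rw [this, integrable_fun_norm_addHaar]
  simp only [Complex.finrank_real_complex]
  have h1 : IntegrableOn (fun _ : ℝ => (1 : ℝ)) (Ioo 0 R) := by simp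
  rw [← integrable_indicator_iff measurableSet_Ioo] at h1
  refine h1.integrableOn.congr_fun (fun r hr => ?_) measurableSet_Ioi
  have hr0 : (0 : ℝ) < r := hr
  by_cases h : r < R
  · rw [indicator_of_mem (show r ∈ Ioo 0 R from ⟨hr0, h⟩), indicator_of_mem (by simpa using h)]
    simp [hr0.ne']
  · rw [indicator_of_notMem (fun h' => h h'.2), indicator_of_notMem (by simpa using h)]
    simp

/-- From log q ≤ 4 q^(1/4), with 4⁴ = 256. The fourth power is what the truncation of the Green
operator and the products of two kernels require, and it is still dominated by 1/|z|, locally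
integrable in the plane. -/
lemma logKernel_pow_le {R : ℝ} {z : ℂ} (hz : ‖z‖ < R) :
    logKernel R z ^ 4 ≤ 256 * R * ‖z‖⁻¹ := by
  have hR : 0 < R := (norm_nonneg z).trans_lt hz
  rcases eq_or_ne z 0 with rfl | h
  · simp [logKernel]
  have hz0 := norm_pos_iff.2 h
  have hq : 0 < R / ‖z‖ := by positivity
  have h0 := logKernel_nonneg hz.le
  have hl : logKernel R z ≤ 4 * (R / ‖z‖) ^ (1 / 4 : ℝ) := by
    have h1 := Real.log_le_rpow_div hq.le (show (0 : ℝ) < 1 / 4 by norm_num)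
    have h2 : (2 * Real.pi)⁻¹ ≤ 1 := inv_le_one_of_one_le₀ (by linarith [Real.pi_gt_three])
    have h3 : 0 ≤ Real.log (R / ‖z‖) := Real.log_nonneg ((one_le_div hz0).2 hz.le)
    rw [logKernel]
    calc _ ≤ 1 * Real.log (R / ‖z‖) := mul_le_mul_of_nonneg_right h2 h3
      _ ≤ _ := by rw [one_mul]; linarith
  calc logKernel R z ^ 4 ≤ (4 * (R / ‖z‖) ^ (1 / 4 : ℝ)) ^ 4 := pow_le_pow_left₀ h0 hl 4
    _ = 256 * (R / ‖z‖) := by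
      rw [mul_pow, ← Real.rpow_natCast ((R / ‖z‖) ^ (1 / 4 : ℝ)), ← Real.rpow_mul hq.le]
      norm_num
    _ = _ := by rw [div_eq_mul_inv]; ring

lemma integrableOn_logKernel_pow_ball (R : ℝ) :
    IntegrableOn (fun z => logKernel R z ^ 4) (ball 0 R) := by
  refine Integrable.mono' ((integrableOn_inv_norm_ball R).const_mul (256 * R))
    ((measurable_logKernel R).pow_const 4).aestronglyMeasurable ?_
  refine (ae_restrict_iff' measurableSet_ball).2 (ae_of_all _ fun z hz => ?_)
  rw [Real.norm_of_nonneg (by positivity)]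
  exact logKernel_pow_le (by simpa using hz)

lemma integrableOn_logKernel_pow {R : ℝ} {Λ : Set ℂ} {z : ℂ}
    (hz : Λ ⊆ ball z R) : IntegrableOn (fun y => logKernel R (z - y) ^ 4) Λ := by
  refine IntegrableOn.mono_set ?_ hz
  have := (integrable_indicator_iff measurableSet_ball).2 (integrableOn_logKernel_pow_ball R)
  rw [← integrable_indicator_iff measurableSet_ball]
  refine (this.comp_sub_left z).congr (ae_of_all _ fun y => ?_)
  dsimp only
  by_cases h : y ∈ ball z R
  · rw [indicator_of_mem h, indicator_of_mem]
    rwa [mem_ball_zero_iff, ← dist_eq_norm, dist_comm]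
  · rw [indicator_of_notMem h, indicator_of_notMem]
    rwa [mem_ball_zero_iff, ← dist_eq_norm, dist_comm]

lemma integral_logKernel_pow_le {R : ℝ} {Λ : Set ℂ} {z : ℂ}
    (hz : Λ ⊆ ball z R) : ∫ y in Λ, logKernel R (z - y) ^ 4 ≤
      ∫ y in ball 0 R, logKernel R y ^ 4 := by
  calc ∫ y in Λ, logKernel R (z - y) ^ 4 ≤ ∫ y in ball z R, logKernel R (z - y) ^ 4 :=
        setIntegral_mono_set (integrableOn_logKernel_pow subset_rfl)
          (ae_of_all _ fun _ => by positivity) hz.eventuallyLE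
    _ = _ := by
      rw [← integral_indicator measurableSet_ball, ← integral_indicator measurableSet_ball,
        ← integral_sub_left_eq_self ((ball 0 R).indicator _) volume z]
      congr 1 with y
      by_cases h : y ∈ ball z R
      · rw [indicator_of_mem h, indicator_of_mem]
        rwa [mem_ball_zero_iff, ← dist_eq_norm, dist_comm]
      · rw [indicator_of_notMem h, indicator_of_notMem]
        rwa [mem_ball_zero_iff, ← dist_eq_norm, dist_comm]

lemma sq_le_one_add_pow_four (x : ℝ) : x ^ 2 ≤ 1 + x ^ 4 := by
  nlinarith [sq_nonneg (x ^ 2 - 1)]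

lemma integrable_of_sq_integrable {α : Type*} [MeasurableSpace α] {μ : Measure α}
    [IsFiniteMeasure μ] {f : α → ℝ} (hf : AEStronglyMeasurable f μ)
    (h2 : Integrable (fun x => f x ^ 2) μ) : Integrable f μ := by
  refine Integrable.mono' ((integrable_const 1).add h2) hf (ae_of_all _ fun x => ?_)
  rw [Real.norm_eq_abs, Pi.add_apply]
  rw [abs_le]
  constructor <;> nlinarith [sq_nonneg (f x - 1), sq_nonneg (f x + 1)]

lemma integrableOn_logKernel_sq {R : ℝ} {Λ : Set ℂ} {z : ℂ}
    (hz : Λ ⊆ ball z R) : IntegrableOn (fun y => logKernel R (z - y) ^ 2) Λ := by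
  refine IntegrableOn.mono_set ?_ hz
  have : IntegrableOn (fun _ : ℂ => (1 : ℝ)) (ball z R) := integrableOn_const (by finiteness)
  refine Integrable.mono' (this.add (integrableOn_logKernel_pow subset_rfl)) ?_
    (ae_of_all _ fun y => ?_)
  · exact (((measurable_logKernel R).comp (measurable_const.sub measurable_id)).pow_const
      2).aestronglyMeasurable
  · rw [Real.norm_of_nonneg (by positivity)]
    exact sq_le_one_add_pow_four _

lemma integrableOn_logKernel {R : ℝ} {Λ : Set ℂ} {z : ℂ}
    (hz : Λ ⊆ ball z R) : IntegrableOn (fun y => logKernel R (z - y)) Λ := by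
  refine IntegrableOn.mono_set ?_ hz
  have : IsFiniteMeasure (volume.restrict (ball z R)) := ⟨by
    rw [Measure.restrict_apply_univ]; exact measure_ball_lt_top⟩
  refine integrable_of_sq_integrable ?_ (integrableOn_logKernel_sq subset_rfl)
  exact ((measurable_logKernel R).comp (measurable_const.sub measurable_id)).aestronglyMeasurable

end LogKernel

/-! ### The logarithm as fundamental solution of the Laplacian. -/

section FundamentalSolution

/-- In polar coordinates 2r/(r² + 1)² has primitive -1/(r² + 1). This is the total mass of the
Laplacian of the regularised logarithm. -/
lemma integral_two_div_normSq_add_one_sq :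
    Integrable (fun u : ℂ => 2 / (Complex.normSq u + 1) ^ 2) ∧
    ∫ u : ℂ, 2 / (Complex.normSq u + 1) ^ 2 = 2 * Real.pi := by
  have e : (fun u : ℂ => 2 / (Complex.normSq u + 1) ^ 2) =
      fun u : ℂ => (fun r : ℝ => 2 / (r ^ 2 + 1) ^ 2) ‖u‖ := by
    funext u; simp [Complex.normSq_eq_norm_sq]
  have hd : ∀ r ∈ Ici (0 : ℝ), HasDerivAt (fun r : ℝ => -1 / (r ^ 2 + 1))
      (r * (2 / (r ^ 2 + 1) ^ 2)) r := by
    intro r _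
    have h1 : HasDerivAt (fun r : ℝ => r ^ 2 + 1) (2 * r) r := by
      simpa using ((hasDerivAt_id r).pow 2).add_const 1
    have := (hasDerivAt_const r (-1 : ℝ)).div h1 (by positivity)
    refine this.congr_deriv ?_
    ring
  have hpos : ∀ r ∈ Ioi (0 : ℝ), 0 ≤ r * (2 / (r ^ 2 + 1) ^ 2) := fun r hr => by
    have : (0 : ℝ) < r := hr
    positivity
  have ht : Tendsto (fun r : ℝ => -1 / (r ^ 2 + 1)) atTop (𝓝 0) := by
    refine tendsto_const_nhds.div_atTop (tendsto_atTop_add_const_right _ _ ?_)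
    exact tendsto_pow_atTop (by norm_num)
  have hi := integrableOn_Ioi_deriv_of_nonneg' hd hpos ht
  have hv := integral_Ioi_of_hasDerivAt_of_nonneg' hd hpos ht
  rw [e]
  constructor
  · rw [integrable_fun_norm_addHaar volume (f := fun r : ℝ => 2 / (r ^ 2 + 1) ^ 2)]
    simpa [Complex.finrank_real_complex] using hi
  · rw [integral_fun_norm_addHaar volume (fun r : ℝ => 2 / (r ^ 2 + 1) ^ 2)]
    simp only [Complex.finrank_real_complex, Measure.real, Complex.volume_ball]
    simp only [Nat.add_one_sub_one, pow_one, smul_eq_mul, hv]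
    simp [NNReal.coe_real_pi]

end FundamentalSolution

end

end MassiveHadamard

namespace MassiveHadamard

noncomputable section

open Set Filter MeasureTheory Metric InnerProductSpace
open scoped Laplacian Convolution

section FundamentalSolution

lemma hasFDerivAt_normSq_sub_add (w : ℂ) (e : ℝ) (z : ℂ) :
    HasFDerivAt (fun z : ℂ => Complex.normSq (z - w) + e)
      ((2 * (z - w).re) • Complex.reCLM + (2 * (z - w).im) • Complex.imCLM) z := by
  have h0 : HasFDerivAt (fun z : ℂ => z - w) (ContinuousLinearMap.id ℝ ℂ) z :=
    (hasFDerivAt_id z).sub_const w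
  have hr := Complex.reCLM.hasFDerivAt.comp z h0
  have hi := Complex.imCLM.hasFDerivAt.comp z h0
  have h := ((hr.mul hr).add (hi.mul hi)).add_const e
  refine h.congr_fderiv ?_
  ext v
  simp
  ring

lemma contDiff_half_log_normSq_sub_add (w : ℂ) {e : ℝ} (he : 0 < e) :
    ContDiff ℝ ∞ (fun z : ℂ => (1 / 2 : ℝ) * Real.log (Complex.normSq (z - w) + e)) := by
  have h1 : ContDiff ℝ ∞ (fun z : ℂ => Complex.normSq (z - w) + e) := by
    have : (fun z : ℂ => Complex.normSq (z - w) + e) =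
        fun z : ℂ => Complex.reCLM (z - w) * Complex.reCLM (z - w) +
          Complex.imCLM (z - w) * Complex.imCLM (z - w) + e := by
      funext z; simp [Complex.normSq_apply]
    rw [this]; fun_prop
  exact contDiff_const.mul (h1.log fun z => (add_pos_of_nonneg_of_pos (Complex.normSq_nonneg _) he).ne')

lemma laplacian_half_log_normSq_sub_add (w : ℂ) {e : ℝ} (he : 0 < e) (z : ℂ) :
    Δ (fun z : ℂ => (1 / 2 : ℝ) * Real.log (Complex.normSq (z - w) + e)) z =
      2 * e / (Complex.normSq (z - w) + e) ^ 2 := by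
  have hN : ∀ z : ℂ, Complex.normSq (z - w) + e ≠ 0 := fun z =>
    (add_pos_of_nonneg_of_pos (Complex.normSq_nonneg _) he).ne'
  rw [laplacian_eq_fderiv_fderiv
    ((contDiff_half_log_normSq_sub_add w he).contDiffAt.of_le two_le_infty)]
  have h1 : ∀ y v : ℂ, fderiv ℝ (fun z : ℂ => (1 / 2 : ℝ) * Real.log (Complex.normSq (z - w) + e))
      y v = ((y - w).re * v.re + (y - w).im * v.im) / (Complex.normSq (y - w) + e) := by
    intro y v
    rw [(((hasFDerivAt_normSq_sub_add w e y).log (hN y)).const_mul (1 / 2 : ℝ)).fderiv]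
    simp
    field_simp
  simp_rw [h1]
  have h0 : HasFDerivAt (fun z : ℂ => z - w) (ContinuousLinearMap.id ℝ ℂ) z :=
    (hasFDerivAt_id z).sub_const w
  have hr : HasFDerivAt (fun y : ℂ => (y - w).re) Complex.reCLM z :=
    Complex.reCLM.hasFDerivAt.comp z h0
  have hi : HasFDerivAt (fun y : ℂ => (y - w).im) Complex.imCLM z :=
    Complex.imCLM.hasFDerivAt.comp z h0
  have hv : HasFDerivAt (fun y : ℂ => (Complex.normSq (y - w) + e)⁻¹) _ z :=
    (hasDerivAt_inv (hN z)).comp_hasFDerivAt z (hasFDerivAt_normSq_sub_add w e z)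
  have e1 := (hr.mul hv).fderiv
  have e2 := (hi.mul hv).fderiv
  simp only [Complex.one_re, mul_one, Complex.one_im, mul_zero, add_zero, Complex.I_re,
    Complex.I_im, zero_add, div_eq_mul_inv]
  erw [e1, e2]
  have hz := hN z
  simp
  rw [Complex.normSq_apply] at hz ⊢
  simp only [Complex.sub_re, Complex.sub_im] at hz ⊢
  field_simp
  ring

/-- `(2π)⁻¹ log |z - w|` is a fundamental solution of the Laplacian in the plane. -/
lemma integral_log_norm_mul_laplacian {ψ : ℂ → ℝ} (hψ : ContDiff ℝ ∞ ψ)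
    (hψc : HasCompactSupport ψ) (w : ℂ) :
    Integrable (fun z => Real.log ‖z - w‖ * Δ ψ z) ∧
    ∫ z, Real.log ‖z - w‖ * Δ ψ z = 2 * Real.pi * ψ w := by
  have hkc := hasCompactSupport_laplacian hψc
  have hks := contDiff_laplacian hψ
  have hlogm : Measurable fun z : ℂ => Real.log ‖z - w‖ := by fun_prop
  have hlogi : LocallyIntegrable fun z : ℂ => Real.log ‖z - w‖ := by
    intro z
    set R := ‖z - w‖ + 2 with hR
    have hR0 : 0 < R := by positivity
    refine ⟨ball w R, isOpen_ball.mem_nhds (by rw [mem_ball, dist_eq_norm]; linarith), ?_⟩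
    have h1 := integrableOn_logKernel (R := R) (z := w) (Λ := ball w R) subset_rfl
    have h2 : IntegrableOn (fun _ : ℂ => Real.log R) (ball w R) :=
      integrableOn_const measure_ball_lt_top.ne
    refine (h2.sub (h1.const_mul (2 * Real.pi))).congr_fun_ae ?_
    refine ae_restrict_of_ae ?_
    filter_upwards [compl_mem_ae_iff.2 (measure_singleton w)] with y hy
    have hy' : w - y ≠ 0 := sub_ne_zero.2 fun h => hy h.symm
    simp only [Pi.sub_apply]
    rw [logKernel_eq hR0 hy', norm_sub_rev y w]
    field_simp
    ring
  have hint : Integrable (fun z => Real.log ‖z - w‖ * Δ ψ z) :=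
    integrable_mul_of_tsupport_subset (hlogi.locallyIntegrableOn univ) hks.continuous hkc
      (subset_univ _)
  refine ⟨hint, ?_⟩
  -- The logarithm is regularised by c⁻² inside ½ log, with c → ∞. One limit recovers log|z - w|;
  -- the other, after moving the Laplacian onto the smooth `L c`, recovers the point mass.
  set L : ℝ → ℂ → ℝ := fun c z => (1 / 2 : ℝ) * Real.log (Complex.normSq (z - w) + (c ^ 2)⁻¹) with hL
  have hlim1 : Tendsto (fun c : ℝ => ∫ z, L c z * Δ ψ z) atTop
      (𝓝 (∫ z, Real.log ‖z - w‖ * Δ ψ z)) := by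
    have hbd1 : Continuous fun z : ℂ => (1 / 2 : ℝ) * Real.log (Complex.normSq (z - w) + 1) :=
      (contDiff_half_log_normSq_sub_add w one_pos).continuous
    have hbi : Integrable fun z : ℂ =>
        ((1 / 2 : ℝ) * Real.log (Complex.normSq (z - w) + 1)) * Δ ψ z :=
      integrable_mul_of_tsupport_subset (hbd1.locallyIntegrable.locallyIntegrableOn univ)
        hks.continuous hkc (subset_univ _)
    -- For c ≥ 1 the regularisation lies between log|z - w| and its value at c = 1, hence the
    -- two-term majorant.
    refine tendsto_integral_filter_of_dominated_convergence
      (fun z => ‖Real.log ‖z - w‖ * Δ ψ z‖ +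
        ‖((1 / 2 : ℝ) * Real.log (Complex.normSq (z - w) + 1)) * Δ ψ z‖) ?_ ?_
      (hint.norm.add hbi.norm) ?_
    · filter_upwards [eventually_gt_atTop 0] with c hc
      exact ((contDiff_half_log_normSq_sub_add w (by positivity)).continuous.mul
        hks.continuous).aestronglyMeasurable
    · filter_upwards [eventually_ge_atTop 1] with c hc
      filter_upwards [compl_mem_ae_iff.2 (measure_singleton w)] with z hz
      have hz' : 0 < ‖z - w‖ := norm_pos_iff.2 (sub_ne_zero.2 hz)
      have hc2 : (c ^ 2)⁻¹ ≤ 1 := inv_le_one_of_one_le₀ (by nlinarith)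
      have hc0 : 0 < (c ^ 2)⁻¹ := by positivity
      have hn := Complex.normSq_eq_norm_sq (z - w)
      have hlow : Real.log ‖z - w‖ ≤ L c z := by
        have : Real.log (‖z - w‖ ^ 2) ≤ Real.log (Complex.normSq (z - w) + (c ^ 2)⁻¹) :=
          Real.log_le_log (by positivity) (by rw [hn]; linarith)
        rw [Real.log_pow] at this
        simp only [hL]
        push_cast at this
        linarith
      have hup : L c z ≤ (1 / 2 : ℝ) * Real.log (Complex.normSq (z - w) + 1) := by
        have := Real.log_le_log (x := Complex.normSq (z - w) + (c ^ 2)⁻¹)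
          (by rw [hn]; positivity) (add_le_add le_rfl hc2)
        simp only [hL]
        linarith
      have e : ∀ a b d : ℝ, ‖a * d‖ + ‖b * d‖ = (‖a‖ + ‖b‖) * ‖d‖ := fun a b d => by
        rw [norm_mul, norm_mul, add_mul]
      rw [e, norm_mul]
      refine mul_le_mul_of_nonneg_right ?_ (norm_nonneg _)
      simp only [Real.norm_eq_abs]
      refine abs_le.2 ⟨?_, ?_⟩
      · linarith [neg_abs_le (Real.log ‖z - w‖),
          abs_nonneg ((1 / 2 : ℝ) * Real.log (Complex.normSq (z - w) + 1))]
      · linarith [le_abs_self ((1 / 2 : ℝ) * Real.log (Complex.normSq (z - w) + 1)),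
          abs_nonneg (Real.log ‖z - w‖)]
    · filter_upwards [compl_mem_ae_iff.2 (measure_singleton w)] with z hz
      have hz' : 0 < ‖z - w‖ := norm_pos_iff.2 (sub_ne_zero.2 hz)
      refine Tendsto.mul_const _ ?_
      have h1 : Tendsto (fun c : ℝ => Complex.normSq (z - w) + (c ^ 2)⁻¹) atTop
          (𝓝 (‖z - w‖ ^ 2)) := by
        have : Tendsto (fun c : ℝ => (c ^ 2)⁻¹) atTop (𝓝 0) :=
          tendsto_inv_atTop_zero.comp (tendsto_pow_atTop (by norm_num))
        simpa [Complex.normSq_eq_norm_sq] using this.const_add (Complex.normSq (z - w))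
      have h2 := ((Real.continuousAt_log (by positivity)).tendsto.comp h1).const_mul (1 / 2 : ℝ)
      have h3 : (1 / 2 : ℝ) * Real.log (‖z - w‖ ^ 2) = Real.log ‖z - w‖ := by
        rw [Real.log_pow]; push_cast; ring
      rw [h3] at h2
      exact h2
  have hlim2 : Tendsto (fun c : ℝ => ∫ z, L c z * Δ ψ z) atTop (𝓝 (2 * Real.pi * ψ w)) := by
    -- The Laplacian of `L c` is 2π c² Φ(c(z - w)), an approximate identity of mass 2π.
    set Φ : ℂ → ℝ := fun u => (2 * Real.pi)⁻¹ * (2 / (Complex.normSq u + 1) ^ 2) with hΦ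
    have hΦ0 : ∀ u, 0 ≤ Φ u := fun u => by
      have := Complex.normSq_nonneg u
      positivity
    have hΦ1 : ∫ u, Φ u = 1 := by
      rw [hΦ, integral_const_mul, integral_two_div_normSq_add_one_sq.2,
        inv_mul_cancel₀ (by positivity)]
    have hΦt : Tendsto (fun u => ‖u‖ ^ Module.finrank ℝ ℂ * Φ u) (Bornology.cobounded ℂ) (𝓝 0) := by
      have h1 : Tendsto (fun u : ℂ => (‖u‖ ^ 2)⁻¹) (Bornology.cobounded ℂ) (𝓝 0) :=
        tendsto_inv_atTop_zero.comp
          ((tendsto_pow_atTop (by norm_num)).comp tendsto_norm_cobounded_atTop)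
      refine squeeze_zero (fun u => mul_nonneg (by positivity) (hΦ0 u)) (fun u => ?_) h1
      rw [Complex.finrank_real_complex]
      rcases eq_or_ne u 0 with rfl | hu
      · simp
      have hu' : 0 < ‖u‖ := norm_pos_iff.2 hu
      simp only [hΦ, Complex.normSq_eq_norm_sq]
      have hpi : (2 * Real.pi)⁻¹ * 2 ≤ 1 := by
        rw [inv_mul_le_iff₀ (by positivity)]; linarith [Real.pi_gt_three]
      have h2 : ‖u‖ ^ 2 * (1 / (‖u‖ ^ 2 + 1) ^ 2) ≤ (‖u‖ ^ 2)⁻¹ := by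
        rw [mul_one_div, div_le_iff₀ (by positivity)]
        rw [inv_mul_eq_div, le_div_iff₀ (by positivity)]
        nlinarith [sq_nonneg ‖u‖]
      calc ‖u‖ ^ 2 * ((2 * Real.pi)⁻¹ * (2 / (‖u‖ ^ 2 + 1) ^ 2))
          = ((2 * Real.pi)⁻¹ * 2) * (‖u‖ ^ 2 * (1 / (‖u‖ ^ 2 + 1) ^ 2)) := by ring
        _ ≤ 1 * (‖u‖ ^ 2 * (1 / (‖u‖ ^ 2 + 1) ^ 2)) :=
          mul_le_mul_of_nonneg_right hpi (by positivity)
        _ ≤ _ := by rw [one_mul]; exact h2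
    have hmain := (tendsto_integral_comp_smul_smul_of_integrable' (μ := volume) hΦ0 hΦ1 hΦt
      (hψ.continuous.integrable_of_hasCompactSupport hψc)
      (hψ.continuous.continuousAt (x := w))).const_mul (2 * Real.pi)
    refine hmain.congr' ?_
    filter_upwards [eventually_gt_atTop 0] with c hc
    have hc2 : 0 < (c ^ 2)⁻¹ := by positivity
    rw [integral_mul_laplacian isOpen_univ (fun x _ =>
      (contDiff_half_log_normSq_sub_add w hc2).contDiffAt.of_le two_le_infty) hψ hψc (subset_univ _),
      ← integral_const_mul]
    congr 1 with z
    rw [laplacian_half_log_normSq_sub_add w hc2, Complex.finrank_real_complex]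
    simp only [hΦ, smul_eq_mul, Complex.normSq_eq_norm_sq, norm_smul, Real.norm_eq_abs, abs_of_pos hc,
      norm_sub_rev w z]
    have : 0 < ‖z - w‖ ^ 2 + (c ^ 2)⁻¹ := by positivity
    field_simp
  exact tendsto_nhds_unique hlim1 hlim2

lemma integral_logKernel_mul_neg_laplacian {R : ℝ} (hR : 0 < R) {ψ : ℂ → ℝ} (hψ : ContDiff ℝ ∞ ψ)
    (hψc : HasCompactSupport ψ) (w : ℂ) :
    Integrable (fun z => logKernel R (z - w) * (-Δ ψ z)) ∧
    ∫ z, logKernel R (z - w) * (-Δ ψ z) = ψ w := by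
  obtain ⟨hi, hv⟩ := integral_log_norm_mul_laplacian hψ hψc w
  have h0 : ∫ z, Real.log R * Δ ψ z = 0 := by
    rw [integral_mul_laplacian isOpen_univ (f := fun _ => Real.log R)
      (fun x _ => contDiffAt_const) hψ hψc (subset_univ _)]
    simp
  have hc : Integrable fun z => Real.log R * Δ ψ z :=
    ((contDiff_laplacian hψ).continuous.integrable_of_hasCompactSupport
      (hasCompactSupport_laplacian hψc)).const_mul _
  have he : (fun z => (2 * Real.pi)⁻¹ * (Real.log ‖z - w‖ * Δ ψ z - Real.log R * Δ ψ z)) =ᵐ[volume]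
      fun z => logKernel R (z - w) * (-Δ ψ z) := by
    filter_upwards [compl_mem_ae_iff.2 (measure_singleton w)] with z hz
    rw [logKernel_eq hR (sub_ne_zero.2 hz)]
    ring
  refine ⟨((hi.sub hc).const_mul _).congr he, ?_⟩
  rw [← integral_congr_ae he, integral_const_mul, integral_sub hi hc, hv, h0]
  field_simp
  ring

end FundamentalSolution

end

end MassiveHadamard

namespace MassiveHadamard

noncomputable section

open Set Filter MeasureTheory Metric InnerProductSpace
open scoped Laplacian Convolution

/-! ### The massless Green operator on L². -/

section GreenKernel

/-- The logarithmic kernel has the same point mass and is nonnegative on a domain contained in the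
ball of radius R about the pole, so the minimum principle applies to the difference. -/
lemma IsMassiveGreen.le_logKernel {Λ : Set ℂ} (hΛ : IsOpen Λ) {R : ℝ} {w : ℂ} {g : ℂ → ℝ}
    (hR : 0 < R) (hb : Λ ⊆ ball w R) (h : IsMassiveGreen 0 Λ w g) {z : ℂ} (hz : z ∈ Λ) (hzw : z ≠ w) :
    g z ≤ logKernel R (w - z) := by
  have hbd : Bornology.IsBounded Λ := isBounded_ball.subset hb
  have hli : LocallyIntegrableOn (fun z => logKernel R (w - z)) Λ :=
    (integrableOn_logKernel hb).locallyIntegrableOn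
  have := weak_minimum_principle hΛ hbd (lam := 0) le_rfl (w := w)
    (h := fun z => logKernel R (w - z) - g z) (ContinuousOn.sub ?_ h.continuousOn)
    (hli.sub h.locallyIntegrableOn) ?_ ?_ z hz hzw
  · simpa using this
  · intro x hx
    refine ContinuousAt.continuousWithinAt ?_
    exact (continuousAt_logKernel hR (sub_ne_zero.2 fun e => hx.2 e.symm)).comp
      (f := fun z => w - z) (by fun_prop)
  · intro ψ hψ hψc hψΛ _
    simp_rw [sub_mul]
    rw [integral_sub (integrableOn_mul_helmholtz hli 0 hψ hψc hψΛ)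
      (integrableOn_mul_helmholtz h.locallyIntegrableOn 0 hψ hψc hψΛ)]
    have h1 := h.weak ψ hψ hψc hψΛ
    have h2 := (integral_logKernel_mul_neg_laplacian hR hψ hψc w).2
    rw [← setIntegral_eq_integral_of_forall_compl_eq_zero (s := Λ)] at h2
    · have e1 : ∀ z, logKernel R (w - z) * (0 * ψ z - Δ ψ z) = logKernel R (z - w) * (-Δ ψ z) :=
        fun z => by rw [logKernel_sub_comm]; ring
      have e2 : ∀ z, g z * (0 * ψ z - Δ ψ z) = g z * (0 ^ 2 * ψ z - Δ ψ z) := fun z => by ring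
      simp_rw [e1, e2]
      rw [h1, h2, sub_self]
    · intro x hx
      rw [image_eq_zero_of_notMem_tsupport fun h' => hx (hψΛ (tsupport_laplacian_subset ψ h'))]
      simp
  · intro ζ hζ η hη
    filter_upwards [(h.boundary ζ hζ).eventually (gt_mem_nhds hη), self_mem_nhdsWithin] with x hx hxΛ
    have : 0 ≤ logKernel R (w - x) := logKernel_nonneg (by
      rw [← dist_eq_norm, dist_comm]; exact (mem_ball.1 (hb hxΛ)).le)
    linarith

/-- A symmetric kernel on a bounded open set whose sections are Dirichlet Green functions of the
Laplacian. -/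
structure GreenKernel (Λ : Set ℂ) (R : ℝ) (G : ℂ → ℂ → ℝ) : Prop where
  isOpen : IsOpen Λ
  pos : 0 < R
  subset_ball : ∀ z ∈ Λ, Λ ⊆ ball z R
  symm : ∀ x y, G x y = G y x
  nonneg : ∀ x ∈ Λ, ∀ y ∈ Λ, 0 ≤ G x y
  diag : ∀ x, G x x = 0
  cont : ContinuousOn (fun p : ℂ × ℂ => G p.1 p.2) {p | p.1 ∈ Λ ∧ p.2 ∈ Λ ∧ p.1 ≠ p.2}
  green : ∀ w ∈ Λ, IsMassiveGreen 0 Λ w (G w)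

/-- The integral operator with kernel `G` on `Λ`. -/
def greenOp (Λ : Set ℂ) (G : ℂ → ℂ → ℝ) (f : ℂ → ℝ) (z : ℂ) : ℝ := ∫ y in Λ, G z y * f y

namespace GreenKernel

variable {Λ : Set ℂ} {R : ℝ} {G : ℂ → ℂ → ℝ} (hG : GreenKernel Λ R G)

include hG

lemma isBounded : Bornology.IsBounded Λ := by
  rcases Λ.eq_empty_or_nonempty with rfl | ⟨z, hz⟩
  · exact Bornology.isBounded_empty
  · exact isBounded_ball.subset (hG.subset_ball z hz)

lemma volume_lt_top : volume Λ < ⊤ := hG.isBounded.measure_lt_top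

lemma isFiniteMeasure : IsFiniteMeasure (volume.restrict Λ) :=
  ⟨by rw [Measure.restrict_apply_univ]; exact hG.volume_lt_top⟩

lemma le_logKernel {x y : ℂ} (hx : x ∈ Λ) (hy : y ∈ Λ) : G x y ≤ logKernel R (x - y) := by
  rcases eq_or_ne y x with rfl | h
  · rw [hG.diag]; simp [logKernel]
  · exact (hG.green x hx).le_logKernel hG.isOpen hG.pos (hG.subset_ball x hx) hy h

lemma aestronglyMeasurable {z : ℂ} (hz : z ∈ Λ) :
    AEStronglyMeasurable (G z) (volume.restrict Λ) :=
  (hG.green z hz).locallyIntegrableOn.aestronglyMeasurable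

lemma memLp {z : ℂ} (hz : z ∈ Λ) : MemLp (G z) 2 (volume.restrict Λ) := by
  refine (memLp_two_iff_integrable_sq (hG.aestronglyMeasurable hz)).2 ?_
  refine Integrable.mono' (integrableOn_logKernel_sq (hG.subset_ball z hz))
    ((hG.aestronglyMeasurable hz).pow 2) ?_
  refine (ae_restrict_iff' hG.isOpen.measurableSet).2 (ae_of_all _ fun y hy => ?_)
  rw [Real.norm_of_nonneg (by positivity)]
  exact pow_le_pow_left₀ (hG.nonneg z hz y hy) (hG.le_logKernel hz hy) 2

lemma integrable_mul {z : ℂ} (hz : z ∈ Λ) {f : ℂ → ℝ} (hf : MemLp f 2 (volume.restrict Λ)) :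
    IntegrableOn (fun y => G z y * f y) Λ :=
  (hG.memLp hz).integrable_mul hf

/-- The integral of the square of the Green function is bounded uniformly in the pole. -/
lemma integral_pow_four_le {z : ℂ} (hz : z ∈ Λ) :
    IntegrableOn (fun y => G z y ^ 4) Λ ∧
      ∫ y in Λ, G z y ^ 4 ≤ ∫ y in ball 0 R, logKernel R y ^ 4 := by
  have hle : ∀ y ∈ Λ, G z y ^ 4 ≤ logKernel R (z - y) ^ 4 := fun y hy =>
    pow_le_pow_left₀ (hG.nonneg z hz y hy) (hG.le_logKernel hz hy) 4
  have hi := integrableOn_logKernel_pow (hG.subset_ball z hz)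
  have h1 : IntegrableOn (fun y => G z y ^ 4) Λ := by
    refine Integrable.mono' hi ((hG.aestronglyMeasurable hz).pow 4) ?_
    refine (ae_restrict_iff' hG.isOpen.measurableSet).2 (ae_of_all _ fun y hy => ?_)
    rw [Real.norm_of_nonneg (by positivity)]
    exact hle y hy
  exact ⟨h1, (setIntegral_mono_on h1 hi hG.isOpen.measurableSet hle).trans
    (integral_logKernel_pow_le (hG.subset_ball z hz))⟩

/-- A bound for `∫ G(z, y) |f y| dy`, uniform in `z`. -/
lemma integral_mul_abs_le {z : ℂ} (hz : z ∈ Λ) {f : ℂ → ℝ} (hf : MemLp f 2 (volume.restrict Λ)) :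
    ∫ y in Λ, G z y * |f y| ≤
      volume.real Λ + (∫ y in ball 0 R, logKernel R y ^ 4) + ∫ y in Λ, f y ^ 2 := by
  have := hG.isFiniteMeasure
  obtain ⟨h4, h4'⟩ := hG.integral_pow_four_le hz
  have h2 : IntegrableOn (fun y => f y ^ 2) Λ := hf.integrable_sq
  have h1 : IntegrableOn (fun _ : ℂ => (1 : ℝ)) Λ := integrableOn_const hG.volume_lt_top.ne
  have h14 : IntegrableOn (fun y => 1 + G z y ^ 4) Λ := h1.add h4
  calc ∫ y in Λ, G z y * |f y| ≤ ∫ y in Λ, (1 + G z y ^ 4 + f y ^ 2) := by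
        refine setIntegral_mono_on (hG.integrable_mul hz hf.abs) (h14.add h2)
          hG.isOpen.measurableSet fun y hy => ?_
        nlinarith [sq_nonneg (G z y - |f y|), sq_abs (f y), sq_le_one_add_pow_four (G z y),
          sq_nonneg (f y)]
    _ = volume.real Λ + (∫ y in Λ, G z y ^ 4) + ∫ y in Λ, f y ^ 2 := by
        rw [integral_add h14 h2, integral_add h1 h4]
        simp
    _ ≤ _ := by linarith

lemma abs_greenOp_le {z : ℂ} (hz : z ∈ Λ) {f : ℂ → ℝ} (hf : MemLp f 2 (volume.restrict Λ)) :
    |greenOp Λ G f z| ≤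
      volume.real Λ + (∫ y in ball 0 R, logKernel R y ^ 4) + ∫ y in Λ, f y ^ 2 := by
  refine le_trans ?_ (hG.integral_mul_abs_le hz hf)
  rw [greenOp, ← Real.norm_eq_abs]
  refine (norm_integral_le_integral_norm _).trans_eq ?_
  refine setIntegral_congr_fun hG.isOpen.measurableSet fun y hy => ?_
  simp only [norm_mul, Real.norm_eq_abs, abs_of_nonneg (hG.nonneg z hz y hy)]

lemma memLp_min {z : ℂ} (hz : z ∈ Λ) (k : ℝ) :
    MemLp (fun y => min (G z y) k) 2 (volume.restrict Λ) := by
  have := hG.isFiniteMeasure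
  exact (hG.memLp hz).inf (memLp_const k)

/-- Since G - min(G, k) ≤ G²/k and G²|f| ≤ G⁴ + f², cutting the singularity costs O(1/k) uniformly
in z. Continuity and boundary decay of `greenOp` then pass from bounded kernels to the limit. -/
lemma abs_greenOp_sub_truncated_le {z : ℂ} (hz : z ∈ Λ) {f : ℂ → ℝ}
    (hf : MemLp f 2 (volume.restrict Λ)) {k : ℝ} (hk : 0 < k) :
    |greenOp Λ G f z - ∫ y in Λ, min (G z y) k * f y| ≤
      k⁻¹ * ((∫ y in ball 0 R, logKernel R y ^ 4) + ∫ y in Λ, f y ^ 2) := by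
  obtain ⟨h4, h4'⟩ := hG.integral_pow_four_le hz
  have h2 : IntegrableOn (fun y => f y ^ 2) Λ := hf.integrable_sq
  have hm : IntegrableOn (fun y => min (G z y) k * f y) Λ := (hG.memLp_min hz k).integrable_mul hf
  rw [greenOp, ← integral_sub (hG.integrable_mul hz hf) hm, ← Real.norm_eq_abs]
  calc ‖∫ y in Λ, (G z y * f y - min (G z y) k * f y)‖
      ≤ ∫ y in Λ, k⁻¹ * (G z y ^ 4 + f y ^ 2) := by
        refine norm_integral_le_of_norm_le ((h4.add h2).const_mul _) ?_
        refine (ae_restrict_iff' hG.isOpen.measurableSet).2 (ae_of_all _ fun y hy => ?_)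
        have hg := hG.nonneg z hz y hy
        rw [← sub_mul, norm_mul, Real.norm_eq_abs, Real.norm_eq_abs,
          abs_of_nonneg (sub_nonneg.2 (min_le_left _ _)), le_inv_mul_iff₀ hk]
        have h1 : k * (G z y - min (G z y) k) ≤ G z y ^ 2 := by
          rcases le_total (G z y) k with h | h
          · rw [min_eq_left h]; nlinarith
          · rw [min_eq_right h]; nlinarith
        calc k * ((G z y - min (G z y) k) * |f y|)
            = k * (G z y - min (G z y) k) * |f y| := by ring
          _ ≤ G z y ^ 2 * |f y| := mul_le_mul_of_nonneg_right h1 (abs_nonneg _)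
          _ ≤ _ := by nlinarith [sq_nonneg (G z y ^ 2 - |f y|), sq_abs (f y), sq_nonneg (f y),
                sq_nonneg (G z y ^ 2)]
    _ ≤ _ := by
        rw [integral_const_mul, integral_add h4 h2]
        have : 0 < k⁻¹ := by positivity
        exact mul_le_mul_of_nonneg_left (by linarith) this.le

lemma tendsto_truncated_uniformly {f : ℂ → ℝ} (hf : MemLp f 2 (volume.restrict Λ)) :
    TendstoUniformlyOn (fun (k : ℝ) z => ∫ y in Λ, min (G z y) k * f y) (greenOp Λ G f) atTop Λ := by
  rw [Metric.tendstoUniformlyOn_iff]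
  intro ε hε
  have h0 : Tendsto (fun k : ℝ => k⁻¹ * ((∫ y in ball 0 R, logKernel R y ^ 4) + ∫ y in Λ, f y ^ 2))
      atTop (𝓝 0) := by
    simpa using tendsto_inv_atTop_zero.mul_const
      ((∫ y in ball 0 R, logKernel R y ^ 4) + ∫ y in Λ, f y ^ 2)
  filter_upwards [h0.eventually (gt_mem_nhds hε), eventually_gt_atTop 0] with k hk hk0 z hz
  rw [Real.dist_eq]
  exact (hG.abs_greenOp_sub_truncated_le hz hf hk0).trans_lt hk

/-- The truncated kernel is bounded by k, so dominated convergence applies along any countably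
generated filter; it serves at interior points and at boundary points alike. -/
lemma tendsto_truncated {f : ℂ → ℝ} (hf : MemLp f 2 (volume.restrict Λ)) {k : ℝ} (hk : 0 ≤ k)
    {l : Filter ℂ} [l.IsCountablyGenerated] (hl : ∀ᶠ z in l, z ∈ Λ) {g : ℂ → ℝ}
    (hg : ∀ᵐ y ∂(volume.restrict Λ), Tendsto (fun z => G z y) l (𝓝 (g y))) :
    Tendsto (fun z => ∫ y in Λ, min (G z y) k * f y) l (𝓝 (∫ y in Λ, min (g y) k * f y)) := by
  have := hG.isFiniteMeasure
  refine tendsto_integral_filter_of_dominated_convergence (fun y => k * |f y|) ?_ ?_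
    ((hf.integrable (by norm_num)).abs.const_mul k) ?_
  · filter_upwards [hl] with z hz using
      (hG.memLp_min hz k).aestronglyMeasurable.mul hf.aestronglyMeasurable
  · filter_upwards [hl] with z hz
    refine (ae_restrict_iff' hG.isOpen.measurableSet).2 (ae_of_all _ fun y hy => ?_)
    rw [norm_mul, Real.norm_eq_abs, Real.norm_eq_abs,
      abs_of_nonneg (le_min (hG.nonneg z hz y hy) hk)]
    exact mul_le_mul_of_nonneg_right (min_le_right _ _) (abs_nonneg _)
  · filter_upwards [hg] with y hy
    exact (hy.min tendsto_const_nhds).mul_const _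

lemma continuousAt_left {y z : ℂ} (hy : y ∈ Λ) (hz : z ∈ Λ) (h : z ≠ y) :
    ContinuousAt (fun z => G z y) z := by
  have h1 := (hG.green y hy).continuousOn.continuousAt
    ((hG.isOpen.sdiff isClosed_singleton).mem_nhds ⟨hz, h⟩)
  exact h1.congr (Eventually.of_forall fun z => hG.symm y z)

lemma continuousOn_greenOp {f : ℂ → ℝ} (hf : MemLp f 2 (volume.restrict Λ)) :
    ContinuousOn (greenOp Λ G f) Λ := by
  refine (hG.tendsto_truncated_uniformly hf).continuousOn (Eventually.frequently ?_)
  filter_upwards [eventually_ge_atTop 0] with k hk z hz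
  refine hG.tendsto_truncated hf hk (eventually_mem_nhdsWithin) ?_
  refine (ae_restrict_iff' hG.isOpen.measurableSet).2 ?_
  filter_upwards [compl_mem_ae_iff.2 (measure_singleton z)] with y hy hyΛ
  exact (hG.continuousAt_left hyΛ hz fun h => hy h.symm).continuousWithinAt

lemma tendsto_greenOp_frontier {f : ℂ → ℝ} (hf : MemLp f 2 (volume.restrict Λ)) {ζ : ℂ}
    (hζ : ζ ∈ frontier Λ) : Tendsto (greenOp Λ G f) (𝓝[Λ] ζ) (𝓝 0) := by
  have hu : TendstoUniformlyOnFilter (fun (k : ℝ) z => ∫ y in Λ, min (G z y) k * f y)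
      (greenOp Λ G f) atTop (𝓝[Λ] ζ) :=
    (hG.tendsto_truncated_uniformly hf).tendstoUniformlyOnFilter.mono_right
      (le_principal_iff.2 self_mem_nhdsWithin)
  rw [Metric.tendsto_nhds]
  intro ε hε
  have h1 := Metric.tendstoUniformlyOn_iff.1 (hG.tendsto_truncated_uniformly hf) (ε / 2) (by positivity)
  obtain ⟨k, hk, hk0⟩ := (h1.and (eventually_ge_atTop 0)).exists
  have h2 := hG.tendsto_truncated hf hk0 (l := 𝓝[Λ] ζ) (g := fun _ => 0) eventually_mem_nhdsWithin
    ((ae_restrict_iff' hG.isOpen.measurableSet).2 (ae_of_all _ fun y hy => by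
      exact ((hG.green y hy).boundary ζ hζ).congr fun z => hG.symm y z))
  simp only [min_eq_left hk0, zero_mul, integral_zero] at h2
  filter_upwards [Metric.tendsto_nhds.1 h2 (ε / 2) (by positivity), self_mem_nhdsWithin] with z hz hzΛ
  calc dist (greenOp Λ G f z) 0 ≤ _ := dist_triangle _ (∫ y in Λ, min (G z y) k * f y) _
    _ < ε / 2 + ε / 2 := add_lt_add (hk z hzΛ) hz
    _ = ε := add_halves ε

lemma memLp_greenOp {f : ℂ → ℝ} (hf : MemLp f 2 (volume.restrict Λ)) :
    MemLp (greenOp Λ G f) 2 (volume.restrict Λ) := by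
  have := hG.isFiniteMeasure
  refine MemLp.of_bound
    ((hG.continuousOn_greenOp hf).aestronglyMeasurable hG.isOpen.measurableSet)
    (volume.real Λ + (∫ y in ball 0 R, logKernel R y ^ 4) + ∫ y in Λ, f y ^ 2) ?_
  exact (ae_restrict_iff' hG.isOpen.measurableSet).2 (ae_of_all _ fun y hy =>
    hG.abs_greenOp_le hy hf)

/-- Joint continuity is available only off the diagonal, which is a null set by Fubini. -/
lemma aestronglyMeasurable_uncurry :
    AEStronglyMeasurable (fun p : ℂ × ℂ => G p.1 p.2)
      ((volume.restrict Λ).prod (volume.restrict Λ)) := by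
  have hd : MeasurableSet {p : ℂ × ℂ | p.1 = p.2} := measurableSet_eq_fun measurable_fst measurable_snd
  have hS : MeasurableSet {p : ℂ × ℂ | p.1 ∈ Λ ∧ p.2 ∈ Λ ∧ p.1 ≠ p.2} :=
    (measurable_fst hG.isOpen.measurableSet).inter
      ((measurable_snd hG.isOpen.measurableSet).inter hd.compl)
  have h1 := hG.cont.aestronglyMeasurable hS (μ := (volume : Measure (ℂ × ℂ)))
  rw [Measure.prod_restrict]
  refine h1.mono_ac ?_
  refine Measure.absolutelyContinuous_of_le (Measure.le_iff.2 fun s hs => ?_)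
  rw [Measure.restrict_apply hs, Measure.restrict_apply hs]
  have hnull : (volume : Measure (ℂ × ℂ)) {p : ℂ × ℂ | p.1 = p.2} = 0 := by
    rw [Measure.volume_eq_prod, Measure.measure_prod_null hd]
    refine ae_of_all _ fun x => ?_
    have : Prod.mk x ⁻¹' {p : ℂ × ℂ | p.1 = p.2} = {x} := by ext y; simp [eq_comm]
    simp [this]
  refine (measure_mono (t := (s ∩ {p : ℂ × ℂ | p.1 ∈ Λ ∧ p.2 ∈ Λ ∧ p.1 ≠ p.2}) ∪
    {p : ℂ × ℂ | p.1 = p.2}) ?_).trans ((measure_union_le _ _).trans_eq ?_)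
  · rintro ⟨x, y⟩ ⟨hxs, hx, hy⟩
    by_cases h : x = y
    · exact Or.inr h
    · exact Or.inl ⟨hxs, hx, hy, h⟩
  · rw [← Measure.volume_eq_prod, hnull, add_zero]

/-- A Schur test: ∫ G(x, y) dy is bounded uniformly in x. It supplies the majorant G(f² + g²) that
justifies Fubini in the symmetry of the operator. -/
lemma integrable_prod_mul_sq {f : ℂ → ℝ} (hf : MemLp f 2 (volume.restrict Λ)) :
    Integrable (fun p : ℂ × ℂ => G p.1 p.2 * f p.1 ^ 2)
      ((volume.restrict Λ).prod (volume.restrict Λ)) := by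
  have := hG.isFiniteMeasure
  have hae : AEStronglyMeasurable (fun p : ℂ × ℂ => G p.1 p.2 * f p.1 ^ 2)
      ((volume.restrict Λ).prod (volume.restrict Λ)) :=
    hG.aestronglyMeasurable_uncurry.mul
      (hf.aestronglyMeasurable.comp_fst (ν := volume.restrict Λ) |>.pow 2)
  rw [integrable_prod_iff hae]
  have h1 : MemLp (fun _ : ℂ => (1 : ℝ)) 2 (volume.restrict Λ) := memLp_const 1
  constructor
  · refine (ae_restrict_iff' hG.isOpen.measurableSet).2 (ae_of_all _ fun x hx => ?_)
    simpa using (hG.integrable_mul hx h1).mul_const (f x ^ 2)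
  · set C := volume.real Λ + (∫ y in ball 0 R, logKernel R y ^ 4) + ∫ y in Λ, (1 : ℝ) ^ 2
    refine Integrable.mono' (hf.integrable_sq.const_mul C) hae.norm.integral_prod_right' ?_
    refine (ae_restrict_iff' hG.isOpen.measurableSet).2 (ae_of_all _ fun x hx => ?_)
    rw [Real.norm_of_nonneg (integral_nonneg fun _ => norm_nonneg _)]
    have h2 := hG.integral_mul_abs_le hx h1
    simp only [norm_mul, Real.norm_eq_abs, abs_pow, sq_abs, integral_mul_const]
    refine mul_le_mul_of_nonneg_right (le_trans (le_of_eq ?_) h2) (by positivity)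
    refine setIntegral_congr_fun hG.isOpen.measurableSet fun y hy => ?_
    simp [abs_of_nonneg (hG.nonneg x hx y hy)]

/-- The Green operator is symmetric on `L²`. -/
lemma integral_mul_greenOp_comm {f g : ℂ → ℝ} (hf : MemLp f 2 (volume.restrict Λ))
    (hg : MemLp g 2 (volume.restrict Λ)) :
    ∫ z in Λ, g z * greenOp Λ G f z = ∫ z in Λ, f z * greenOp Λ G g z := by
  have := hG.isFiniteMeasure
  have i1 := hG.integrable_prod_mul_sq hg
  have i2 : Integrable (fun p : ℂ × ℂ => G p.1 p.2 * f p.2 ^ 2)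
      ((volume.restrict Λ).prod (volume.restrict Λ)) := by
    have := (hG.integrable_prod_mul_sq hf).swap
    refine this.congr (ae_of_all _ fun p => ?_)
    simp [hG.symm p.2 p.1]
  have hae : AEStronglyMeasurable (fun p : ℂ × ℂ => g p.1 * (G p.1 p.2 * f p.2))
      ((volume.restrict Λ).prod (volume.restrict Λ)) :=
    (hg.aestronglyMeasurable.comp_fst (ν := volume.restrict Λ)).mul
      (hG.aestronglyMeasurable_uncurry.mul
        (hf.aestronglyMeasurable.comp_snd (μ := volume.restrict Λ)))
  have hi : Integrable (fun p : ℂ × ℂ => g p.1 * (G p.1 p.2 * f p.2))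
      ((volume.restrict Λ).prod (volume.restrict Λ)) := by
    refine Integrable.mono' (i1.add i2) hae ?_
    rw [Measure.prod_restrict]
    refine (ae_restrict_iff' (hG.isOpen.measurableSet.prod hG.isOpen.measurableSet)).2
      (ae_of_all _ fun p hp => ?_)
    have h0 := hG.nonneg p.1 hp.1 p.2 hp.2
    simp only [norm_mul, Real.norm_eq_abs, Pi.add_apply, abs_of_nonneg h0]
    have : |g p.1| * |f p.2| ≤ g p.1 ^ 2 + f p.2 ^ 2 := by
      nlinarith [sq_nonneg (|g p.1| - |f p.2|), sq_abs (g p.1), sq_abs (f p.2), sq_nonneg (g p.1),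
        sq_nonneg (f p.2)]
    calc |g p.1| * (G p.1 p.2 * |f p.2|) = G p.1 p.2 * (|g p.1| * |f p.2|) := by ring
      _ ≤ G p.1 p.2 * (g p.1 ^ 2 + f p.2 ^ 2) := mul_le_mul_of_nonneg_left this h0
      _ = _ := by ring
  have h1 := integral_integral_swap (f := fun z y => g z * (G z y * f y)) hi
  simp only [greenOp]
  simp_rw [← integral_const_mul]
  rw [h1]
  congr 1 with y
  congr 1 with z
  rw [hG.symm z y]; ring

/-- By duality: symmetry moves the operator onto -Δψ, and the Green operator of -Δψ is ψ by the
defining property of each section of G. -/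
lemma integral_greenOp_mul_neg_laplacian {f : ℂ → ℝ} (hf : MemLp f 2 (volume.restrict Λ))
    {ψ : ℂ → ℝ} (hψ : ContDiff ℝ ∞ ψ) (hψc : HasCompactSupport ψ) (hψΛ : tsupport ψ ⊆ Λ) :
    ∫ z in Λ, greenOp Λ G f z * (-Δ ψ z) = ∫ z in Λ, f z * ψ z := by
  have := hG.isFiniteMeasure
  have hL : MemLp (fun z => -Δ ψ z) 2 (volume.restrict Λ) :=
    ((contDiff_laplacian hψ).continuous.memLp_of_hasCompactSupport
      (hasCompactSupport_laplacian hψc)).neg.restrict Λ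
  have h1 := hG.integral_mul_greenOp_comm hf hL
  simp_rw [mul_comm (-Δ ψ _)] at h1
  rw [h1]
  refine setIntegral_congr_fun hG.isOpen.measurableSet fun z hz => ?_
  have h2 := (hG.green z hz).weak ψ hψ hψc hψΛ
  simp only [greenOp]
  rw [← h2]
  congr 1
  congr 1 with y
  ring

end GreenKernel

end GreenKernel

end

end MassiveHadamard

namespace MassiveHadamard

noncomputable section

open Set Filter MeasureTheory Metric InnerProductSpace
open scoped Laplacian BoundedContinuousFunction

/-! ### The resolvent of the Green operator. -/

section ContinuityMethod

/-- The continuity method: an a priori bound for the equations `f + lam • T f = g`, uniform in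
`lam ∈ [0, M]`, implies their solvability. -/
lemma isUnit_one_add_smul_of_apriori {X : Type*} [NormedAddCommGroup X] [NormedSpace ℝ X]
    [CompleteSpace X] (T : X →L[ℝ] X) {M C : ℝ} (hC : 0 ≤ C)
    (h : ∀ lam ∈ Icc 0 M, ∀ f : X, ‖f‖ ≤ C * ‖f + lam • T f‖) :
    ∀ lam ∈ Icc 0 M, IsUnit (1 + lam • T) := by
  -- The a priori bound says that every inverse found so far has norm at most C, so a Neumann series
  -- always advances by the same length ε, and finitely many steps reach lam.
  set ε : ℝ := 1 / (2 * (C * ‖T‖ + 1)) with hε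
  have hε0 : 0 < ε := by positivity
  have hε1 : ε * (C * ‖T‖) < 1 := by
    rw [hε, one_div_mul_eq_div, div_lt_one (by positivity)]
    have : 0 ≤ C * ‖T‖ := by positivity
    linarith
  have key : ∀ n : ℕ, ∀ lam ∈ Icc 0 M, lam ≤ n * ε → IsUnit (1 + lam • T) := by
    intro n
    induction n with
    | zero =>
      intro lam hl hle
      have : lam = 0 := le_antisymm (by simpa using hle) hl.1
      simp [this]
    | succ n ih =>
      intro lam hl hle
      rcases le_total lam (n * ε) with h' | h'
      · exact ih lam hl h'
      set l₀ : ℝ := n * ε with hl₀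
      have hl₀m : l₀ ∈ Icc 0 M := ⟨by positivity, h'.trans hl.2⟩
      obtain ⟨u, hu⟩ := ih l₀ hl₀m le_rfl
      have hinv : ‖(↑u⁻¹ : X →L[ℝ] X)‖ ≤ C := by
        refine ContinuousLinearMap.opNorm_le_bound _ hC fun g => ?_
        have h1 := h l₀ hl₀m ((↑u⁻¹ : X →L[ℝ] X) g)
        have h2 : (1 + l₀ • T) ((↑u⁻¹ : X →L[ℝ] X) g) = g := by
          rw [← hu, ← mul_apply_eq_comp, Units.mul_inv, one_apply_eq_self]
        have h3 : (↑u⁻¹ : X →L[ℝ] X) g + l₀ • T ((↑u⁻¹ : X →L[ℝ] X) g) = g := by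
          simpa using h2
        rwa [h3] at h1
      have hd : 0 ≤ lam - l₀ ∧ lam - l₀ ≤ ε := by
        push_cast at hle
        constructor <;> linarith
      have hsmall : ‖-((lam - l₀) • ((↑u⁻¹ : X →L[ℝ] X) * T))‖ < 1 := by
        rw [norm_neg, norm_smul, Real.norm_of_nonneg hd.1]
        calc (lam - l₀) * ‖(↑u⁻¹ : X →L[ℝ] X) * T‖ ≤ ε * (C * ‖T‖) := by
              gcongr
              · exact hd.2
              · exact (norm_mul_le _ _).trans (mul_le_mul_of_nonneg_right hinv (norm_nonneg _))
          _ < 1 := hε1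
      have hprod : (1 + lam • T) =
          (u : X →L[ℝ] X) * (1 - (-((lam - l₀) • ((↑u⁻¹ : X →L[ℝ] X) * T)))) := by
        rw [sub_neg_eq_add, mul_add, mul_one, mul_smul_comm, ← mul_assoc, Units.mul_inv, one_mul, hu,
          sub_smul]
        abel
      rw [hprod]
      exact u.isUnit.mul (isUnit_one_sub_of_norm_lt_one hsmall)
  intro lam hl
  obtain ⟨n, hn⟩ := exists_nat_ge (lam / ε)
  exact key n lam hl ((div_le_iff₀ hε0).1 hn)

end ContinuityMethod

namespace GreenKernel

variable {Λ : Set ℂ} {R : ℝ} {G : ℂ → ℂ → ℝ} (hG : GreenKernel Λ R G)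

include hG

lemma greenOp_add {f g : ℂ → ℝ} (hf : MemLp f 2 (volume.restrict Λ))
    (hg : MemLp g 2 (volume.restrict Λ)) {z : ℂ} (hz : z ∈ Λ) :
    greenOp Λ G (fun y => f y + g y) z = greenOp Λ G f z + greenOp Λ G g z := by
  simp only [greenOp, mul_add]
  exact integral_add (hG.integrable_mul hz hf) (hG.integrable_mul hz hg)

omit hG in
lemma _root_.MassiveHadamard.greenOp_const_mul (c : ℝ) (f : ℂ → ℝ) (z : ℂ) :
    greenOp Λ G (fun y => c * f y) z = c * greenOp Λ G f z := by
  simp only [greenOp, ← integral_const_mul]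
  congr 1 with y
  ring

omit hG in
lemma _root_.MassiveHadamard.greenOp_congr {f g : ℂ → ℝ} (h : f =ᵐ[volume.restrict Λ] g) (z : ℂ) :
    greenOp Λ G f z = greenOp Λ G g z := by
  refine integral_congr_ae ?_
  filter_upwards [h] with y hy
  rw [hy]

/-- The maximum principle for the operator `(1 + lam T)⁻¹ T`. -/
lemma greenOp_nonneg {k : ℂ → ℝ} (hk : MemLp k 2 (volume.restrict Λ)) {lam : ℝ} (hlam : 0 ≤ lam)
    (h : ∀ᵐ z ∂(volume.restrict Λ), 0 ≤ k z + lam * greenOp Λ G k z) {z : ℂ} (hz : z ∈ Λ) :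
    0 ≤ greenOp Λ G k z := by
  have := hG.isFiniteMeasure
  have hc := hG.continuousOn_greenOp hk
  have hTk := hG.memLp_greenOp hk
  have hli : LocallyIntegrableOn (greenOp Λ G k) Λ :=
    hc.locallyIntegrableOn hG.isOpen.measurableSet
  -- The function u = Tk solves -Δu = k weakly and vanishes at the boundary, so the assumption reads
  -- (-Δ + lam)u ≥ 0. As u has no pole, the exceptional point z + 1 is a dummy different from z.
  refine weak_minimum_principle hG.isOpen hG.isBounded hlam (w := z + 1) (hc.mono sdiff_subset)
    hli ?_ ?_ z hz (by simp)
  · intro ψ hψ hψc hψΛ hψ0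
    have e1 := hG.integral_greenOp_mul_neg_laplacian hk hψ hψc hψΛ
    have hψL : MemLp ψ 2 (volume.restrict Λ) :=
      (hψ.continuous.memLp_of_hasCompactSupport hψc).restrict Λ
    have i1 : IntegrableOn (fun z => greenOp Λ G k z * ψ z) Λ := hTk.integrable_mul hψL
    have i2 : IntegrableOn (fun z => k z * ψ z) Λ := hk.integrable_mul hψL
    have hL : MemLp (fun z => -Δ ψ z) 2 (volume.restrict Λ) :=
      ((contDiff_laplacian hψ).continuous.memLp_of_hasCompactSupport
        (hasCompactSupport_laplacian hψc)).neg.restrict Λ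
    have i3 : IntegrableOn (fun z => greenOp Λ G k z * (-Δ ψ z)) Λ :=
      hTk.integrable_mul hL
    have : ∫ z in Λ, greenOp Λ G k z * (lam * ψ z - Δ ψ z) =
        ∫ z in Λ, (k z + lam * greenOp Λ G k z) * ψ z := by
      calc _ = ∫ z in Λ, (lam * (greenOp Λ G k z * ψ z) + greenOp Λ G k z * (-Δ ψ z)) := by
            congr 1 with z; ring
        _ = ∫ z in Λ, (lam * (greenOp Λ G k z * ψ z) + k z * ψ z) := by
            rw [integral_add (i1.const_mul lam) i3, integral_add (i1.const_mul lam) i2, e1]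
        _ = _ := by congr 1 with z; ring
    rw [this]
    refine integral_nonneg_of_ae ?_
    filter_upwards [h] with z hz using mul_nonneg hz (hψ0 z)
  · intro ζ hζ η hη
    exact (hG.tendsto_greenOp_frontier hk hζ).eventually (lt_mem_nhds (by linarith))

open Classical in
omit hG in
/-- Extension by zero of a function on `Λ`. -/
def _root_.MassiveHadamard.extendZero (f : Λ → ℝ) (z : ℂ) : ℝ := if h : z ∈ Λ then f ⟨z, h⟩ else 0

omit hG in
lemma _root_.MassiveHadamard.extendZero_apply (f : Λ → ℝ) {z : ℂ} (hz : z ∈ Λ) :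
    extendZero f z = f ⟨z, hz⟩ := dif_pos hz

lemma memLp_extendZero (f : Λ →ᵇ ℝ) : MemLp (extendZero f) 2 (volume.restrict Λ) := by
  have := hG.isFiniteMeasure
  have hc : ContinuousOn (extendZero f) Λ := by
    rw [continuousOn_iff_continuous_domRestrict]
    convert f.continuous using 1
    funext z
    exact extendZero_apply f z.2
  refine MemLp.of_bound (hc.aestronglyMeasurable hG.isOpen.measurableSet) ‖f‖ ?_
  refine (ae_restrict_iff' hG.isOpen.measurableSet).2 (ae_of_all _ fun z hz => ?_)
  rw [extendZero_apply f hz]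
  exact f.norm_coe_le_norm _

/-- The constant function one lies in `L²`. -/
lemma memLp_one : MemLp (fun _ : ℂ => (1 : ℝ)) 2 (volume.restrict Λ) := by
  have := hG.isFiniteMeasure
  exact memLp_const 1

lemma abs_greenOp_le_of_bound {f : ℂ → ℝ} {c : ℝ}
    (h : ∀ y ∈ Λ, |f y| ≤ c) {z : ℂ} (hz : z ∈ Λ) :
    |greenOp Λ G f z| ≤ c * greenOp Λ G (fun _ => 1) z := by
  rw [← greenOp_const_mul, greenOp, ← Real.norm_eq_abs]
  have hc : MemLp (fun _ : ℂ => c * (1 : ℝ)) 2 (volume.restrict Λ) := hG.memLp_one.const_mul c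
  refine norm_integral_le_of_norm_le (hG.integrable_mul hz hc) ?_
  refine (ae_restrict_iff' hG.isOpen.measurableSet).2 (ae_of_all _ fun y hy => ?_)
  rw [norm_mul, Real.norm_eq_abs, Real.norm_eq_abs, abs_of_nonneg (hG.nonneg z hz y hy), mul_one]
  exact mul_le_mul_of_nonneg_left (h y hy) (hG.nonneg z hz y hy)

/-- The Green operator on bounded continuous functions. -/
lemma exists_boundedContinuous_op : ∃ (B : ℝ) (T : (Λ →ᵇ ℝ) →L[ℝ] (Λ →ᵇ ℝ)), 0 ≤ B ∧
    (∀ z ∈ Λ, greenOp Λ G (fun _ => 1) z ≤ B) ∧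
    ∀ (f : Λ →ᵇ ℝ) (z : Λ), T f z = greenOp Λ G (extendZero f) z := by
  set B₀ := volume.real Λ + (∫ y in ball 0 R, logKernel R y ^ 4) + ∫ y in Λ, (1 : ℝ) ^ 2 with hB₀
  set B := max B₀ 0
  have hB : ∀ z ∈ Λ, greenOp Λ G (fun _ => 1) z ≤ B := fun z hz =>
    ((le_abs_self _).trans (hG.abs_greenOp_le hz hG.memLp_one)).trans (le_max_left _ _)
  have hbd : ∀ (f : Λ →ᵇ ℝ) (z : Λ), ‖greenOp Λ G (extendZero f) z‖ ≤ B * ‖f‖ := by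
    intro f z
    refine (hG.abs_greenOp_le_of_bound (f := extendZero f) (c := ‖f‖) (fun y hy => ?_) z.2).trans ?_
    · rw [extendZero_apply f hy]; exact f.norm_coe_le_norm _
    · rw [mul_comm]; exact mul_le_mul_of_nonneg_right (hB z z.2) (norm_nonneg _)
  let T₀ : (Λ →ᵇ ℝ) → (Λ →ᵇ ℝ) := fun f =>
    BoundedContinuousFunction.ofNormedAddCommGroup (fun z : Λ => greenOp Λ G (extendZero f) z)
      (continuousOn_iff_continuous_domRestrict.1 (hG.continuousOn_greenOp (hG.memLp_extendZero f)))
      (B * ‖f‖) (hbd f)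
  let T₁ : (Λ →ᵇ ℝ) →ₗ[ℝ] (Λ →ᵇ ℝ) :=
    { toFun := T₀
      map_add' := fun f g => by
        ext z
        have e : extendZero ⇑(f + g) = fun y => extendZero f y + extendZero g y := by
          funext y
          by_cases hy : y ∈ Λ
          · simp [extendZero_apply _ hy]
          · simp [extendZero, hy]
        change greenOp Λ G (extendZero ⇑(f + g)) z = _
        rw [e, hG.greenOp_add (hG.memLp_extendZero f) (hG.memLp_extendZero g) z.2]
        rfl
      map_smul' := fun c f => by
        ext z
        have e : extendZero ⇑(c • f) = fun y => c * extendZero f y := by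
          funext y
          by_cases hy : y ∈ Λ
          · simp [extendZero_apply _ hy]
          · simp [extendZero, hy]
        change greenOp Λ G (extendZero ⇑(c • f)) z = _
        rw [e, greenOp_const_mul]
        rfl }
  refine ⟨B, T₁.mkContinuous B fun f => ?_, le_max_right _ _, hB, fun f z => rfl⟩
  exact (BoundedContinuousFunction.norm_le (by positivity)).2 (hbd f)

/-- A priori bound: with c = ‖f + lTf‖ and k = c ± f, one has k + lTk = c ± (f + lTf) + lc·T1 ≥ 0,
so `greenOp_nonneg` gives |Tf| ≤ c·T1 ≤ cB, whence |f| ≤ (1 + lam B)c. -/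
lemma exists_solution {lam : ℝ} (hlam : 0 ≤ lam) (g : Λ →ᵇ ℝ) :
    ∃ u : Λ →ᵇ ℝ, ∀ z : Λ, u z + lam * greenOp Λ G (extendZero u) z = g z := by
  obtain ⟨B, T, hB0, hB, hT⟩ := hG.exists_boundedContinuous_op
  have hap : ∀ l ∈ Icc 0 lam, ∀ f : Λ →ᵇ ℝ, ‖f‖ ≤ (1 + lam * B) * ‖f + l • T f‖ := by
    intro l hl f
    set c := ‖f + l • T f‖ with hc
    have hfe := hG.memLp_extendZero f
    have hval : ∀ z : Λ, |f z + l * T f z| ≤ c := fun z => by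
      simpa using (f + l • T f).norm_coe_le_norm z
    have hsgn : ∀ σ : ℝ, |σ| = 1 → ∀ z : Λ, 0 ≤ c * greenOp Λ G (fun _ => 1) z + σ * T f z := by
      intro σ hσ z
      have h1 : MemLp (fun _ : ℂ => c * (1 : ℝ)) 2 (volume.restrict Λ) := hG.memLp_one.const_mul c
      have h2 : MemLp (fun y => σ * extendZero f y) 2 (volume.restrict Λ) := hfe.const_mul σ
      have hlin : ∀ y ∈ Λ, greenOp Λ G (fun y => c * (1 : ℝ) + σ * extendZero f y) y =
          c * greenOp Λ G (fun _ => 1) y + σ * greenOp Λ G (extendZero f) y := fun y hy => by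
        rw [hG.greenOp_add h1 h2 hy, greenOp_const_mul, greenOp_const_mul]
      have := hG.greenOp_nonneg (h1.add h2) hl.1 ?_ z.2
      · rw [hT]
        rwa [← hlin z z.2]
      · refine (ae_restrict_iff' hG.isOpen.measurableSet).2 (ae_of_all _ fun y hy => ?_)
        have e := hlin y hy
        have hv := hval ⟨y, hy⟩
        rw [hT] at hv
        have hp : 0 ≤ greenOp Λ G (fun _ => 1) y :=
          integral_nonneg_of_ae ((ae_restrict_iff' hG.isOpen.measurableSet).2
            (ae_of_all _ fun x hx => by simpa using hG.nonneg y hy x hx))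
        have hs : -c ≤ σ * (f ⟨y, hy⟩ + l * greenOp Λ G (extendZero f) y) := by
          have := neg_abs_le (σ * (f ⟨y, hy⟩ + l * greenOp Λ G (extendZero f) y))
          rw [abs_mul, hσ, one_mul] at this
          linarith
        have hq : 0 ≤ l * (c * greenOp Λ G (fun _ => 1) y) :=
          mul_nonneg hl.1 (mul_nonneg (norm_nonneg _) hp)
        simp only [Pi.add_apply]
        change 0 ≤ c * 1 + σ * extendZero f y +
          l * greenOp Λ G (fun y => c * (1 : ℝ) + σ * extendZero f y) y
        rw [e, extendZero_apply f hy]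
        nlinarith
    refine (BoundedContinuousFunction.norm_le (by positivity)).2 fun z => ?_
    have hTz : |T f z| ≤ c * B := by
      have h1 := hsgn 1 (by simp) z
      have h2 := hsgn (-1) (by simp) z
      have h3 : c * greenOp Λ G (fun _ => 1) z ≤ c * B :=
        mul_le_mul_of_nonneg_left (hB z z.2) (norm_nonneg _)
      exact abs_le.2 ⟨by linarith, by linarith⟩
    have h4 : |l * T f z| ≤ lam * (c * B) := by
      rw [abs_mul, abs_of_nonneg hl.1]
      exact mul_le_mul hl.2 hTz (abs_nonneg _) hlam
    calc ‖f z‖ = |(f z + l * T f z) - l * T f z| := by rw [add_sub_cancel_right]; rfl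
      _ ≤ |f z + l * T f z| + |l * T f z| := abs_sub _ _
      _ ≤ c + lam * (c * B) := add_le_add (hval z) h4
      _ = _ := by ring
  obtain ⟨v, hv⟩ := isUnit_one_add_smul_of_apriori T (by positivity) hap lam ⟨hlam, le_rfl⟩
  refine ⟨(↑v⁻¹ : (Λ →ᵇ ℝ) →L[ℝ] (Λ →ᵇ ℝ)) g, fun z => ?_⟩
  have h2 : (1 + lam • T) ((↑v⁻¹ : (Λ →ᵇ ℝ) →L[ℝ] (Λ →ᵇ ℝ)) g) = g := by
    rw [← hv, ← mul_apply_eq_comp, Units.mul_inv, one_apply_eq_self]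
  have h3 := congrArg (fun f : Λ →ᵇ ℝ => f z) h2
  simpa [hT] using h3

end GreenKernel

end

end MassiveHadamard

namespace MassiveHadamard

noncomputable section

open Set Filter MeasureTheory Metric InnerProductSpace
open scoped Laplacian BoundedContinuousFunction

/-! ### Existence and properties of the massive Green function. -/

namespace GreenKernel

variable {Λ : Set ℂ} {R : ℝ} {G : ℂ → ℂ → ℝ} (hG : GreenKernel Λ R G)

include hG

/-- Existence of the massive Green function, together with its resolvent equation. -/
lemma exists_isMassiveGreen (m : ℝ) {w : ℂ} (hw : w ∈ Λ) : ∃ f : ℂ → ℝ,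
    IsMassiveGreen m Λ w f ∧ MemLp f 2 (volume.restrict Λ) ∧
      ∀ z ∈ Λ, f z + m ^ 2 * greenOp Λ G f z = G w z := by
  have hm := sq_nonneg m
  have hGw := hG.memLp hw
  -- The section `G w` is singular at w, so the equation is solved for the bounded function u = Tf
  -- instead: u + m²Tu = T(G w). Then f = G w - m²u satisfies Tf = u.
  set g : Λ →ᵇ ℝ := BoundedContinuousFunction.ofNormedAddCommGroup
    (fun z : Λ => greenOp Λ G (G w) z)
    (continuousOn_iff_continuous_domRestrict.1 (hG.continuousOn_greenOp hGw))
    (volume.real Λ + (∫ y in ball 0 R, logKernel R y ^ 4) + ∫ y in Λ, G w y ^ 2)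
    (fun z => hG.abs_greenOp_le z.2 hGw) with hg
  obtain ⟨u, hu⟩ := hG.exists_solution hm g
  set f : ℂ → ℝ := fun z => G w z + -m ^ 2 * extendZero u z with hf
  have hue := hG.memLp_extendZero u
  have hue' : MemLp (fun z => -m ^ 2 * extendZero u z) 2 (volume.restrict Λ) := hue.const_mul (-m ^ 2)
  have hfL : MemLp f 2 (volume.restrict Λ) := hGw.add hue'
  have hTf : ∀ z ∈ Λ, greenOp Λ G f z = extendZero u z := by
    intro z hz
    rw [hf, hG.greenOp_add hGw hue' hz, greenOp_const_mul]
    have h1 := hu ⟨z, hz⟩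
    have h2 : g ⟨z, hz⟩ = greenOp Λ G (G w) z := rfl
    rw [h2] at h1
    rw [extendZero_apply u hz]
    simp only at h1
    linarith
  have hres : ∀ z ∈ Λ, f z + m ^ 2 * greenOp Λ G f z = G w z := fun z hz => by
    rw [hTf z hz]; simp only [hf]; ring
  have hgr := hG.green w hw
  have hcT := hG.continuousOn_greenOp hfL
  have hfe : EqOn f (fun z => G w z - m ^ 2 * greenOp Λ G f z) Λ := fun z hz => by
    simp only; linarith [hres z hz]
  have hfli : LocallyIntegrableOn f Λ := by
    have := hG.isFiniteMeasure
    exact IntegrableOn.locallyIntegrableOn (hfL.integrable (by norm_num))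
  refine ⟨f, ⟨?_, hfli, ?_, ?_⟩, hfL, hres⟩
  · have hc : ContinuousOn (fun z => G w z - m ^ 2 * greenOp Λ G f z) (Λ \ {w}) :=
      hgr.continuousOn.sub (continuousOn_const.mul (hcT.mono sdiff_subset))
    exact hc.congr fun z hz => hfe hz.1
  · intro ψ hψ hψc hψΛ
    have e1 := hG.integral_greenOp_mul_neg_laplacian hfL hψ hψc hψΛ
    have e2 := hgr.weak ψ hψ hψc hψΛ
    have hL : MemLp (fun z => -Δ ψ z) 2 (volume.restrict Λ) :=
      ((contDiff_laplacian hψ).continuous.memLp_of_hasCompactSupport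
        (hasCompactSupport_laplacian hψc)).neg.restrict Λ
    have hψL : MemLp ψ 2 (volume.restrict Λ) :=
      (hψ.continuous.memLp_of_hasCompactSupport hψc).restrict Λ
    have i1 : IntegrableOn (fun z => f z * ψ z) Λ := hfL.integrable_mul hψL
    have i2 : IntegrableOn (fun z => G w z * (0 ^ 2 * ψ z - Δ ψ z)) Λ :=
      integrableOn_mul_helmholtz hgr.locallyIntegrableOn _ hψ hψc hψΛ
    have i3 : IntegrableOn (fun z => greenOp Λ G f z * (-Δ ψ z)) Λ :=
      (hG.memLp_greenOp hfL).integrable_mul hL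
    calc ∫ z in Λ, f z * (m ^ 2 * ψ z - Δ ψ z)
        = ∫ z in Λ, (m ^ 2 * (f z * ψ z) + (G w z * (0 ^ 2 * ψ z - Δ ψ z)
          - m ^ 2 * (greenOp Λ G f z * (-Δ ψ z)))) := by
          refine setIntegral_congr_fun hG.isOpen.measurableSet fun z hz => ?_
          have := hres z hz
          rw [← this]; ring
      _ = ψ w := by
          have i23 : IntegrableOn (fun z => G w z * (0 ^ 2 * ψ z - Δ ψ z)
              - m ^ 2 * (greenOp Λ G f z * (-Δ ψ z))) Λ := i2.sub (i3.const_mul _)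
          rw [integral_add (i1.const_mul _) i23, integral_sub i2 (i3.const_mul _),
            integral_const_mul, integral_const_mul, e1, e2]
          ring
  · intro ζ hζ
    have h1 := (hgr.boundary ζ hζ).sub ((hG.tendsto_greenOp_frontier hfL hζ).const_mul (m ^ 2))
    rw [mul_zero, sub_zero] at h1
    refine h1.congr' ?_
    filter_upwards [self_mem_nhdsWithin] with z hz using (hfe hz).symm

variable (m : ℝ)

lemma isMassiveGreen {w : ℂ} (hw : w ∈ Λ) : IsMassiveGreen m Λ w (massiveGreen m Λ w) := by
  obtain ⟨f, hf, -⟩ := hG.exists_isMassiveGreen m hw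
  exact (massiveGreen_eq hG.isOpen hG.isBounded hf).1

/-- The chosen Green function is known only off its pole; the integral operator ignores that point,
but the pointwise identity has to exclude it. -/
lemma massiveGreen_resolvent {w : ℂ} (hw : w ∈ Λ) :
    MemLp (massiveGreen m Λ w) 2 (volume.restrict Λ) ∧
      ∀ z ∈ Λ, z ≠ w →
        massiveGreen m Λ w z + m ^ 2 * greenOp Λ G (massiveGreen m Λ w) z = G w z := by
  obtain ⟨f, hf, hfL, hres⟩ := hG.exists_isMassiveGreen m hw
  have he := (massiveGreen_eq hG.isOpen hG.isBounded hf).2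
  have hae : f =ᵐ[volume.restrict Λ] massiveGreen m Λ w := by
    refine (ae_restrict_iff' hG.isOpen.measurableSet).2 ?_
    filter_upwards [compl_mem_ae_iff.2 (measure_singleton w)] with z hz hzΛ
    exact (he ⟨hzΛ, hz⟩).symm
  refine ⟨hfL.ae_eq hae, fun z hz hzw => ?_⟩
  rw [← greenOp_congr hae, he ⟨hz, hzw⟩]
  exact hres z hz

lemma memLp_massiveGreen {w : ℂ} (hw : w ∈ Λ) :
    MemLp (massiveGreen m Λ w) 2 (volume.restrict Λ) := (hG.massiveGreen_resolvent m hw).1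

lemma massiveGreen_add {w z : ℂ} (hw : w ∈ Λ) (hz : z ∈ Λ) (hzw : z ≠ w) :
    massiveGreen m Λ w z + m ^ 2 * greenOp Λ G (massiveGreen m Λ w) z = G w z :=
  (hG.massiveGreen_resolvent m hw).2 z hz hzw

lemma ae_ne (w : ℂ) : ∀ᵐ z ∂(volume.restrict Λ), z ∈ Λ ∧ z ≠ w := by
  refine (ae_restrict_iff' hG.isOpen.measurableSet).2 ?_
  filter_upwards [compl_mem_ae_iff.2 (measure_singleton w)] with z hz hzΛ
  exact ⟨hzΛ, hz⟩

lemma massiveGreen_nonneg {w z : ℂ} (hw : w ∈ Λ) (hz : z ∈ Λ) (hzw : z ≠ w) :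
    0 ≤ massiveGreen m Λ w z := by
  have h := hG.isMassiveGreen m hw
  refine weak_minimum_principle hG.isOpen hG.isBounded (sq_nonneg m) h.continuousOn
    h.locallyIntegrableOn (fun ψ hψ hψc hψΛ hψ0 => ?_) (fun ζ hζ η hη => ?_) z hz hzw
  · exact (hψ0 w).trans_eq (h.weak ψ hψ hψc hψΛ).symm
  · exact (h.boundary ζ hζ).eventually (lt_mem_nhds (by linarith))

/-- By the resolvent equation the difference is m² T G^{(m)}(w,·), which the minimum principle for
the resolvent shows to be nonnegative. -/
lemma massiveGreen_le {w z : ℂ} (hw : w ∈ Λ) (hz : z ∈ Λ) (hzw : z ≠ w) :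
    massiveGreen m Λ w z ≤ G w z := by
  have h1 := hG.massiveGreen_add m hw hz hzw
  have h2 : 0 ≤ greenOp Λ G (massiveGreen m Λ w) z := by
    refine hG.greenOp_nonneg (hG.memLp_massiveGreen m hw) (sq_nonneg m) ?_ hz
    filter_upwards [hG.ae_ne w] with y hy
    rw [hG.massiveGreen_add m hw hy.1 hy.2]
    exact hG.nonneg w hw y hy.1
  nlinarith [mul_nonneg (sq_nonneg m) h2]

/-- The massive Green operator is the resolvent of the massless one. -/
lemma integral_massiveGreen_mul_add {h : ℂ → ℝ} (hh : MemLp h 2 (volume.restrict Λ)) {z : ℂ}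
    (hz : z ∈ Λ) :
    ∫ y in Λ, massiveGreen m Λ z y * (h y + m ^ 2 * greenOp Λ G h y) = greenOp Λ G h z := by
  have hM := hG.memLp_massiveGreen m hz
  have hT := hG.memLp_greenOp hh
  have i1 : IntegrableOn (fun y => massiveGreen m Λ z y * h y) Λ := hM.integrable_mul hh
  have i2 : IntegrableOn (fun y => massiveGreen m Λ z y * greenOp Λ G h y) Λ := hM.integrable_mul hT
  have i3 : IntegrableOn (fun y => h y * greenOp Λ G (massiveGreen m Λ z) y) Λ :=
    hh.integrable_mul (hG.memLp_greenOp hM)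
  -- Symmetry moves the operator from h onto G^{(m)}(z,·), where the resolvent equation collapses
  -- the sum to G(z,·).
  calc _ = ∫ y in Λ, (massiveGreen m Λ z y * h y +
        m ^ 2 * (massiveGreen m Λ z y * greenOp Λ G h y)) := by congr 1 with y; ring
    _ = ∫ y in Λ, (massiveGreen m Λ z y * h y +
        m ^ 2 * (h y * greenOp Λ G (massiveGreen m Λ z) y)) := by
      rw [integral_add i1 (i2.const_mul _), integral_add i1 (i3.const_mul _), integral_const_mul,
        integral_const_mul, hG.integral_mul_greenOp_comm hh hM]
    _ = ∫ y in Λ, G z y * h y := by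
      refine integral_congr_ae ?_
      filter_upwards [hG.ae_ne z] with y hy
      rw [← hG.massiveGreen_add m hz hy.1 hy.2]; ring
    _ = _ := rfl

/-- Inserting the inversion formula into the resolvent equation expresses G^{(m)}(w, z) through G(w,
z), an L² pairing and a pairing through T, all symmetric in the two points. -/
lemma massiveGreen_symm {w z : ℂ} (hw : w ∈ Λ) (hz : z ∈ Λ) (hzw : z ≠ w) :
    massiveGreen m Λ w z = massiveGreen m Λ z w := by
  have key : ∀ {w z : ℂ}, w ∈ Λ → z ∈ Λ → z ≠ w →
      massiveGreen m Λ w z = G w z - m ^ 2 * ((∫ y in Λ, massiveGreen m Λ z y * massiveGreen m Λ w y) +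
        m ^ 2 * ∫ y in Λ, massiveGreen m Λ z y * greenOp Λ G (massiveGreen m Λ w) y) := by
    intro w z hw hz hzw
    have hMw := hG.memLp_massiveGreen m hw
    have hMz := hG.memLp_massiveGreen m hz
    have i1 : IntegrableOn (fun y => massiveGreen m Λ z y * massiveGreen m Λ w y) Λ :=
      hMz.integrable_mul hMw
    have i2 : IntegrableOn (fun y => massiveGreen m Λ z y * greenOp Λ G (massiveGreen m Λ w) y) Λ :=
      hMz.integrable_mul (hG.memLp_greenOp hMw)
    have h1 := hG.massiveGreen_add m hw hz hzw
    rw [← hG.integral_massiveGreen_mul_add m hMw hz] at h1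
    have h2 : ∫ y in Λ, massiveGreen m Λ z y * (massiveGreen m Λ w y +
        m ^ 2 * greenOp Λ G (massiveGreen m Λ w) y) =
        (∫ y in Λ, massiveGreen m Λ z y * massiveGreen m Λ w y) +
        m ^ 2 * ∫ y in Λ, massiveGreen m Λ z y * greenOp Λ G (massiveGreen m Λ w) y := by
      rw [← integral_const_mul, ← integral_add i1 (i2.const_mul _)]
      congr 1 with y; ring
    rw [h2] at h1
    linarith
  rw [key hw hz hzw, key hz hw hzw.symm, hG.symm w z,
    hG.integral_mul_greenOp_comm (hG.memLp_massiveGreen m hw) (hG.memLp_massiveGreen m hz)]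
  congr 3
  congr 1 with y
  ring

end GreenKernel

end

end MassiveHadamard

/-! ### The Loewner equation with truncated vector field. -/

namespace MassiveHadamard

noncomputable section

open Set Filter MeasureTheory Metric
open scoped NNReal

lemma hasDerivWithinAt_integral {k : ℝ → ℂ} {a b : ℝ} (hk : ContinuousOn k (Icc a b)) {s : ℝ}
    (hs : s ∈ Icc a b) : HasDerivWithinAt (fun s => ∫ r in a..s, k r) (k s) (Icc a b) s := by
  have hab : a ≤ b := hs.1.trans hs.2
  set κ : ℝ → ℂ := IccExtend hab ((Icc a b).domRestrict k) with hκ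
  have hκc : Continuous κ := (continuousOn_iff_continuous_domRestrict.1 hk).Icc_extend'
  have hκe : ∀ r ∈ Icc a b, κ r = k r := fun r hr => by
    rw [hκ, IccExtend_of_mem _ _ hr]; rfl
  have hint : ∀ r ∈ Icc a b, ∫ u in a..r, k u = ∫ u in a..r, κ u := fun r hr =>
    intervalIntegral.integral_congr fun u hu => by
      rw [uIcc_of_le hr.1] at hu
      exact (hκe u ⟨hu.1, hu.2.trans hr.2⟩).symm
  rw [← hκe s hs]
  exact ((hκc.integral_hasStrictDerivAt a s).hasDerivAt.hasDerivWithinAt).congr hint (hint s hs)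

/-- A solution of a linear scalar equation is given by the exponential formula. -/
lemma eq_mul_exp_of_hasDerivWithinAt {f k : ℝ → ℂ} {a b : ℝ} (hk : ContinuousOn k (Icc a b))
    (hf : ∀ s ∈ Icc a b, HasDerivWithinAt f (k s * f s) (Icc a b) s) {s : ℝ} (hs : s ∈ Icc a b) :
    f s = f a * Complex.exp (∫ r in a..s, k r) := by
  have hF : ∀ r ∈ Icc a b, HasDerivWithinAt
      (fun s => f s * Complex.exp (-∫ r in a..s, k r)) 0 (Icc a b) r := fun r hr => by
    refine ((hf r hr).mul (hasDerivWithinAt_integral hk hr).neg.cexp).congr_deriv ?_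
    ring
  have hcst := constant_of_has_deriv_right_zero
    (f := fun s => f s * Complex.exp (-∫ r in a..s, k r)) (a := a) (b := b)
    (fun r hr => (hF r hr).continuousWithinAt)
    (fun r hr => (hF r (Ico_subset_Icc_self hr)).mono_of_mem_nhdsWithin
      (Icc_mem_nhdsGE_of_mem hr)) s hs
  simp only [intervalIntegral.integral_same, neg_zero, Complex.exp_zero, mul_one] at hcst
  rw [← hcst, mul_assoc, ← Complex.exp_add]
  simp

/-- Truncation of the imaginary part from below. -/
def clip (c : ℝ) (u : ℂ) : ℂ := ⟨u.re, max u.im c⟩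

lemma norm_clip_sub_clip_le (c : ℝ) (u v : ℂ) : ‖clip c u - clip c v‖ ≤ ‖u - v‖ := by
  rw [← sq_le_sq₀ (norm_nonneg _) (norm_nonneg _), Complex.sq_norm, Complex.sq_norm,
    Complex.normSq_apply, Complex.normSq_apply]
  have h := sq_le_sq.2 ((abs_max_sub_max_le_abs u.im v.im c))
  simp only [clip, Complex.sub_re, Complex.sub_im]
  nlinarith

lemma clip_eq_self {c : ℝ} {u : ℂ} (h : c ≤ u.im) : clip c u = u :=
  Complex.ext rfl (max_eq_left h)

lemma le_im_clip (c : ℝ) (u : ℂ) : c ≤ (clip c u).im := le_max_right _ _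

lemma le_norm_clip_sub (c : ℝ) (u : ℂ) (x : ℝ) : c ≤ ‖clip c u - x‖ := by
  refine le_trans ?_ (Complex.abs_im_le_norm _)
  rw [Complex.sub_im, Complex.ofReal_im, sub_zero]
  exact (le_im_clip c u).trans (le_abs_self _)

lemma clip_sub_ne_zero {c : ℝ} (hc : 0 < c) (u : ℂ) (x : ℝ) : clip c u - x ≠ 0 :=
  norm_pos_iff.1 (hc.trans_le (le_norm_clip_sub c u x))

/-- The Loewner vector field with the imaginary part truncated from below. -/
def clippedField (ξ : ℝ → ℝ) (c s : ℝ) (u : ℂ) : ℂ := 2 / (clip c u - ξ s)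

lemma clippedField_eq {ξ : ℝ → ℝ} {c s : ℝ} {u : ℂ} (h : c ≤ u.im) :
    clippedField ξ c s u = 2 / (u - ξ s) := by rw [clippedField, clip_eq_self h]

lemma norm_clippedField_le (ξ : ℝ → ℝ) {c : ℝ} (hc : 0 < c) (s : ℝ) (u : ℂ) :
    ‖clippedField ξ c s u‖ ≤ 2 / c := by
  rw [clippedField, norm_div, Complex.norm_ofNat]
  exact div_le_div_of_nonneg_left (by norm_num) hc (le_norm_clip_sub c u _)

lemma lipschitzWith_clippedField (ξ : ℝ → ℝ) {c : ℝ} (hc : 0 < c) (s : ℝ) :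
    LipschitzWith (Real.toNNReal (2 / c ^ 2)) (clippedField ξ c s) := by
  refine LipschitzWith.of_dist_le_mul fun u v => ?_
  rw [Real.coe_toNNReal _ (by positivity), dist_eq_norm, dist_eq_norm, clippedField, clippedField]
  have hu := clip_sub_ne_zero hc u (ξ s)
  have hv := clip_sub_ne_zero hc v (ξ s)
  have e : (2 : ℂ) / (clip c u - ξ s) - 2 / (clip c v - ξ s) =
      2 * -(clip c u - clip c v) / ((clip c u - ξ s) * (clip c v - ξ s)) := by
    field_simp; ring
  rw [e, norm_div, norm_mul, norm_mul, norm_neg, Complex.norm_ofNat]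
  have h1 := le_norm_clip_sub c u (ξ s)
  have h2 := le_norm_clip_sub c v (ξ s)
  calc 2 * ‖clip c u - clip c v‖ / (‖clip c u - ξ s‖ * ‖clip c v - ξ s‖)
      ≤ 2 * ‖u - v‖ / (c * c) := by
        gcongr
        exact norm_clip_sub_clip_le c u v
    _ = 2 / c ^ 2 * ‖u - v‖ := by ring

lemma im_clippedField_nonpos (ξ : ℝ → ℝ) {c : ℝ} (hc : 0 < c) (s : ℝ) (u : ℂ) :
    (clippedField ξ c s u).im ≤ 0 := by
  rw [clippedField, Complex.div_im]
  simp only [Complex.im_ofNat, zero_mul, zero_div, zero_sub, Complex.re_ofNat, Complex.sub_im,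
    Complex.ofReal_im, sub_zero, neg_nonpos]
  have := hc.trans_le (le_im_clip c u)
  exact div_nonneg (by positivity) (Complex.normSq_nonneg _)

/-- `u` solves the truncated Loewner equation on `[0, T]`. -/
def IsClippedSolution (ξ : ℝ → ℝ) (c T : ℝ) (u : ℝ → ℂ) : Prop :=
  ∀ s ∈ Icc 0 T, HasDerivWithinAt u (clippedField ξ c s (u s)) (Icc 0 T) s

namespace IsClippedSolution

variable {ξ : ℝ → ℝ} {c T : ℝ} {u v : ℝ → ℂ}

lemma continuousOn (hu : IsClippedSolution ξ c T u) : ContinuousOn u (Icc 0 T) :=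
  fun s hs => (hu s hs).continuousWithinAt

lemma hasDerivWithinAt_Ici (hu : IsClippedSolution ξ c T u) {s : ℝ} (hs : s ∈ Ico 0 T) :
    HasDerivWithinAt u (clippedField ξ c s (u s)) (Ici s) s :=
  (hu s (Ico_subset_Icc_self hs)).mono_of_mem_nhdsWithin (Icc_mem_nhdsGE_of_mem hs)

lemma dist_le (hc : 0 < c) (hu : IsClippedSolution ξ c T u) (hv : IsClippedSolution ξ c T v)
    {s : ℝ} (hs : s ∈ Icc 0 T) : dist (u s) (v s) ≤ dist (u 0) (v 0) * Real.exp (2 / c ^ 2 * s) := by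
  have := dist_le_of_trajectories_ODE (v := clippedField ξ c)
    (fun s => lipschitzWith_clippedField ξ hc s) hu.continuousOn
    (fun s hs => hu.hasDerivWithinAt_Ici hs) hv.continuousOn (fun s hs => hv.hasDerivWithinAt_Ici hs)
    le_rfl s hs
  rwa [Real.coe_toNNReal _ (by positivity), sub_zero] at this

lemma antitoneOn_im (hc : 0 < c) (hu : IsClippedSolution ξ c T u) :
    AntitoneOn (fun s => (u s).im) (Icc 0 T) := by
  refine antitoneOn_of_hasDerivWithinAt_nonpos (convex_Icc 0 T)
    (Complex.continuous_im.comp_continuousOn hu.continuousOn)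
    (f' := fun s => (clippedField ξ c s (u s)).im) (fun s hs => ?_) fun s _ =>
      im_clippedField_nonpos ξ hc s _
  have := (hu s (interior_subset hs)).mono interior_subset
  exact Complex.imCLM.hasFDerivAt.comp_hasDerivWithinAt s this

lemma mono (hu : IsClippedSolution ξ c T u) {t : ℝ} (ht : t ≤ T) : IsClippedSolution ξ c t u :=
  fun s hs => (hu s ⟨hs.1, hs.2.trans ht⟩).mono (Icc_subset_Icc_right ht)

/-- The imaginary part decreases, so a final height of at least c means that the truncation was
never active. -/
lemma isLoewnerTrajectory (hc : 0 < c) (hu : IsClippedSolution ξ c T u) (hT : c ≤ (u T).im) :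
    IsLoewnerTrajectory ξ (u 0) T u := by
  have him : ∀ s ∈ Icc 0 T, c ≤ (u s).im := fun s hs =>
    hT.trans (hu.antitoneOn_im hc hs ⟨hs.1.trans hs.2, le_rfl⟩ hs.2)
  refine ⟨rfl, fun s hs h => ?_, fun s hs => ?_⟩
  · have := him s hs
    rw [h, Complex.ofReal_im] at this
    exact this.not_gt hc
  · rw [← clippedField_eq (him s hs)]
    exact hu s hs

end IsClippedSolution

/-- The truncated field is globally Lipschitz and bounded by 2/c, so one Picard–Lindelöf interval
covers [0, T]. The initial time is arbitrary because surjectivity of g_t solves the equation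
backwards. -/
lemma exists_isClippedSolution {ξ : ℝ → ℝ} (hξ : ContinuousOn ξ (Ici 0)) {c T t₀ : ℝ} (hc : 0 < c)
    (ht₀ : t₀ ∈ Icc 0 T) (z : ℂ) : ∃ u, u t₀ = z ∧ IsClippedSolution ξ c T u := by
  have hL : 0 ≤ 2 / c := by positivity
  have hT : 0 ≤ T := ht₀.1.trans ht₀.2
  have h : IsPicardLindelof (clippedField ξ c) (tmin := 0) (tmax := T) ⟨t₀, ht₀⟩ z
      (Real.toNNReal (2 / c * T)) 0 (Real.toNNReal (2 / c)) (Real.toNNReal (2 / c ^ 2)) := by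
    refine ⟨fun s _ => (lipschitzWith_clippedField ξ hc s).lipschitzOnWith, fun x _ => ?_,
      fun s _ x _ => ?_, ?_⟩
    · refine ContinuousOn.div continuousOn_const (continuousOn_const.sub ?_)
        fun s _ => clip_sub_ne_zero hc x _
      exact Complex.continuous_ofReal.comp_continuousOn (hξ.mono Icc_subset_Ici_self)
    · rw [Real.coe_toNNReal _ hL]
      exact norm_clippedField_le ξ hc s x
    · rw [Real.coe_toNNReal _ hL, Real.coe_toNNReal _ (mul_nonneg hL hT), NNReal.coe_zero]
      simp only [sub_zero]
      refine mul_le_mul_of_nonneg_left (max_le ?_ ?_) hL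
      · exact sub_le_self _ ht₀.1
      · exact ht₀.2
  exact h.exists_eq_forall_mem_Icc_hasDerivWithinAt₀

namespace IsLoewnerTrajectory

variable {ξ : ℝ → ℝ} {z : ℂ} {t : ℝ} {u v : ℝ → ℂ}

lemma continuousOn (hu : IsLoewnerTrajectory ξ z t u) : ContinuousOn u (Icc 0 t) :=
  fun s hs => (hu.deriv s hs).continuousWithinAt

lemma mono (hu : IsLoewnerTrajectory ξ z t u) {s : ℝ} (hs : s ≤ t) : IsLoewnerTrajectory ξ z s u :=
  ⟨hu.init, fun r hr => hu.ne r ⟨hr.1, hr.2.trans hs⟩, fun r hr =>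
    (hu.deriv r ⟨hr.1, hr.2.trans hs⟩).mono (Icc_subset_Icc_right hs)⟩

lemma hasDerivWithinAt_im (hu : IsLoewnerTrajectory ξ z t u) {s : ℝ} (hs : s ∈ Icc 0 t) :
    HasDerivWithinAt (fun s => (u s).im) (-2 / Complex.normSq (u s - ξ s) * (u s).im) (Icc 0 t) s := by
  have h := Complex.imCLM.hasFDerivAt.comp_hasDerivWithinAt s (hu.deriv s hs)
  refine h.congr_deriv ?_
  rw [Complex.imCLM_apply, Complex.div_im]
  simp only [Complex.im_ofNat, zero_mul, zero_div, zero_sub, Complex.re_ofNat, Complex.sub_im,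
    Complex.ofReal_im, sub_zero]
  ring

/-- Along a trajectory the imaginary part solves a linear scalar equation with continuous
coefficient, hence keeps its sign by the exponential formula. -/
lemma im_pos (hξ : ContinuousOn ξ (Ici 0)) (hz : z ∈ upperHalf) (hu : IsLoewnerTrajectory ξ z t u)
    {s : ℝ} (hs : s ∈ Icc 0 t) : 0 < (u s).im := by
  have hk : ContinuousOn (fun s => ((-2 / Complex.normSq (u s - ξ s) : ℝ) : ℂ)) (Icc 0 t) := by
    refine Complex.continuous_ofReal.comp_continuousOn (ContinuousOn.div continuousOn_const ?_ ?_)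
    · exact Complex.continuous_normSq.comp_continuousOn (hu.continuousOn.sub
        (Complex.continuous_ofReal.comp_continuousOn (hξ.mono Icc_subset_Ici_self)))
    · exact fun s hs => (Complex.normSq_pos.2 (sub_ne_zero.2 (hu.ne s hs))).ne'
  have h := eq_mul_exp_of_hasDerivWithinAt (f := fun s => ((u s).im : ℂ)) hk (fun r hr => by
    have := (hu.hasDerivWithinAt_im hr).ofReal_comp
    simpa only [Complex.ofReal_mul] using this) hs
  simp only [intervalIntegral.integral_ofReal] at h
  rw [← Complex.ofReal_exp, ← Complex.ofReal_mul, Complex.ofReal_inj, hu.init] at h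
  rw [h]
  exact mul_pos hz (Real.exp_pos _)

lemma antitoneOn_im (hξ : ContinuousOn ξ (Ici 0)) (hz : z ∈ upperHalf)
    (hu : IsLoewnerTrajectory ξ z t u) : AntitoneOn (fun s => (u s).im) (Icc 0 t) := by
  refine antitoneOn_of_hasDerivWithinAt_nonpos (convex_Icc 0 t)
    (Complex.continuous_im.comp_continuousOn hu.continuousOn) (fun s hs =>
      (hu.hasDerivWithinAt_im (interior_subset hs)).mono interior_subset) fun s hs => ?_
  have h1 := hu.im_pos hξ hz (interior_subset hs)
  have h2 := Complex.normSq_nonneg (u s - ξ s)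
  exact mul_nonpos_of_nonpos_of_nonneg (div_nonpos_of_nonpos_of_nonneg (by norm_num) h2) h1.le

lemma isClippedSolution (hξ : ContinuousOn ξ (Ici 0)) (hz : z ∈ upperHalf)
    (hu : IsLoewnerTrajectory ξ z t u) {c : ℝ} (hc : c ≤ (u t).im) : IsClippedSolution ξ c t u := by
  intro s hs
  rw [clippedField_eq]
  · exact hu.deriv s hs
  · exact hc.trans (hu.antitoneOn_im hξ hz hs ⟨hs.1.trans hs.2, le_rfl⟩ hs.2)

/-- Truncating below the smaller of the two final heights makes both trajectories solutions of the
same Lipschitz equation. -/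
lemma eqOn (hξ : ContinuousOn ξ (Ici 0)) (hz : z ∈ upperHalf) (hu : IsLoewnerTrajectory ξ z t u)
    (hv : IsLoewnerTrajectory ξ z t v) : EqOn u v (Icc 0 t) := by
  intro s hs
  have htt : t ∈ Icc 0 t := ⟨hs.1.trans hs.2, le_rfl⟩
  have hc : 0 < min (u t).im (v t).im := lt_min (hu.im_pos hξ hz htt) (hv.im_pos hξ hz htt)
  have := (hu.isClippedSolution hξ hz (min_le_left _ (v t).im)).dist_le hc
    (hv.isClippedSolution hξ hz (min_le_right (u t).im _)) hs
  rw [hu.init, hv.init, dist_self, zero_mul] at this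
  exact dist_le_zero.1 this

lemma loewnerMap_eq (hξ : ContinuousOn ξ (Ici 0)) (hz : z ∈ upperHalf)
    (hu : IsLoewnerTrajectory ξ z t u) {s : ℝ} (hs : s ∈ Icc 0 t) : loewnerMap ξ s z = u s := by
  have h : ∃ u, IsLoewnerTrajectory ξ z s u := ⟨u, hu.mono hs.2⟩
  rw [loewnerMap, dif_pos h]
  exact h.choose_spec.eqOn hξ hz (hu.mono hs.2) ⟨hs.1, le_rfl⟩

end IsLoewnerTrajectory

end

end MassiveHadamard

/-! ### The Loewner flow: openness, conformality and lifetime. -/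

namespace MassiveHadamard

noncomputable section

open Set Filter MeasureTheory Metric
open scoped NNReal

section LoewnerFlow

variable {ξ : ℝ → ℝ} (hξ : ContinuousOn ξ (Ici 0))

include hξ

lemma isLoewnerTrajectory_loewnerMap {t : ℝ} (ht : 0 ≤ t) {z : ℂ} (hz : z ∈ loewnerDomain ξ t) :
    IsLoewnerTrajectory ξ z t (fun s => loewnerMap ξ s z) := by
  obtain ⟨hzH, u, hu⟩ := hz
  have h : EqOn (fun s => loewnerMap ξ s z) u (Icc 0 t) := fun s hs => hu.loewnerMap_eq hξ hzH hs
  refine ⟨(h ⟨le_rfl, ht⟩).trans hu.init, fun s hs => ?_, fun s hs => ?_⟩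
  · have h' : loewnerMap ξ s z = u s := h hs
    rw [h']; exact hu.ne s hs
  · have h' : loewnerMap ξ s z = u s := h hs
    rw [h']; exact (hu.deriv s hs).congr h h'

omit hξ in
lemma loewnerDomain_anti {s t : ℝ} (h : s ≤ t) : loewnerDomain ξ t ⊆ loewnerDomain ξ s :=
  fun _ hz => ⟨hz.1, hz.2.imp fun _ hu => hu.mono h⟩

lemma loewnerMap_im_pos {t : ℝ} (ht : 0 ≤ t) {z : ℂ} (hz : z ∈ loewnerDomain ξ t) :
    0 < (loewnerMap ξ t z).im :=
  (isLoewnerTrajectory_loewnerMap hξ ht hz).im_pos hξ hz.1 ⟨ht, le_rfl⟩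

lemma loewnerMap_im_anti {s t : ℝ} (hs : 0 ≤ s) (hst : s ≤ t) {z : ℂ} (hz : z ∈ loewnerDomain ξ t) :
    (loewnerMap ξ t z).im ≤ (loewnerMap ξ s z).im :=
  (isLoewnerTrajectory_loewnerMap hξ (hs.trans hst) hz).antitoneOn_im hξ hz.1 ⟨hs, hst⟩
    ⟨hs.trans hst, le_rfl⟩ hst

omit hξ in
lemma norm_sub_ofReal_ge (u : ℂ) (x : ℝ) : u.im ≤ ‖u - x‖ := by
  refine le_trans ?_ (Complex.abs_im_le_norm _)
  rw [Complex.sub_im, Complex.ofReal_im, sub_zero]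
  exact le_abs_self _

lemma loewnerMap_sub_ne_zero {t : ℝ} (ht : 0 ≤ t) {z : ℂ} (hz : z ∈ loewnerDomain ξ t) :
    loewnerMap ξ t z - ξ t ≠ 0 :=
  norm_pos_iff.1 ((loewnerMap_im_pos hξ ht hz).trans_le (norm_sub_ofReal_ge _ _))

open Classical in
omit hξ in
/-- The flow of the truncated Loewner equation on `[0, T]`. -/
def clippedFlow (ξ : ℝ → ℝ) (c T : ℝ) (z : ℂ) : ℝ → ℂ :=
  if h : ∃ u, u 0 = z ∧ IsClippedSolution ξ c T u then h.choose else 0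

lemma clippedFlow_spec {c T : ℝ} (hc : 0 < c) (hT : 0 ≤ T) (z : ℂ) :
    clippedFlow ξ c T z 0 = z ∧ IsClippedSolution ξ c T (clippedFlow ξ c T z) := by
  have h := exists_isClippedSolution hξ hc ⟨le_rfl, hT⟩ z
  rw [clippedFlow, dif_pos h]
  exact h.choose_spec

lemma continuousOn_clippedFlow {c T : ℝ} (hc : 0 < c) (hT : 0 ≤ T) :
    ContinuousOn (fun p : ℝ × ℂ => clippedFlow ξ c T p.2 p.1) (Icc 0 T ×ˢ univ) := by
  refine continuousOn_prod_of_continuousOn_lipschitzOnWith' _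
    (Real.toNNReal (Real.exp (2 / c ^ 2 * T))) (fun s hs => ?_) fun z _ =>
    (clippedFlow_spec hξ hc hT z).2.continuousOn
  refine (LipschitzWith.of_dist_le_mul fun z z' => ?_).lipschitzOnWith
  have h1 := clippedFlow_spec hξ hc hT z
  have h2 := clippedFlow_spec hξ hc hT z'
  have h := h1.2.dist_le hc h2.2 hs
  rw [h1.1, h2.1, mul_comm] at h
  rw [Real.coe_toNNReal _ (Real.exp_pos _).le]
  refine h.trans ?_
  gcongr
  exact hs.2

lemma mem_loewnerDomain_of_le_im {c T : ℝ} (hc : 0 < c) {t : ℝ} (ht : t ∈ Icc 0 T) {z : ℂ}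
    (hz : z ∈ upperHalf) (h : c ≤ (clippedFlow ξ c T z t).im) :
    z ∈ loewnerDomain ξ t ∧ loewnerMap ξ t z = clippedFlow ξ c T z t := by
  have h1 := clippedFlow_spec hξ hc (ht.1.trans ht.2) z
  have h2 := (h1.2.mono ht.2).isLoewnerTrajectory hc h
  rw [h1.1] at h2
  exact ⟨⟨hz, _, h2⟩, h2.loewnerMap_eq hξ hz ⟨ht.1, le_rfl⟩⟩

lemma clippedFlow_eq_loewnerMap {c T : ℝ} (hc : 0 < c) {t : ℝ} (ht : t ∈ Icc 0 T) {z : ℂ}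
    (hz : z ∈ loewnerDomain ξ t) (h : c ≤ (loewnerMap ξ t z).im) {s : ℝ} (hs : s ∈ Icc 0 t) :
    clippedFlow ξ c T z s = loewnerMap ξ s z := by
  have h1 := clippedFlow_spec hξ hc (ht.1.trans ht.2) z
  have h2 := isLoewnerTrajectory_loewnerMap hξ ht.1 hz
  have h3 := (h1.2.mono ht.2).dist_le hc (h2.isClippedSolution hξ hz.1 h) hs
  rw [h1.1, h2.init, dist_self, zero_mul] at h3
  exact dist_le_zero.1 h3

omit hξ in
lemma isOpen_upperHalf : IsOpen upperHalf := isOpen_lt continuous_const Complex.continuous_im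

/-- The space-time domain of the Loewner flow is relatively open and the flow is jointly
continuous. -/
lemma eventually_mem_and_continuousWithinAt {t : ℝ} (ht : 0 ≤ t) {z : ℂ}
    (hz : z ∈ loewnerDomain ξ t) :
    (∀ᶠ p : ℝ × ℂ in 𝓝[Ici 0 ×ˢ univ] (t, z), p.2 ∈ loewnerDomain ξ p.1) ∧
      ContinuousWithinAt (fun p : ℝ × ℂ => loewnerMap ξ p.1 p.2) (Ici 0 ×ˢ univ) (t, z) := by
  have hv := loewnerMap_im_pos hξ ht hz
  -- Half the height makes the condition "height above c" stable under perturbation, and the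
  -- truncated flow is run up to t + 1 to leave room after t.
  set c := (loewnerMap ξ t z).im / 2 with hc'
  have hc : 0 < c := by positivity
  have hT : 0 ≤ t + 1 := by linarith
  have htT : t ∈ Icc 0 (t + 1) := ⟨ht, by linarith⟩
  have hcf : ContinuousWithinAt (fun p : ℝ × ℂ => clippedFlow ξ c (t + 1) p.2 p.1)
      (Ici 0 ×ˢ univ) (t, z) := by
    refine ((continuousOn_clippedFlow hξ hc hT) (t, z) ⟨htT, mem_univ _⟩).mono_of_mem_nhdsWithin ?_
    have : Icc 0 (t + 1) ×ˢ univ = (Ici (0 : ℝ) ×ˢ (univ : Set ℂ)) ∩ (Iic (t + 1) ×ˢ univ) := by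
      rw [prod_inter_prod, Ici_inter_Iic, inter_univ]
    rw [this]
    exact inter_mem_nhdsWithin _ (prod_mem_nhds (Iic_mem_nhds (by linarith)) univ_mem)
  have he : clippedFlow ξ c (t + 1) z t = loewnerMap ξ t z :=
    clippedFlow_eq_loewnerMap hξ hc htT hz (by linarith) ⟨ht, le_rfl⟩
  have h1 : ∀ᶠ p : ℝ × ℂ in 𝓝[Ici 0 ×ˢ univ] (t, z), c < (clippedFlow ξ c (t + 1) p.2 p.1).im := by
    have := (Complex.continuous_im.continuousAt.comp_continuousWithinAt hcf).eventually
      (lt_mem_nhds (a := c) (by simp only [Function.comp, he]; linarith))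
    simpa using this
  have h2 : ∀ᶠ p : ℝ × ℂ in 𝓝[Ici 0 ×ˢ univ] (t, z), p.2 ∈ loewnerDomain ξ p.1 ∧
      loewnerMap ξ p.1 p.2 = clippedFlow ξ c (t + 1) p.2 p.1 := by
    have h3 : ∀ᶠ p : ℝ × ℂ in 𝓝[Ici 0 ×ˢ univ] (t, z), p.1 ≤ t + 1 ∧ p.2 ∈ upperHalf :=
      mem_nhdsWithin_of_mem_nhds (prod_mem_nhds (Iic_mem_nhds (by linarith))
        (isOpen_upperHalf.mem_nhds hz.1))
    filter_upwards [h1, h3, self_mem_nhdsWithin] with p hp1 hp2 hp3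
    exact mem_loewnerDomain_of_le_im hξ hc ⟨hp3.1, hp2.1⟩ hp2.2 hp1.le
  exact ⟨h2.mono fun p hp => hp.1, hcf.congr_of_eventuallyEq (h2.mono fun p hp => hp.2) he.symm⟩

lemma isOpen_loewnerDomain {t : ℝ} (ht : 0 ≤ t) : IsOpen (loewnerDomain ξ t) := by
  refine isOpen_iff_mem_nhds.2 fun z hz => ?_
  have h := (eventually_mem_and_continuousWithinAt hξ ht hz).1
  have h2 : Tendsto (fun z : ℂ => (t, z)) (𝓝 z) (𝓝[Ici 0 ×ˢ univ] (t, z)) :=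
    tendsto_nhdsWithin_of_tendsto_nhds_of_eventually_within _
      (Continuous.tendsto (by fun_prop) z) (Eventually.of_forall fun z => ⟨ht, mem_univ _⟩)
  exact h2.eventually h

lemma continuousAt_loewnerMap {t : ℝ} (ht : 0 ≤ t) {z : ℂ} (hz : z ∈ loewnerDomain ξ t) :
    ContinuousAt (loewnerMap ξ t) z := by
  have h := (eventually_mem_and_continuousWithinAt hξ ht hz).2
  have h2 : Tendsto (fun z : ℂ => (t, z)) (𝓝 z) (𝓝[Ici 0 ×ˢ univ] (t, z)) :=
    tendsto_nhdsWithin_of_tendsto_nhds_of_eventually_within _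
      (Continuous.tendsto (by fun_prop) z) (Eventually.of_forall fun z => ⟨ht, mem_univ _⟩)
  exact h.tendsto.comp h2

lemma exists_gt_mem_loewnerDomain {t : ℝ} (ht : 0 ≤ t) {z : ℂ} (hz : z ∈ loewnerDomain ξ t) :
    ∃ T, t < T ∧ z ∈ loewnerDomain ξ T := by
  have h := (eventually_mem_and_continuousWithinAt hξ ht hz).1
  have h2 : Tendsto (fun s : ℝ => (s, z)) (𝓝[>] t) (𝓝[Ici 0 ×ˢ univ] (t, z)) :=
    tendsto_nhdsWithin_of_tendsto_nhds_of_eventually_within _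
      ((Continuous.tendsto (by fun_prop) t).mono_left nhdsWithin_le_nhds)
      (by filter_upwards [self_mem_nhdsWithin] with s hs using ⟨ht.trans (le_of_lt hs), mem_univ _⟩)
  obtain ⟨T, hT, hT'⟩ := ((h2.eventually h).and self_mem_nhdsWithin).exists
  exact ⟨T, hT', hT⟩

lemma continuousOn_ofReal_driving {t : ℝ} : ContinuousOn (fun s => (ξ s : ℂ)) (Icc 0 t) :=
  Complex.continuous_ofReal.comp_continuousOn (hξ.mono Icc_subset_Ici_self)

lemma continuousOn_two_div_mul {t : ℝ} (ht : 0 ≤ t) {z w : ℂ} (hz : z ∈ loewnerDomain ξ t)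
    (hw : w ∈ loewnerDomain ξ t) : ContinuousOn (fun s => -2 /
      ((loewnerMap ξ s z - ξ s) * (loewnerMap ξ s w - ξ s))) (Icc 0 t) := by
  refine ContinuousOn.div continuousOn_const (ContinuousOn.mul ?_ ?_) fun s hs => mul_ne_zero
    (loewnerMap_sub_ne_zero hξ hs.1 (loewnerDomain_anti hs.2 hz))
    (loewnerMap_sub_ne_zero hξ hs.1 (loewnerDomain_anti hs.2 hw))
  · exact (isLoewnerTrajectory_loewnerMap hξ ht hz).continuousOn.sub (continuousOn_ofReal_driving hξ)
  · exact (isLoewnerTrajectory_loewnerMap hξ ht hw).continuousOn.sub (continuousOn_ofReal_driving hξ)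

/-- The difference of two trajectories solves a linear equation with coefficient -2/((u - ξ)(v -
ξ)). The resulting formula yields both injectivity and the complex derivative, with no
differentiation of the flow in its initial value. -/
lemma loewnerMap_sub_loewnerMap {t : ℝ} (ht : 0 ≤ t) {z w : ℂ} (hz : z ∈ loewnerDomain ξ t)
    (hw : w ∈ loewnerDomain ξ t) : loewnerMap ξ t z - loewnerMap ξ t w =
      (z - w) * Complex.exp (∫ s in 0..t, -2 /
        ((loewnerMap ξ s z - ξ s) * (loewnerMap ξ s w - ξ s))) := by
  have h1 := isLoewnerTrajectory_loewnerMap hξ ht hz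
  have h2 := isLoewnerTrajectory_loewnerMap hξ ht hw
  have := eq_mul_exp_of_hasDerivWithinAt (f := fun s => loewnerMap ξ s z - loewnerMap ξ s w)
    (continuousOn_two_div_mul hξ ht hz hw) (fun s hs => by
      refine ((h1.deriv s hs).sub (h2.deriv s hs)).congr_deriv ?_
      have e1 := loewnerMap_sub_ne_zero hξ hs.1 (loewnerDomain_anti hs.2 hz)
      have e2 := loewnerMap_sub_ne_zero hξ hs.1 (loewnerDomain_anti hs.2 hw)
      field_simp
      ring) ⟨ht, le_rfl⟩
  simpa only [h1.init, h2.init] using this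

lemma injOn_loewnerMap {t : ℝ} (ht : 0 ≤ t) : InjOn (loewnerMap ξ t) (loewnerDomain ξ t) := by
  intro z hz w hw h
  have := loewnerMap_sub_loewnerMap hξ ht hz hw
  rw [h, sub_self, eq_comm, mul_eq_zero] at this
  exact sub_eq_zero.1 (this.resolve_right (Complex.exp_ne_zero _))

/-- Solve backwards from y with truncation level Im y: backwards in time the height only grows, so
the truncation is harmless. -/
lemma surjOn_loewnerMap {t : ℝ} (ht : 0 ≤ t) :
    SurjOn (loewnerMap ξ t) (loewnerDomain ξ t) upperHalf := by
  intro y (hy : 0 < y.im)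
  obtain ⟨u, hut, hu⟩ := exists_isClippedSolution hξ hy (⟨ht, le_rfl⟩ : t ∈ Icc 0 t) y
  have h0 : u 0 ∈ upperHalf := by
    have := hu.antitoneOn_im hy ⟨le_rfl, ht⟩ ⟨ht, le_rfl⟩ ht
    simp only [hut] at this
    exact hy.trans_le this
  have htr := hu.isLoewnerTrajectory hy (by rw [hut])
  exact ⟨u 0, ⟨h0, u, htr⟩, (htr.loewnerMap_eq hξ h0 ⟨ht, le_rfl⟩).trans hut⟩

/-- The difference quotient is an exponential of an integral that is continuous in the moving point,
the integrand being dominated by 2/c² while both heights exceed c. -/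
lemma hasDerivAt_loewnerMap {t : ℝ} (ht : 0 ≤ t) {z : ℂ} (hz : z ∈ loewnerDomain ξ t) :
    HasDerivAt (loewnerMap ξ t) (Complex.exp (∫ s in 0..t, -2 / (loewnerMap ξ s z - ξ s) ^ 2)) z := by
  have hD := (isOpen_loewnerDomain hξ ht).mem_nhds hz
  set c := (loewnerMap ξ t z).im / 2 with hc'
  have hv := loewnerMap_im_pos hξ ht hz
  have hc : 0 < c := by positivity
  have hcz : c < (loewnerMap ξ t z).im := by linarith
  have hcont : ContinuousAt (fun w => ∫ s in 0..t, -2 /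
      ((loewnerMap ξ s w - ξ s) * (loewnerMap ξ s z - ξ s))) z := by
    refine intervalIntegral.continuousAt_of_dominated_interval (bound := fun _ => 2 / (c * c)) ?_ ?_
      intervalIntegrable_const ?_
    · filter_upwards [hD] with w hw
      refine ((continuousOn_two_div_mul hξ ht hw hz).mono ?_).aestronglyMeasurable
        measurableSet_uIoc
      rw [uIoc_of_le ht]; exact Ioc_subset_Icc_self
    · have := (Complex.continuous_im.continuousAt.comp
        (continuousAt_loewnerMap hξ ht hz)).eventually (lt_mem_nhds hcz)
      filter_upwards [hD, this] with w hw hcw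
      refine ae_of_all _ fun s hs => ?_
      rw [uIoc_of_le ht] at hs
      rw [norm_div, norm_neg, Complex.norm_ofNat, norm_mul]
      have e1 := (hcw.le.trans (loewnerMap_im_anti hξ hs.1.le hs.2 hw)).trans
        (norm_sub_ofReal_ge _ (ξ s))
      have e2 := (hcz.le.trans (loewnerMap_im_anti hξ hs.1.le hs.2 hz)).trans
        (norm_sub_ofReal_ge _ (ξ s))
      gcongr
    · refine ae_of_all _ fun s hs => ?_
      rw [uIoc_of_le ht] at hs
      have hzs := loewnerDomain_anti hs.2 hz
      have hne := loewnerMap_sub_ne_zero hξ hs.1.le hzs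
      exact continuousAt_const.div (((continuousAt_loewnerMap hξ hs.1.le hzs).sub
        continuousAt_const).mul continuousAt_const) (mul_ne_zero hne hne)
  rw [hasDerivAt_iff_tendsto_slope]
  have h := (Complex.continuous_exp.continuousAt.comp hcont).tendsto.mono_left
    (nhdsWithin_le_nhds (s := {z}ᶜ))
  simp only [Function.comp, ← pow_two] at h
  refine h.congr' ?_
  filter_upwards [self_mem_nhdsWithin, mem_nhdsWithin_of_mem_nhds hD] with w hw hwD
  rw [slope_def_field, loewnerMap_sub_loewnerMap hξ ht hwD hz,
    mul_div_cancel_left₀ _ (sub_ne_zero.2 hw)]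
  rfl

lemma hasDerivWithinAt_sq_im_loewnerMap {t : ℝ} (ht : 0 ≤ t) {z : ℂ} (hz : z ∈ loewnerDomain ξ t)
    {s : ℝ} (hs : s ∈ Icc 0 t) : HasDerivWithinAt (fun s => (loewnerMap ξ s z).im ^ 2)
      (-4 * ((loewnerMap ξ s z).im ^ 2 / Complex.normSq (loewnerMap ξ s z - ξ s))) (Icc 0 t) s := by
  have h := ((isLoewnerTrajectory_loewnerMap hξ ht hz).hasDerivWithinAt_im hs).pow 2
  refine h.congr_deriv ?_
  simp only [Nat.cast_ofNat]
  ring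

omit hξ in
lemma sq_im_div_normSq_le_one (u : ℂ) (x : ℝ) : u.im ^ 2 / Complex.normSq (u - x) ≤ 1 := by
  refine div_le_one_of_le₀ ?_ (Complex.normSq_nonneg _)
  rw [Complex.normSq_apply, Complex.sub_im, Complex.ofReal_im, sub_zero]
  nlinarith [mul_self_nonneg (u - x).re]

/-- The squared height decreases at rate 4(Im u)²/|u - ξ|² ≤ 4. -/
lemma sq_im_loewnerMap_le {a b : ℝ} (ha : 0 ≤ a) (hab : a ≤ b) {z : ℂ}
    (hz : z ∈ loewnerDomain ξ b) :
    (loewnerMap ξ a z).im ^ 2 ≤ (loewnerMap ξ b z).im ^ 2 + 4 * (b - a) := by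
  have hb := ha.trans hab
  have hm : MonotoneOn (fun s => (loewnerMap ξ s z).im ^ 2 + 4 * s) (Icc 0 b) := by
    have hd : ∀ s ∈ Icc 0 b, HasDerivWithinAt (fun s => (loewnerMap ξ s z).im ^ 2 + 4 * s)
        (-4 * ((loewnerMap ξ s z).im ^ 2 / Complex.normSq (loewnerMap ξ s z - ξ s)) + 4 * 1)
        (Icc 0 b) s := fun s hs =>
      (hasDerivWithinAt_sq_im_loewnerMap hξ hb hz hs).add ((hasDerivWithinAt_id s _).const_mul 4)
    refine monotoneOn_of_hasDerivWithinAt_nonneg (convex_Icc 0 b)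
      (fun s hs => (hd s hs).continuousWithinAt)
      (fun s hs => (hd s (interior_subset hs)).mono interior_subset) fun s _ => ?_
    have := sq_im_div_normSq_le_one (loewnerMap ξ s z) (ξ s)
    linarith
  have := hm ⟨ha, hab⟩ ⟨hb, le_rfl⟩ hab
  simp only at this
  linarith

/-- A point of height V survives at least for a time V²/4. Otherwise the truncated flow would cross
the level c before b, and the rate bound up to the crossing contradicts the choice of c. -/
lemma mem_loewnerDomain_of_lt_sq_im {a b : ℝ} (ha : 0 ≤ a) (hab : a ≤ b) {z : ℂ}
    (hz : z ∈ loewnerDomain ξ a) (h : 4 * (b - a) < (loewnerMap ξ a z).im ^ 2) :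
    z ∈ loewnerDomain ξ b := by
  have hv := loewnerMap_im_pos hξ ha hz
  obtain ⟨c, hc, hcv⟩ : ∃ c > 0, c ^ 2 < (loewnerMap ξ a z).im ^ 2 - 4 * (b - a) := by
    have hpos : 0 < (loewnerMap ξ a z).im ^ 2 - 4 * (b - a) := by linarith
    refine ⟨√((loewnerMap ξ a z).im ^ 2 - 4 * (b - a)) / 2, by positivity, ?_⟩
    rw [div_pow, Real.sq_sqrt hpos.le]
    linarith
  have hcv' : c ≤ (loewnerMap ξ a z).im := by
    refine le_of_sq_le_sq ?_ hv.le
    linarith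
  have hspec := clippedFlow_spec hξ hc (ha.trans hab) z
  by_contra hnb
  have hlt : (clippedFlow ξ c b z b).im < c := by
    by_contra hge
    exact hnb (mem_loewnerDomain_of_le_im hξ hc ⟨ha.trans hab, le_rfl⟩ hz.1 (not_lt.1 hge)).1
  have hcont : ContinuousOn (fun s => (clippedFlow ξ c b z s).im) (Icc a b) :=
    Complex.continuous_im.comp_continuousOn (hspec.2.continuousOn.mono (Icc_subset_Icc_left ha))
  have hfa : clippedFlow ξ c b z a = loewnerMap ξ a z :=
    clippedFlow_eq_loewnerMap hξ hc ⟨ha, hab⟩ hz hcv' ⟨ha, le_rfl⟩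
  obtain ⟨s, hs, hsc⟩ := intermediate_value_Icc' hab hcont
    (⟨hlt.le, by simp only [hfa]; exact hcv'⟩ : c ∈ Icc _ _)
  simp only at hsc
  obtain ⟨hzs, hgs⟩ := mem_loewnerDomain_of_le_im hξ hc ⟨ha.trans hs.1, hs.2⟩ hz.1 hsc.ge
  have := sq_im_loewnerMap_le hξ ha hs.1 hzs
  rw [hgs, hsc] at this
  linarith [hs.2]

end LoewnerFlow

end

end MassiveHadamard

namespace MassiveHadamard

noncomputable section

open Set Filter MeasureTheory Metric InnerProductSpace
open scoped Laplacian

/-! ### Injective holomorphic maps. -/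

section Univalent

variable {Λ : Set ℂ} {f : ℂ → ℂ} (hΛ : IsOpen Λ) (hf : DifferentiableOn ℂ f Λ) (hi : InjOn f Λ)

include hΛ hf hi

omit hf in
lemma not_eventually_eq_of_injOn {x : ℂ} (hx : x ∈ Λ) : ¬ ∀ᶠ y in 𝓝 x, f y = f x := by
  intro h
  have h1 : ∀ᶠ y in 𝓝[≠] x, f y = f x ∧ y ∈ Λ :=
    (h.and (hΛ.mem_nhds hx)).filter_mono nhdsWithin_le_nhds
  obtain ⟨y, ⟨hy, hyΛ⟩, hyx⟩ := (h1.and self_mem_nhdsWithin).exists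
  exact hyx (hi hyΛ hx hy)

lemma nhds_le_map_of_injOn {x : ℂ} (hx : x ∈ Λ) : 𝓝 (f x) ≤ map f (𝓝 x) :=
  (hf.analyticAt (hΛ.mem_nhds hx)).eventually_constant_or_nhds_le_map_nhds.resolve_left
    (not_eventually_eq_of_injOn hΛ hi hx)

lemma eventually_mem_image_of_injOn {x : ℂ} (hx : x ∈ Λ) : ∀ᶠ y in 𝓝 (f x), y ∈ f '' Λ :=
  nhds_le_map_of_injOn hΛ hf hi hx (image_mem_map (hΛ.mem_nhds hx))

lemma continuousAt_invFunOn {x : ℂ} (hx : x ∈ Λ) :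
    ContinuousAt (Function.invFunOn f Λ) (f x) := by
  intro U hU
  rw [hi.leftInvOn_invFunOn hx] at hU
  have h : f '' (U ∩ Λ) ∈ 𝓝 (f x) :=
    nhds_le_map_of_injOn hΛ hf hi hx (image_mem_map (inter_mem hU (hΛ.mem_nhds hx)))
  refine mem_map.2 (mem_of_superset h ?_)
  rintro _ ⟨y, ⟨hyU, hyΛ⟩, rfl⟩
  rwa [mem_preimage, hi.leftInvOn_invFunOn hyΛ]

lemma hasDerivAt_invFunOn_of_ne {x : ℂ} (hx : x ∈ Λ) (h : deriv f x ≠ 0) :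
    HasDerivAt (Function.invFunOn f Λ) (deriv f x)⁻¹ (f x) := by
  refine HasDerivAt.of_local_left_inverse (f := f) (continuousAt_invFunOn hΛ hf hi hx) ?_ h ?_
  · rw [hi.leftInvOn_invFunOn hx]
    exact (hf.differentiableAt (hΛ.mem_nhds hx)).hasDerivAt
  · filter_upwards [eventually_mem_image_of_injOn hΛ hf hi hx] with y hy
    exact Function.invFunOn_eq hy

/-- An injective holomorphic function has no critical points. -/
lemma deriv_ne_zero_of_injOn {x : ℂ} (hx : x ∈ Λ) : deriv f x ≠ 0 := by
  have ha := (hf.analyticAt (hΛ.mem_nhds hx))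
  -- Zeros of the derivative are isolated; otherwise f would be constant on a disc, against
  -- injectivity.
  have hne : ∀ᶠ y in 𝓝[≠] x, deriv f y ≠ 0 := by
    refine ha.deriv.eventually_eq_zero_or_eventually_ne_zero.resolve_left fun h => ?_
    obtain ⟨r, hr, hball⟩ := Metric.eventually_nhds_iff_ball.1 (h.and (hΛ.mem_nhds hx))
    refine not_eventually_eq_of_injOn hΛ hi hx ?_
    filter_upwards [ball_mem_nhds x hr] with y hy
    exact (convex_ball x r).is_const_of_fderivWithin_eq_zero (𝕜 := ℂ)
      (hf.mono fun z hz => (hball z hz).2) (fun z hz => by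
        rw [fderivWithin_of_isOpen isOpen_ball hz]
        ext
        rw [fderiv_apply_one_eq_deriv, (hball z hz).1]; rfl) hy (mem_ball_self hr)
  obtain ⟨U, hU, hUne⟩ : ∃ U ∈ 𝓝 x, ∀ y ∈ U, y ≠ x → deriv f y ≠ 0 :=
    ⟨_, eventually_nhdsWithin_iff.1 hne, fun y hy hyx => hy hyx⟩
  have hS : f '' (U ∩ Λ) ∈ 𝓝 (f x) :=
    nhds_le_map_of_injOn hΛ hf hi hx (image_mem_map (inter_mem hU (hΛ.mem_nhds hx)))
  -- The inverse is holomorphic off f x and continuous there, so the singularity is removable; the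
  -- chain rule for the identity then rules out a vanishing derivative.
  have hd : DifferentiableOn ℂ (Function.invFunOn f Λ) (f '' (U ∩ Λ)) := by
    refine (Complex.differentiableOn_compl_singleton_and_continuousAt_iff hS).1
      ⟨?_, continuousAt_invFunOn hΛ hf hi hx⟩
    rintro _ ⟨⟨y, ⟨hyU, hyΛ⟩, rfl⟩, hyx⟩
    have : y ≠ x := fun h => hyx (by rw [h]; rfl)
    exact (hasDerivAt_invFunOn_of_ne hΛ hf hi hyΛ
      (hUne y hyU this)).differentiableAt.differentiableWithinAt
  have hd' := (hd.differentiableAt hS).hasDerivAt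
  have hcomp := hd'.comp x ha.differentiableAt.hasDerivAt
  have hid : Function.invFunOn f Λ ∘ f =ᶠ[𝓝 x] id := by
    filter_upwards [hΛ.mem_nhds hx] with y hy using hi.leftInvOn_invFunOn hy
  have := (hcomp.congr_of_eventuallyEq hid.symm).unique (hasDerivAt_id x)
  exact right_ne_zero_of_mul_eq_one this

lemma hasDerivAt_invFunOn {x : ℂ} (hx : x ∈ Λ) :
    HasDerivAt (Function.invFunOn f Λ) (deriv f x)⁻¹ (f x) :=
  hasDerivAt_invFunOn_of_ne hΛ hf hi hx (deriv_ne_zero_of_injOn hΛ hf hi hx)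

end Univalent

/-! ### Green functions of the half-plane and of its conformal images. -/

/-- The Dirichlet Green function of the upper half-plane. -/
def halfPlaneGreen (X Y : ℂ) : ℝ :=
  (4 * Real.pi)⁻¹ * Real.log (1 + 4 * X.im * Y.im / Complex.normSq (X - Y))

lemma halfPlaneGreen_symm (X Y : ℂ) : halfPlaneGreen X Y = halfPlaneGreen Y X := by
  rw [halfPlaneGreen, halfPlaneGreen, ← Complex.normSq_neg (X - Y), neg_sub]
  ring_nf

lemma halfPlaneGreen_self (X : ℂ) : halfPlaneGreen X X = 0 := by simp [halfPlaneGreen]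

section HalfPlane

variable {X Y : ℂ} (hX : 0 < X.im) (hY : 0 < Y.im)

include hX hY

lemma halfPlaneGreen_nonneg : 0 ≤ halfPlaneGreen X Y := by
  refine mul_nonneg (by positivity) (Real.log_nonneg ?_)
  have : 0 ≤ 4 * X.im * Y.im / Complex.normSq (X - Y) :=
    div_nonneg (by positivity) (Complex.normSq_nonneg _)
  linarith

/-- The inequality log(1 + x) ≤ x, which exhibits the decay at the boundary and at infinity. -/
lemma halfPlaneGreen_le :
    halfPlaneGreen X Y ≤ X.im * Y.im / (Real.pi * Complex.normSq (X - Y)) := by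
  have h : 0 ≤ 4 * X.im * Y.im / Complex.normSq (X - Y) :=
    div_nonneg (by positivity) (Complex.normSq_nonneg _)
  have := Real.log_le_sub_one_of_pos (x := 1 + 4 * X.im * Y.im / Complex.normSq (X - Y)) (by linarith)
  calc halfPlaneGreen X Y ≤ (4 * Real.pi)⁻¹ * (4 * X.im * Y.im / Complex.normSq (X - Y)) := by
        refine mul_le_mul_of_nonneg_left ?_ (by positivity)
        linarith
    _ = _ := by
        rw [← div_div, inv_mul_eq_div, div_div, div_div, div_eq_div_iff_comm]
        rcases eq_or_ne (Complex.normSq (X - Y)) 0 with h0 | h0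
        · simp [h0]
        · field_simp

lemma halfPlaneGreen_eq (hXY : X ≠ Y) : halfPlaneGreen X Y =
    (2 * Real.pi)⁻¹ * (Real.log ‖Y - (starRingEnd ℂ) X‖ - Real.log ‖Y - X‖) := by
  have h1 : 0 < ‖Y - X‖ := norm_pos_iff.2 (sub_ne_zero.2 hXY.symm)
  have h2 : 0 < ‖Y - (starRingEnd ℂ) X‖ := by
    refine lt_of_lt_of_le ?_ (Complex.abs_im_le_norm _)
    simp only [Complex.sub_im, Complex.conj_im, sub_neg_eq_add]
    positivity
  have e : 1 + 4 * X.im * Y.im / Complex.normSq (X - Y) =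
      ‖Y - (starRingEnd ℂ) X‖ ^ 2 / ‖Y - X‖ ^ 2 := by
    rw [← Complex.sq_norm, norm_sub_rev X Y, eq_div_iff (by positivity), add_mul,
      div_mul_cancel₀ _ (by positivity), Complex.sq_norm, Complex.sq_norm, Complex.normSq_apply,
      Complex.normSq_apply]
    simp only [Complex.sub_re, Complex.sub_im, Complex.conj_re, Complex.conj_im]
    ring
  rw [halfPlaneGreen, e, Real.log_div (by positivity) (by positivity), Real.log_pow, Real.log_pow]
  push_cast
  field_simp
  ring

end HalfPlane

/-- Superlevel sets of the Green function of the half-plane are contained in compact sets. -/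
lemma exists_isCompact_halfPlaneGreen_lt {X : ℂ} (hX : 0 < X.im) {η : ℝ} (hη : 0 < η) :
    ∃ K ⊆ upperHalf, IsCompact K ∧ ∀ Y ∈ upperHalf, Y ∉ K → halfPlaneGreen X Y < η := by
  -- Below height c one has |Y - X| ≥ Im X / 2, and the upper bound becomes 4 Im Y/(π Im X) < η.
  -- Beyond radius ρ one has Im Y ≤ 2|Y - X|, and it becomes 2 Im X/(π|Y - X|) < η.
  set c := min (X.im / 2) (Real.pi * η * X.im / 4) with hc
  set ρ := max X.im (2 * X.im / (Real.pi * η)) with hρ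
  have hπ := Real.pi_pos
  have hc0 : 0 < c := by positivity
  have hρ0 : 0 < ρ := lt_max_of_lt_left hX
  refine ⟨closedBall X ρ ∩ {Y | c ≤ Y.im}, fun Y hY => hc0.trans_le hY.2,
    (isCompact_closedBall X ρ).inter_right (isClosed_le continuous_const Complex.continuous_im),
    fun Y (hY : 0 < Y.im) hYK => ?_⟩
  refine (halfPlaneGreen_le hX hY).trans_lt ?_
  rw [← Complex.sq_norm, norm_sub_rev]
  by_cases hYc : c ≤ Y.im
  · have hd : ρ < ‖Y - X‖ := by
      by_contra h
      exact hYK ⟨by rw [mem_closedBall, dist_eq_norm]; exact not_lt.1 h, hYc⟩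
    have h1 : Y.im ≤ 2 * ‖Y - X‖ := by
      have := (le_abs_self _).trans (Complex.abs_im_le_norm (Y - X))
      rw [Complex.sub_im] at this
      linarith [le_max_left X.im (2 * X.im / (Real.pi * η))]
    have h2 : 2 * X.im / (Real.pi * η) < ‖Y - X‖ := (le_max_right _ _).trans_lt hd
    have hp : 0 < ‖Y - X‖ := hρ0.trans hd
    rw [div_lt_iff₀ (by positivity)] at h2 ⊢
    calc X.im * Y.im ≤ (2 * X.im) * ‖Y - X‖ := by nlinarith
      _ < ‖Y - X‖ * (Real.pi * η) * ‖Y - X‖ := by gcongr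
      _ = _ := by ring
  · push Not at hYc
    have h1 : X.im / 2 ≤ ‖Y - X‖ := by
      have := (neg_le_abs _).trans (Complex.abs_im_le_norm (Y - X))
      rw [Complex.sub_im] at this
      linarith [min_le_left (X.im / 2) (Real.pi * η * X.im / 4)]
    have h2 : Y.im < Real.pi * η * X.im / 4 := hYc.trans_le (min_le_right _ _)
    have hp : 0 < ‖Y - X‖ := lt_of_lt_of_le (by positivity) h1
    rw [div_lt_iff₀ (by positivity)]
    calc X.im * Y.im < X.im * (Real.pi * η * X.im / 4) := by gcongr
      _ = η * (Real.pi * (X.im / 2) ^ 2) := by ring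
      _ ≤ _ := by gcongr

open Classical in
/-- The Dirichlet Green function of `Λ` transported from the half-plane by `f`, extended by zero. -/
def conformalGreen (Λ : Set ℂ) (f : ℂ → ℂ) (x y : ℂ) : ℝ :=
  if x ∈ Λ ∧ y ∈ Λ then halfPlaneGreen (f x) (f y) else 0

lemma conformalGreen_of_mem {Λ : Set ℂ} {f : ℂ → ℂ} {x y : ℂ} (hx : x ∈ Λ) (hy : y ∈ Λ) :
    conformalGreen Λ f x y = halfPlaneGreen (f x) (f y) := if_pos ⟨hx, hy⟩

lemma conformalGreen_of_notMem {Λ : Set ℂ} {f : ℂ → ℂ} {x y : ℂ} (hx : x ∉ Λ) :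
    conformalGreen Λ f x y = 0 := if_neg fun h => hx h.1

lemma conformalGreen_symm (Λ : Set ℂ) (f : ℂ → ℂ) (x y : ℂ) :
    conformalGreen Λ f x y = conformalGreen Λ f y x := by
  rw [conformalGreen, conformalGreen, halfPlaneGreen_symm]
  split_ifs with h1 h2 h2
  · rfl
  · exact absurd h1.symm h2
  · exact absurd h2.symm h1
  · rfl

section Conformal

variable {Λ : Set ℂ} {f : ℂ → ℂ} (hΛ : IsOpen Λ) (hf : DifferentiableOn ℂ f Λ)
  (hb : BijOn f Λ upperHalf)

include hf hb in
lemma continuousOn_conformalGreen : ContinuousOn (fun p : ℂ × ℂ => conformalGreen Λ f p.1 p.2)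
    {p | p.1 ∈ Λ ∧ p.2 ∈ Λ ∧ p.1 ≠ p.2} := by
  have h1 : ContinuousOn (fun p : ℂ × ℂ => f p.1) {p | p.1 ∈ Λ ∧ p.2 ∈ Λ ∧ p.1 ≠ p.2} :=
    hf.continuousOn.comp continuousOn_fst fun p hp => hp.1
  have h2 : ContinuousOn (fun p : ℂ × ℂ => f p.2) {p | p.1 ∈ Λ ∧ p.2 ∈ Λ ∧ p.1 ≠ p.2} :=
    hf.continuousOn.comp continuousOn_snd fun p hp => hp.2.1
  have hn : ∀ p ∈ {p : ℂ × ℂ | p.1 ∈ Λ ∧ p.2 ∈ Λ ∧ p.1 ≠ p.2},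
      Complex.normSq (f p.1 - f p.2) ≠ 0 := fun p hp h =>
    hp.2.2 (hb.injOn hp.1 hp.2.1 (sub_eq_zero.1 (Complex.normSq_eq_zero.1 h)))
  have h3 : ContinuousOn (fun p : ℂ × ℂ => halfPlaneGreen (f p.1) (f p.2))
      {p | p.1 ∈ Λ ∧ p.2 ∈ Λ ∧ p.1 ≠ p.2} := by
    refine continuousOn_const.mul (ContinuousOn.log ?_ fun p hp => ?_)
    · refine continuousOn_const.add (ContinuousOn.div ?_ ?_ hn)
      · exact (continuousOn_const.mul (Complex.continuous_im.comp_continuousOn h1)).mul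
          (Complex.continuous_im.comp_continuousOn h2)
      · exact Complex.continuous_normSq.comp_continuousOn (h1.sub h2)
    · have e1 : 0 < (f p.1).im := hb.mapsTo hp.1
      have e2 : 0 < (f p.2).im := hb.mapsTo hp.2.1
      have := Complex.normSq_nonneg (f p.1 - f p.2)
      positivity
  exact h3.congr fun p hp => conformalGreen_of_mem hp.1 hp.2.1

include hΛ hf hb

/-- The Green function is the logarithmic kernel plus a harmonic function. -/
lemma exists_harmonicAt_conformalGreen (R : ℝ) (hR : 0 < R) {w : ℂ} (hw : w ∈ Λ) :
    ∃ H : ℂ → ℝ, (∀ z ∈ Λ, HarmonicAt H z) ∧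
      ∀ z ∈ Λ, z ≠ w → conformalGreen Λ f w z = logKernel R (z - w) + H z := by
  -- Write f z - f w = (z - w)q(z) with q holomorphic and zero-free by univalence; the factor z - w
  -- carries the logarithmic pole and log|q| is harmonic.
  have hqd : DifferentiableOn ℂ (dslope f w) Λ :=
    (Complex.differentiableOn_dslope (hΛ.mem_nhds hw)).2 hf
  have hq0 : ∀ z ∈ Λ, dslope f w z ≠ 0 := fun z hz => by
    rcases eq_or_ne z w with rfl | h
    · rw [dslope_same]; exact deriv_ne_zero_of_injOn hΛ hf hb.injOn hz
    · rw [dslope_of_ne _ h, slope_def_field]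
      exact div_ne_zero (sub_ne_zero.2 fun e => h (hb.injOn hz hw e)) (sub_ne_zero.2 h)
  have hwim : 0 < (f w).im := hb.mapsTo hw
  have hc0 : ∀ z ∈ Λ, f z - (starRingEnd ℂ) (f w) ≠ 0 := fun z hz h => by
    have hzim : 0 < (f z).im := hb.mapsTo hz
    have := congrArg Complex.im h
    simp only [Complex.sub_im, Complex.conj_im, sub_neg_eq_add, Complex.zero_im] at this
    linarith
  have hcd : DifferentiableOn ℂ (fun z => f z - (starRingEnd ℂ) (f w)) Λ := hf.sub_const _
  refine ⟨(2 * Real.pi)⁻¹ • ((fun z => Real.log ‖f z - (starRingEnd ℂ) (f w)‖) -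
    (fun z => Real.log ‖dslope f w z‖) - fun _ => Real.log R), fun z hz => ?_, fun z hz hzw => ?_⟩
  · exact ((((hcd.analyticAt (hΛ.mem_nhds hz)).harmonicAt_log_norm (hc0 z hz)).sub
      ((hqd.analyticAt (hΛ.mem_nhds hz)).harmonicAt_log_norm (hq0 z hz))).sub
      (harmonicAt_const _)).const_smul
  · have hzim : 0 < (f z).im := hb.mapsTo hz
    have hne : f w ≠ f z := fun e => hzw (hb.injOn hw hz e).symm
    have hzw' : 0 < ‖z - w‖ := norm_pos_iff.2 (sub_ne_zero.2 hzw)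
    have e : f z - f w = (z - w) * dslope f w z := by
      rw [dslope_of_ne _ hzw, slope_def_field, mul_div_cancel₀ _ (sub_ne_zero.2 hzw)]
    rw [conformalGreen_of_mem hw hz, halfPlaneGreen_eq hwim hzim hne, e, norm_mul,
      Real.log_mul hzw'.ne' (norm_ne_zero_iff.2 (hq0 z hz)), logKernel, Real.log_div hR.ne' hzw'.ne']
    simp only [Pi.smul_apply, Pi.sub_apply, smul_eq_mul]
    ring

/-- The pole comes from the logarithmic kernel and the harmonic remainder contributes nothing to the
weak equation. At the boundary, superlevel sets are preimages of compact subsets of the half-plane,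
hence compact in Λ; no regularity of the boundary is needed. -/
lemma isMassiveGreen_conformalGreen {R : ℝ} (hR : 0 < R) {w : ℂ} (hw : w ∈ Λ)
    (hball : Λ ⊆ ball w R) : IsMassiveGreen 0 Λ w (conformalGreen Λ f w) := by
  obtain ⟨H, hH, hGH⟩ := exists_harmonicAt_conformalGreen hΛ hf hb R hR hw
  have hHc : ContinuousOn H Λ := fun z hz => (hH z hz).1.continuousAt.continuousWithinAt
  have hae : ∀ᵐ z ∂(volume.restrict Λ), logKernel R (z - w) + H z = conformalGreen Λ f w z := by
    refine (ae_restrict_iff' hΛ.measurableSet).2 ?_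
    filter_upwards [compl_mem_ae_iff.2 (measure_singleton w)] with z hz hzΛ
    exact (hGH z hzΛ hz).symm
  have hlog : LocallyIntegrableOn (fun z => logKernel R (z - w)) Λ := by
    have := (integrableOn_logKernel hball).locallyIntegrableOn
    simpa only [logKernel_sub_comm] using this
  have hHl : LocallyIntegrableOn H Λ := hHc.locallyIntegrableOn hΛ.measurableSet
  have hwim : 0 < (f w).im := hb.mapsTo hw
  refine ⟨?_, ?_, fun ψ hψ hψc hψΛ => ?_, fun ζ hζ => ?_⟩
  · refine (continuousOn_conformalGreen hf hb).comp (by fun_prop : ContinuousOn (fun z => (w, z)) _) ?_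
    exact fun z hz => ⟨hw, hz.1, fun h => hz.2 h.symm⟩
  · intro z hz
    obtain ⟨U, hU, hUi⟩ := (hlog.add hHl) z hz
    obtain ⟨V, hV, hVU⟩ := mem_nhdsWithin_iff_exists_mem_nhds_inter.1 hU
    refine ⟨U ∩ Λ, inter_mem hU self_mem_nhdsWithin, (hUi.mono_set inter_subset_left).congr ?_⟩
    exact ae_restrict_of_ae_restrict_of_subset inter_subset_right hae
  · have hsub : tsupport (Δ ψ) ⊆ Λ := (tsupport_laplacian_subset ψ).trans hψΛ
    obtain ⟨hi1, hv1⟩ := integral_logKernel_mul_neg_laplacian hR hψ hψc w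
    have hv2 : ∫ z, H z * Δ ψ z = 0 := by
      rw [integral_mul_laplacian hΛ (fun z hz => (hH z hz).1) hψ hψc hψΛ]
      refine integral_eq_zero_of_ae (ae_of_all _ fun z => ?_)
      by_cases hz : z ∈ Λ
      · simp [(hH z hz).2.self_of_nhds]
      · simp [image_eq_zero_of_notMem_tsupport fun h => hz (hψΛ h)]
    have hi2 : IntegrableOn (fun z => H z * Δ ψ z) Λ :=
      (integrable_mul_of_tsupport_subset hHl (contDiff_laplacian hψ).continuous
        (hasCompactSupport_laplacian hψc) hsub).integrableOn
    have hz0 : ∀ z, z ∉ Λ → Δ ψ z = 0 := fun z hz =>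
      image_eq_zero_of_notMem_tsupport fun h => hz (hsub h)
    have e1 : ∫ z in Λ, logKernel R (z - w) * (-Δ ψ z) = ψ w := by
      rw [← hv1]
      exact setIntegral_eq_integral_of_forall_compl_eq_zero fun z hz => by rw [hz0 z hz]; simp
    have e2 : ∫ z in Λ, H z * Δ ψ z = 0 := by
      rw [← hv2]
      exact setIntegral_eq_integral_of_forall_compl_eq_zero fun z hz => by rw [hz0 z hz]; simp
    calc ∫ z in Λ, conformalGreen Λ f w z * (0 ^ 2 * ψ z - Δ ψ z)
        = ∫ z in Λ, (logKernel R (z - w) * (-Δ ψ z) - H z * Δ ψ z) := by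
          refine integral_congr_ae ?_
          filter_upwards [hae] with z hz
          rw [← hz]; ring
      _ = ψ w := by rw [integral_sub hi1.integrableOn hi2, e1, e2, sub_zero]
  · rw [Metric.tendsto_nhds]
    intro η hη
    obtain ⟨K, hKH, hK, hlt⟩ := exists_isCompact_halfPlaneGreen_lt hwim hη
    have hinv : ContinuousOn (Function.invFunOn f Λ) K := fun y hy => by
      obtain ⟨x, hx, rfl⟩ := hb.surjOn (hKH hy)
      exact (continuousAt_invFunOn hΛ hf hb.injOn hx).continuousWithinAt
    have hcl : IsClosed (Function.invFunOn f Λ '' K) := (hK.image_of_continuousOn hinv).isClosed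
    have hζK : ζ ∉ Function.invFunOn f Λ '' K := by
      rintro ⟨y, hy, rfl⟩
      have : Function.invFunOn f Λ y ∈ Λ := Function.invFunOn_mem (hb.surjOn (hKH hy))
      rw [hΛ.frontier_eq] at hζ
      exact hζ.2 this
    filter_upwards [self_mem_nhdsWithin, mem_nhdsWithin_of_mem_nhds (hcl.isOpen_compl.mem_nhds hζK)]
      with z hz hzK
    have hzim : 0 < (f z).im := hb.mapsTo hz
    rw [conformalGreen_of_mem hw hz, Real.dist_eq, sub_zero,
      abs_of_nonneg (halfPlaneGreen_nonneg hwim hzim)]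
    refine hlt _ hzim fun h => hzK ⟨f z, h, hb.injOn.leftInvOn_invFunOn hz⟩

/-- A bounded domain uniformized by the half-plane has a Green function. -/
lemma greenKernel_conformalGreen {R : ℝ} (hR : 0 < R) (hball : ∀ z ∈ Λ, Λ ⊆ ball z R) :
    GreenKernel Λ R (conformalGreen Λ f) where
  isOpen := hΛ
  pos := hR
  subset_ball := hball
  symm := conformalGreen_symm Λ f
  nonneg x hx y hy := by
    rw [conformalGreen_of_mem hx hy]
    exact halfPlaneGreen_nonneg (hb.mapsTo hx) (hb.mapsTo hy)
  diag x := by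
    rw [conformalGreen, halfPlaneGreen_self]
    exact ite_self _
  cont := continuousOn_conformalGreen hf hb
  green w hw := isMassiveGreen_conformalGreen hΛ hf hb hR hw (hball w hw)

end Conformal

end

end MassiveHadamard

/-! ### Heights, and Hadamard's formula at mass zero. -/

namespace MassiveHadamard

noncomputable section

open Set Filter MeasureTheory Metric InnerProductSpace

/-- A bounded domain uniformized by the half-plane, together with a driving function. -/
structure LoewnerSetup (Ω : Set ℂ) (φ : ℂ → ℂ) (ξ : ℝ → ℝ) (R : ℝ) : Prop where
  isOpen : IsOpen Ω
  differentiableOn : DifferentiableOn ℂ φ Ω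
  bijOn : BijOn φ Ω upperHalf
  continuousOn : ContinuousOn ξ (Ici 0)
  pos : 0 < R
  subset_ball : ∀ z ∈ Ω, Ω ⊆ ball z R

open Classical in
/-- The imaginary part of `φ_t`, extended by zero off `Ω_t`. -/
def height (Ω : Set ℂ) (φ : ℂ → ℂ) (ξ : ℝ → ℝ) (t : ℝ) (x : ℂ) : ℝ :=
  if x ∈ evolvedDomain Ω φ ξ t then (loewnerMap ξ t (φ x)).im else 0

/-- The Green function of the Laplacian in `Ω_t`, extended by zero. -/
def evolvedGreen (Ω : Set ℂ) (φ : ℂ → ℂ) (ξ : ℝ → ℝ) (t : ℝ) : ℂ → ℂ → ℝ :=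
  conformalGreen (evolvedDomain Ω φ ξ t) (evolvedMap φ ξ t)

lemma height_of_mem {Ω : Set ℂ} {φ : ℂ → ℂ} {ξ : ℝ → ℝ} {t : ℝ} {x : ℂ}
    (hx : x ∈ evolvedDomain Ω φ ξ t) : height Ω φ ξ t x = (loewnerMap ξ t (φ x)).im := if_pos hx

lemma height_of_notMem {Ω : Set ℂ} {φ : ℂ → ℂ} {ξ : ℝ → ℝ} {t : ℝ} {x : ℂ}
    (hx : x ∉ evolvedDomain Ω φ ξ t) : height Ω φ ξ t x = 0 := if_neg hx

lemma evolvedMap_im (φ : ℂ → ℂ) (ξ : ℝ → ℝ) (t : ℝ) (x : ℂ) :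
    (evolvedMap φ ξ t x).im = (loewnerMap ξ t (φ x)).im := by simp [evolvedMap]

lemma evolvedDomain_anti {Ω : Set ℂ} {φ : ℂ → ℂ} {ξ : ℝ → ℝ} {s t : ℝ} (h : s ≤ t) :
    evolvedDomain Ω φ ξ t ⊆ evolvedDomain Ω φ ξ s :=
  fun _ hx => ⟨hx.1, loewnerDomain_anti h hx.2⟩

/-- The computation behind the massless formula, in real coordinates: A + iB and C + iD are two
Loewner trajectories and e is the value of the driving function. -/
lemma hasDerivWithinAt_log_one_add {A B C D : ℝ → ℝ} {e t : ℝ} {s : Set ℝ}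
    (hA : HasDerivWithinAt A (2 * (A t - e) / ((A t - e) ^ 2 + B t ^ 2)) s t)
    (hB : HasDerivWithinAt B (-2 * B t / ((A t - e) ^ 2 + B t ^ 2)) s t)
    (hC : HasDerivWithinAt C (2 * (C t - e) / ((C t - e) ^ 2 + D t ^ 2)) s t)
    (hD : HasDerivWithinAt D (-2 * D t / ((C t - e) ^ 2 + D t ^ 2)) s t)
    (hB0 : 0 < B t) (hD0 : 0 < D t) (hN : 0 < (A t - C t) ^ 2 + (B t - D t) ^ 2) :
    HasDerivWithinAt (fun r => (4 * Real.pi)⁻¹ *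
        Real.log (1 + 4 * B r * D r / ((A r - C r) ^ 2 + (B r - D r) ^ 2)))
      (-2 * Real.pi * (B t / (Real.pi * ((A t - e) ^ 2 + B t ^ 2)) *
        (D t / (Real.pi * ((C t - e) ^ 2 + D t ^ 2))))) s t := by
  have hn : HasDerivWithinAt (fun r => (A r - C r) ^ 2 + (B r - D r) ^ 2) _ s t :=
    ((hA.sub hC).pow 2).add ((hB.sub hD).pow 2)
  have hq : HasDerivWithinAt
      (fun r => 1 + 4 * B r * D r / ((A r - C r) ^ 2 + (B r - D r) ^ 2)) _ s t :=
    (((hB.const_mul 4).mul hD).div hn hN.ne').const_add 1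
  have h1 : 0 < 1 + 4 * B t * D t / ((A t - C t) ^ 2 + (B t - D t) ^ 2) := by positivity
  refine ((hq.log h1.ne').const_mul (4 * Real.pi)⁻¹).congr_deriv ?_
  simp only [Pi.sub_apply, Pi.mul_apply]
  generalize A t = a at *
  generalize B t = b at *
  generalize C t = c at *
  generalize D t = d at *
  have h2 : 0 < (a - c) ^ 2 + (b - d) ^ 2 + 4 * b * d := by positivity
  have e3 : 1 + 4 * b * d / ((a - c) ^ 2 + (b - d) ^ 2) =
    ((a - c) ^ 2 + (b - d) ^ 2 + 4 * b * d) / ((a - c) ^ 2 + (b - d) ^ 2) := by field_simp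
  rw [e3]
  have h3 : 0 < (a - e) ^ 2 + b ^ 2 := by positivity
  have h4 : 0 < (c - e) ^ 2 + d ^ 2 := by positivity
  have := h2.ne'
  have := h3.ne'
  have := h4.ne'
  have := hN.ne'
  have := Real.pi_ne_zero
  simp only [Nat.cast_ofNat, Nat.add_one_sub_one, pow_one]
  field_simp
  ring

namespace LoewnerSetup

variable {Ω : Set ℂ} {φ : ℂ → ℂ} {ξ : ℝ → ℝ} {R : ℝ} (S : LoewnerSetup Ω φ ξ R)

include S

lemma isOpen_evolvedDomain {t : ℝ} (ht : 0 ≤ t) : IsOpen (evolvedDomain Ω φ ξ t) :=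
  S.differentiableOn.continuousOn.isOpen_inter_preimage S.isOpen
    (isOpen_loewnerDomain S.continuousOn ht)

lemma differentiableOn_evolvedMap {t : ℝ} (ht : 0 ≤ t) :
    DifferentiableOn ℂ (evolvedMap φ ξ t) (evolvedDomain Ω φ ξ t) := by
  intro x hx
  exact (((hasDerivAt_loewnerMap S.continuousOn ht hx.2).differentiableAt.comp x
    (S.differentiableOn.differentiableAt (S.isOpen.mem_nhds hx.1))).sub_const
      (ξ t : ℂ)).differentiableWithinAt

lemma bijOn_evolvedMap {t : ℝ} (ht : 0 ≤ t) :
    BijOn (evolvedMap φ ξ t) (evolvedDomain Ω φ ξ t) upperHalf := by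
  refine ⟨fun x hx => ?_, fun x hx y hy h => ?_, fun y hy => ?_⟩
  · change 0 < (evolvedMap φ ξ t x).im
    rw [evolvedMap_im]
    exact loewnerMap_im_pos S.continuousOn ht hx.2
  · exact S.bijOn.injOn hx.1 hy.1 (injOn_loewnerMap S.continuousOn ht hx.2 hy.2 (sub_left_injective h))
  · have hy' : y + ξ t ∈ upperHalf := by
      change 0 < (y + ξ t).im
      rw [Complex.add_im, Complex.ofReal_im, add_zero]; exact hy
    obtain ⟨z, hz, hzy⟩ := surjOn_loewnerMap S.continuousOn ht hy'
    obtain ⟨x, hx, rfl⟩ := S.bijOn.surjOn hz.1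
    exact ⟨x, ⟨hx, hz⟩, by rw [evolvedMap, hzy, add_sub_cancel_right]⟩

lemma greenKernel {t : ℝ} (ht : 0 ≤ t) :
    GreenKernel (evolvedDomain Ω φ ξ t) R (evolvedGreen Ω φ ξ t) :=
  greenKernel_conformalGreen (S.isOpen_evolvedDomain ht) (S.differentiableOn_evolvedMap ht)
    (S.bijOn_evolvedMap ht) S.pos fun z hz _ hx => S.subset_ball z hz.1 hx.1

lemma evolvedMap_ne_zero {t : ℝ} (ht : 0 ≤ t) {x : ℂ} (hx : x ∈ evolvedDomain Ω φ ξ t) :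
    evolvedMap φ ξ t x ≠ 0 := loewnerMap_sub_ne_zero S.continuousOn ht hx.2

lemma height_pos {t : ℝ} (ht : 0 ≤ t) {x : ℂ} (hx : x ∈ evolvedDomain Ω φ ξ t) :
    0 < height Ω φ ξ t x := by
  rw [height_of_mem hx]; exact loewnerMap_im_pos S.continuousOn ht hx.2

lemma height_nonneg {t : ℝ} (ht : 0 ≤ t) (x : ℂ) : 0 ≤ height Ω φ ξ t x := by
  by_cases hx : x ∈ evolvedDomain Ω φ ξ t
  · exact (S.height_pos ht hx).le
  · rw [height_of_notMem hx]

lemma height_anti {a b : ℝ} (ha : 0 ≤ a) (hab : a ≤ b) (x : ℂ) :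
    height Ω φ ξ b x ≤ height Ω φ ξ a x := by
  by_cases hx : x ∈ evolvedDomain Ω φ ξ b
  · rw [height_of_mem hx, height_of_mem (evolvedDomain_anti hab hx)]
    exact loewnerMap_im_anti S.continuousOn ha hab hx.2
  · rw [height_of_notMem hx]
    exact S.height_nonneg ha x

/-- Because the height is extended by zero, the rate bound also covers points swallowed between a
and b: the lifetime estimate forces V_a² ≤ 4(b - a) for them. -/
lemma sq_height_le {a b : ℝ} (ha : 0 ≤ a) (hab : a ≤ b) (x : ℂ) :
    height Ω φ ξ a x ^ 2 ≤ height Ω φ ξ b x ^ 2 + 4 * (b - a) := by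
  by_cases hx : x ∈ evolvedDomain Ω φ ξ b
  · rw [height_of_mem hx, height_of_mem (evolvedDomain_anti hab hx)]
    exact sq_im_loewnerMap_le S.continuousOn ha hab hx.2
  · rw [height_of_notMem hx]
    by_cases hxa : x ∈ evolvedDomain Ω φ ξ a
    · rw [height_of_mem hxa]
      by_contra h
      exact hx ⟨hxa.1, mem_loewnerDomain_of_lt_sq_im S.continuousOn ha hab hxa.2 (by linarith)⟩
    · rw [height_of_notMem hxa]
      linarith

omit S in
lemma poisson_eq {t : ℝ} {x : ℂ} (hx : x ∈ evolvedDomain Ω φ ξ t) :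
    poisson (evolvedMap φ ξ t) x =
      height Ω φ ξ t x / (Real.pi * Complex.normSq (evolvedMap φ ξ t x)) := by
  rw [poisson, height_of_mem hx, ← evolvedMap_im, one_div (evolvedMap φ ξ t x), Complex.inv_im]
  field_simp

lemma poisson_nonneg {t : ℝ} (ht : 0 ≤ t) {x : ℂ} (hx : x ∈ evolvedDomain Ω φ ξ t) :
    0 ≤ poisson (evolvedMap φ ξ t) x := by
  rw [poisson_eq hx]
  exact div_nonneg (S.height_nonneg ht x) (mul_nonneg Real.pi_pos.le (Complex.normSq_nonneg _))

omit S in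
lemma sq_height_le_normSq {t : ℝ} {x : ℂ} (hx : x ∈ evolvedDomain Ω φ ξ t) :
    height Ω φ ξ t x ^ 2 ≤ Complex.normSq (evolvedMap φ ξ t x) := by
  rw [height_of_mem hx, ← evolvedMap_im, Complex.normSq_apply]
  nlinarith [mul_self_nonneg (evolvedMap φ ξ t x).re]

lemma poisson_le {t : ℝ} (ht : 0 ≤ t) {x : ℂ} (hx : x ∈ evolvedDomain Ω φ ξ t) :
    poisson (evolvedMap φ ξ t) x ≤ (Real.pi * height Ω φ ξ t x)⁻¹ := by
  have hv := S.height_pos ht hx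
  have hn := sq_height_le_normSq hx
  have hn0 : 0 < Complex.normSq (evolvedMap φ ξ t x) := lt_of_lt_of_le (by positivity) hn
  rw [poisson_eq hx, ← one_div, div_le_div_iff₀ (by positivity) (by positivity)]
  nlinarith [mul_le_mul_of_nonneg_left hn Real.pi_pos.le]

lemma hasDerivWithinAt_loewnerMap_comp {T : ℝ} {x : ℂ} (hx : x ∈ evolvedDomain Ω φ ξ T) {t : ℝ}
    (ht : t ∈ Icc 0 T) : HasDerivWithinAt (fun s => loewnerMap ξ s (φ x))
      (2 / evolvedMap φ ξ t x) (Icc 0 T) t :=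
  (isLoewnerTrajectory_loewnerMap S.continuousOn (ht.1.trans ht.2) hx.2).deriv t ht

omit S in
lemma height_eqOn {T : ℝ} {x : ℂ} (hx : x ∈ evolvedDomain Ω φ ξ T) :
    EqOn (fun s => height Ω φ ξ s x) (fun s => (loewnerMap ξ s (φ x)).im) (Icc 0 T) :=
  fun _ hs => height_of_mem (evolvedDomain_anti hs.2 hx)

lemma hasDerivWithinAt_height {T : ℝ} {x : ℂ} (hx : x ∈ evolvedDomain Ω φ ξ T) {t : ℝ}
    (ht : t ∈ Icc 0 T) : HasDerivWithinAt (fun s => height Ω φ ξ s x)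
      (-2 * Real.pi * poisson (evolvedMap φ ξ t) x) (Icc 0 T) t := by
  have h := (isLoewnerTrajectory_loewnerMap S.continuousOn (ht.1.trans ht.2)
    hx.2).hasDerivWithinAt_im ht
  refine (h.congr (height_eqOn hx) (height_eqOn hx ht)).congr_deriv ?_
  rw [poisson_eq (evolvedDomain_anti ht.2 hx), height_of_mem (evolvedDomain_anti ht.2 hx), evolvedMap]
  field_simp

/-- The driving function cancels in φ_t(x) - φ_t(y), so its mere continuity suffices. -/
lemma hasDerivWithinAt_evolvedGreen {T : ℝ} {x y : ℂ} (hx : x ∈ evolvedDomain Ω φ ξ T)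
    (hy : y ∈ evolvedDomain Ω φ ξ T) (hxy : x ≠ y) {t : ℝ} (ht : t ∈ Icc 0 T) :
    HasDerivWithinAt (fun s => evolvedGreen Ω φ ξ s x y)
      (-2 * Real.pi * (poisson (evolvedMap φ ξ t) x * poisson (evolvedMap φ ξ t) y)) (Icc 0 T) t := by
  have hX := S.hasDerivWithinAt_loewnerMap_comp hx ht
  have hY := S.hasDerivWithinAt_loewnerMap_comp hy ht
  have hxt := evolvedDomain_anti ht.2 hx
  have hyt := evolvedDomain_anti ht.2 hy
  have hvx := S.height_pos ht.1 hxt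
  have hvy := S.height_pos ht.1 hyt
  have hne : evolvedMap φ ξ t x - evolvedMap φ ξ t y ≠ 0 := fun h =>
    hxy ((S.bijOn_evolvedMap ht.1).injOn hxt hyt (sub_eq_zero.1 h))
  have hN0 := Complex.normSq_pos.2 hne
  have nf : ∀ x, Complex.normSq (evolvedMap φ ξ t x) = ((loewnerMap ξ t (φ x)).re - ξ t) ^ 2 +
      (loewnerMap ξ t (φ x)).im ^ 2 := fun x => by
    rw [Complex.normSq_apply]; simp [evolvedMap, pow_two]
  have hre : ∀ x, (2 / evolvedMap φ ξ t x).re = 2 * ((loewnerMap ξ t (φ x)).re - ξ t) /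
      (((loewnerMap ξ t (φ x)).re - ξ t) ^ 2 + (loewnerMap ξ t (φ x)).im ^ 2) := fun x => by
    rw [Complex.div_re, nf]; simp [evolvedMap]
  have him : ∀ x, (2 / evolvedMap φ ξ t x).im = -2 * (loewnerMap ξ t (φ x)).im /
      (((loewnerMap ξ t (φ x)).re - ξ t) ^ 2 + (loewnerMap ξ t (φ x)).im ^ 2) := fun x => by
    rw [Complex.div_im, nf]; simp [evolvedMap, neg_div]
  rw [height_of_mem hxt] at hvx
  rw [height_of_mem hyt] at hvy
  have hN0' : 0 < ((loewnerMap ξ t (φ x)).re - (loewnerMap ξ t (φ y)).re) ^ 2 +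
      ((loewnerMap ξ t (φ x)).im - (loewnerMap ξ t (φ y)).im) ^ 2 := by
    rw [Complex.normSq_apply] at hN0
    simp only [evolvedMap, sub_sub_sub_cancel_right, Complex.sub_re, Complex.sub_im] at hN0
    nlinarith
  have heq : EqOn (fun s => evolvedGreen Ω φ ξ s x y) (fun s => (4 * Real.pi)⁻¹ *
      Real.log (1 + 4 * (loewnerMap ξ s (φ x)).im * (loewnerMap ξ s (φ y)).im /
      (((loewnerMap ξ s (φ x)).re - (loewnerMap ξ s (φ y)).re) ^ 2 +
      ((loewnerMap ξ s (φ x)).im - (loewnerMap ξ s (φ y)).im) ^ 2))) (Icc 0 T) := by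
    intro s hs
    simp only [evolvedGreen]
    rw [conformalGreen_of_mem (evolvedDomain_anti hs.2 hx) (evolvedDomain_anti hs.2 hy),
      halfPlaneGreen, evolvedMap_im, evolvedMap_im, Complex.normSq_apply]
    simp only [evolvedMap, sub_sub_sub_cancel_right, Complex.sub_re, Complex.sub_im, pow_two]
  rw [poisson_eq hxt, poisson_eq hyt, height_of_mem hxt, height_of_mem hyt, nf, nf]
  refine HasDerivWithinAt.congr ?_ heq (heq ht)
  refine hasDerivWithinAt_log_one_add (A := fun s => (loewnerMap ξ s (φ x)).re)
    (B := fun s => (loewnerMap ξ s (φ x)).im) (C := fun s => (loewnerMap ξ s (φ y)).re)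
    (D := fun s => (loewnerMap ξ s (φ y)).im) ?_ ?_ ?_ ?_ hvx hvy hN0'
  · rw [← hre]; exact Complex.reCLM.hasFDerivAt.comp_hasDerivWithinAt t hX
  · rw [← him]; exact Complex.imCLM.hasFDerivAt.comp_hasDerivWithinAt t hX
  · rw [← hre]; exact Complex.reCLM.hasFDerivAt.comp_hasDerivWithinAt t hY
  · rw [← him]; exact Complex.imCLM.hasFDerivAt.comp_hasDerivWithinAt t hY

end LoewnerSetup

end

end MassiveHadamard

/-! ### Boundary decay and time decrements of the massless Green function. -/

namespace MassiveHadamard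

noncomputable section

open Set Filter MeasureTheory Metric InnerProductSpace

namespace LoewnerSetup

variable {Ω : Set ℂ} {φ : ℂ → ℂ} {ξ : ℝ → ℝ} {R : ℝ} (S : LoewnerSetup Ω φ ξ R)

include S

lemma logKernel_nonneg_of_mem {x y : ℂ} (hx : x ∈ Ω) (hy : y ∈ Ω) : 0 ≤ logKernel R (x - y) := by
  refine logKernel_nonneg ?_
  have := S.subset_ball y hy hx
  rw [mem_ball, dist_eq_norm] at this
  exact this.le

lemma evolvedGreen_nonneg {t : ℝ} (ht : 0 ≤ t) (x y : ℂ) : 0 ≤ evolvedGreen Ω φ ξ t x y := by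
  rw [evolvedGreen, conformalGreen]
  split_ifs with h
  · exact halfPlaneGreen_nonneg ((S.bijOn_evolvedMap ht).mapsTo h.1)
      ((S.bijOn_evolvedMap ht).mapsTo h.2)
  · exact le_rfl

/-- Boundary decay of the Green function in one of the variables. -/
lemma evolvedGreen_le {t : ℝ} (ht : 0 ≤ t) {x y : ℂ} (hx : x ∈ evolvedDomain Ω φ ξ t)
    (hy : y ∈ evolvedDomain Ω φ ξ t) : evolvedGreen Ω φ ξ t x y ≤
      2 * (1 + logKernel R (x - y)) * height Ω φ ξ t x / height Ω φ ξ t y := by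
  have hvx := S.height_pos ht hx
  have hvy := S.height_pos ht hy
  have hl := S.logKernel_nonneg_of_mem hx.1 hy.1
  rw [le_div_iff₀ hvy]
  -- If the images are closer than V(y)/2, the heights are comparable and the logarithmic bound
  -- suffices. Otherwise V(x)V(y)/(π|X - Y|²) is at most (4/π)V(x)/V(y).
  by_cases hd : ‖evolvedMap φ ξ t x - evolvedMap φ ξ t y‖ < height Ω φ ξ t y / 2
  · have h1 : height Ω φ ξ t y ≤ 2 * height Ω φ ξ t x := by
      have := (neg_le_abs _).trans ((Complex.abs_im_le_norm _).trans hd.le)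
      rw [Complex.sub_im, evolvedMap_im, evolvedMap_im, ← height_of_mem hx, ← height_of_mem hy] at this
      linarith
    have h2 := (S.greenKernel ht).le_logKernel hx hy
    have h3 := S.evolvedGreen_nonneg ht x y
    nlinarith [mul_nonneg hl hvx.le]
  · push Not at hd
    have h1 : evolvedGreen Ω φ ξ t x y ≤ height Ω φ ξ t x * height Ω φ ξ t y /
        (Real.pi * Complex.normSq (evolvedMap φ ξ t x - evolvedMap φ ξ t y)) := by
      have h := halfPlaneGreen_le ((S.bijOn_evolvedMap ht).mapsTo hx)
        ((S.bijOn_evolvedMap ht).mapsTo hy)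
      rw [evolvedMap_im, evolvedMap_im, ← height_of_mem hx, ← height_of_mem hy] at h
      rwa [evolvedGreen, conformalGreen_of_mem hx hy]
    rw [← Complex.sq_norm] at h1
    have h2 : height Ω φ ξ t x * height Ω φ ξ t y /
        (Real.pi * ‖evolvedMap φ ξ t x - evolvedMap φ ξ t y‖ ^ 2) ≤
        height Ω φ ξ t x * height Ω φ ξ t y / (Real.pi * (height Ω φ ξ t y / 2) ^ 2) := by
      gcongr
    calc evolvedGreen Ω φ ξ t x y * height Ω φ ξ t y
        ≤ height Ω φ ξ t x * height Ω φ ξ t y / (Real.pi * (height Ω φ ξ t y / 2) ^ 2) *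
          height Ω φ ξ t y := by gcongr; exact h1.trans h2
      _ = 4 / Real.pi * height Ω φ ξ t x := by field_simp; norm_num
      _ ≤ 2 * height Ω φ ξ t x := by
        gcongr
        rw [div_le_iff₀ Real.pi_pos]
        linarith [Real.two_le_pi]
      _ ≤ _ := by gcongr; nlinarith

lemma evolvedGreen_anti {a b : ℝ} (ha : 0 ≤ a) (hab : a ≤ b) (x y : ℂ) :
    evolvedGreen Ω φ ξ b x y ≤ evolvedGreen Ω φ ξ a x y := by
  by_cases hx : x ∈ evolvedDomain Ω φ ξ b
  swap
  · rw [evolvedGreen, conformalGreen_of_notMem hx]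
    exact S.evolvedGreen_nonneg ha x y
  by_cases hy : y ∈ evolvedDomain Ω φ ξ b
  swap
  · rw [evolvedGreen, conformalGreen_symm, conformalGreen_of_notMem hy]
    exact S.evolvedGreen_nonneg ha x y
  rcases eq_or_ne x y with rfl | hxy
  · rw [(S.greenKernel ha).diag, (S.greenKernel (ha.trans hab)).diag]
  have hm : AntitoneOn (fun s => evolvedGreen Ω φ ξ s x y) (Icc 0 b) := by
    refine antitoneOn_of_hasDerivWithinAt_nonpos (convex_Icc 0 b)
      (fun s hs => (S.hasDerivWithinAt_evolvedGreen hx hy hxy hs).continuousWithinAt)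
      (fun s hs => (S.hasDerivWithinAt_evolvedGreen hx hy hxy (interior_subset hs)).mono
        interior_subset) fun s hs => ?_
    have hs' := interior_subset hs
    have h1 := S.poisson_nonneg hs'.1 (evolvedDomain_anti hs'.2 hx)
    have h2 := S.poisson_nonneg hs'.1 (evolvedDomain_anti hs'.2 hy)
    nlinarith [mul_nonneg Real.pi_pos.le (mul_nonneg h1 h2)]
  exact hm ⟨ha, hab⟩ ⟨ha.trans hab, le_rfl⟩ hab

/-- The decrement of the Green function is controlled by the decrement of the height. -/
lemma evolvedGreen_sub_le_of_mem {a b : ℝ} (ha : 0 ≤ a) (hab : a ≤ b) {x y : ℂ}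
    (hx : x ∈ evolvedDomain Ω φ ξ b) (hy : y ∈ evolvedDomain Ω φ ξ b) :
    evolvedGreen Ω φ ξ a x y - evolvedGreen Ω φ ξ b x y ≤
      (height Ω φ ξ a x - height Ω φ ξ b x) / height Ω φ ξ b y := by
  have hb := ha.trans hab
  have hvy := S.height_pos hb hy
  rcases eq_or_ne x y with rfl | hxy
  · rw [(S.greenKernel ha).diag, (S.greenKernel (ha.trans hab)).diag, sub_zero]
    exact div_nonneg (sub_nonneg.2 (S.height_anti ha hab x)) hvy.le
  -- The Green function decreases at rate 2πP(x)P(y) and the height of x at rate 2πP(x), while P(y)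
  -- ≤ 1/(πV_s(y)) ≤ 1/V_b(y); so the difference below is nondecreasing.
  have hd : ∀ s ∈ Icc 0 b, HasDerivWithinAt
      (fun s => evolvedGreen Ω φ ξ s x y - height Ω φ ξ s x / height Ω φ ξ b y)
      (-2 * Real.pi * (poisson (evolvedMap φ ξ s) x * poisson (evolvedMap φ ξ s) y) -
        -2 * Real.pi * poisson (evolvedMap φ ξ s) x / height Ω φ ξ b y) (Icc 0 b) s := fun s hs =>
    (S.hasDerivWithinAt_evolvedGreen hx hy hxy hs).sub ((S.hasDerivWithinAt_height hx hs).div_const _)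
  have hm : MonotoneOn (fun s => evolvedGreen Ω φ ξ s x y - height Ω φ ξ s x / height Ω φ ξ b y)
      (Icc 0 b) := by
    refine monotoneOn_of_hasDerivWithinAt_nonneg (convex_Icc 0 b)
      (fun s hs => (hd s hs).continuousWithinAt)
      (fun s hs => (hd s (interior_subset hs)).mono interior_subset) fun s hs => ?_
    have hs' := interior_subset hs
    have hys := evolvedDomain_anti hs'.2 hy
    have h1 := S.poisson_nonneg hs'.1 (evolvedDomain_anti hs'.2 hx)
    have h2 : poisson (evolvedMap φ ξ s) y ≤ (height Ω φ ξ b y)⁻¹ := by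
      refine (S.poisson_le hs'.1 hys).trans (inv_anti₀ hvy ?_)
      have := S.height_anti hs'.1 hs'.2 y
      have h3 := S.height_nonneg hs'.1 y
      nlinarith [Real.two_le_pi]
    rw [sub_nonneg, div_eq_mul_inv]
    have := mul_le_mul_of_nonneg_left h2 (mul_nonneg (mul_nonneg two_pos.le Real.pi_pos.le) h1)
    linarith
  have := hm ⟨ha, hab⟩ ⟨hb, le_rfl⟩ hab
  simp only at this
  rw [sub_div]
  linarith

/-- For x swallowed before b both subtracted terms vanish and the estimate becomes the boundary
decay at time a; for surviving x it is the monotonicity argument. -/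
lemma evolvedGreen_sub_le {a b : ℝ} (ha : 0 ≤ a) (hab : a ≤ b) {x y : ℂ}
    (hx : x ∈ evolvedDomain Ω φ ξ a) (hy : y ∈ evolvedDomain Ω φ ξ b) :
    evolvedGreen Ω φ ξ a x y - evolvedGreen Ω φ ξ b x y ≤
      2 * (1 + logKernel R (x - y)) * (height Ω φ ξ a x - height Ω φ ξ b x) / height Ω φ ξ b y := by
  have hb := ha.trans hab
  have hvy := S.height_pos hb hy
  have hl := S.logKernel_nonneg_of_mem hx.1 hy.1
  have hm := sub_nonneg.2 (S.height_anti ha hab x)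
  by_cases hxb : x ∈ evolvedDomain Ω φ ξ b
  · refine (S.evolvedGreen_sub_le_of_mem ha hab hxb hy).trans ?_
    gcongr
    nlinarith
  · rw [height_of_notMem hxb, sub_zero, evolvedGreen, evolvedGreen, conformalGreen_of_notMem hxb,
      sub_zero]
    refine (S.evolvedGreen_le ha hx (evolvedDomain_anti hab hy)).trans ?_
    have := S.height_anti ha hab y
    have := S.height_nonneg ha x
    gcongr

end LoewnerSetup

end

end MassiveHadamard

/-! ### The conformal radius along the flow. -/

namespace MassiveHadamard

noncomputable section

open Set Filter MeasureTheory Metric InnerProductSpace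

lemma measurable_of_continuousOn_of_eq_zero {X : Type*} [TopologicalSpace X] [MeasurableSpace X]
    [OpensMeasurableSpace X] {f : X → ℝ} {s : Set X} (hs : MeasurableSet s)
    (hf : ContinuousOn f s) (h0 : ∀ x, x ∉ s → f x = 0) : Measurable f := by
  classical
  have h := hf.measurable_piecewise (continuousOn_const (c := (0 : ℝ))) hs
  convert h using 1
  ext x
  by_cases hx : x ∈ s
  · rw [piecewise_eq_of_mem _ _ _ hx]
  · rw [piecewise_eq_of_notMem _ _ _ hx, h0 x hx]

/-- The square of half the conformal radius of `Ω_t` seen from `x`, extended by zero. -/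
def sqRadius (Ω : Set ℂ) (φ : ℂ → ℂ) (ξ : ℝ → ℝ) (t : ℝ) (x : ℂ) : ℝ :=
  height Ω φ ξ t x ^ 2 / Complex.normSq (deriv (evolvedMap φ ξ t) x)

lemma sqRadius_of_notMem {Ω : Set ℂ} {φ : ℂ → ℂ} {ξ : ℝ → ℝ} {t : ℝ} {x : ℂ}
    (hx : x ∉ evolvedDomain Ω φ ξ t) : sqRadius Ω φ ξ t x = 0 := by
  rw [sqRadius, height_of_notMem hx]; simp

lemma sqRadius_nonneg (Ω : Set ℂ) (φ : ℂ → ℂ) (ξ : ℝ → ℝ) (t : ℝ) (x : ℂ) :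
    0 ≤ sqRadius Ω φ ξ t x := div_nonneg (sq_nonneg _) (Complex.normSq_nonneg _)

namespace LoewnerSetup

variable {Ω : Set ℂ} {φ : ℂ → ℂ} {ξ : ℝ → ℝ} {R : ℝ} (S : LoewnerSetup Ω φ ξ R)

include S

lemma continuousOn_height {t : ℝ} (ht : 0 ≤ t) :
    ContinuousOn (height Ω φ ξ t) (evolvedDomain Ω φ ξ t) :=
  (Complex.continuous_im.comp_continuousOn (S.differentiableOn_evolvedMap ht).continuousOn).congr
    fun x hx => by rw [height_of_mem hx, ← evolvedMap_im]; rfl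

lemma measurable_height {t : ℝ} (ht : 0 ≤ t) : Measurable (height Ω φ ξ t) :=
  measurable_of_continuousOn_of_eq_zero (S.isOpen_evolvedDomain ht).measurableSet
    (S.continuousOn_height ht) fun _ hx => height_of_notMem hx

lemma deriv_evolvedMap_ne_zero {t : ℝ} (ht : 0 ≤ t) {x : ℂ} (hx : x ∈ evolvedDomain Ω φ ξ t) :
    deriv (evolvedMap φ ξ t) x ≠ 0 :=
  deriv_ne_zero_of_injOn (S.isOpen_evolvedDomain ht) (S.differentiableOn_evolvedMap ht)
    (S.bijOn_evolvedMap ht).injOn hx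

lemma hasDerivAt_evolvedMap {t : ℝ} (ht : 0 ≤ t) {x : ℂ} (hx : x ∈ evolvedDomain Ω φ ξ t) :
    HasDerivAt (evolvedMap φ ξ t) (deriv (evolvedMap φ ξ t) x) x :=
  ((S.differentiableOn_evolvedMap ht).differentiableAt
    ((S.isOpen_evolvedDomain ht).mem_nhds hx)).hasDerivAt

lemma measurable_sqRadius {t : ℝ} (ht : 0 ≤ t) : Measurable (sqRadius Ω φ ξ t) := by
  refine measurable_of_continuousOn_of_eq_zero (S.isOpen_evolvedDomain ht).measurableSet ?_
    fun _ hx => sqRadius_of_notMem hx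
  refine ((S.continuousOn_height ht).pow 2).div (Complex.continuous_normSq.comp_continuousOn
    ((S.differentiableOn_evolvedMap ht).deriv (S.isOpen_evolvedDomain ht)).continuousOn) fun x hx => ?_
  exact (Complex.normSq_pos.2 (S.deriv_evolvedMap_ne_zero ht hx)).ne'

lemma deriv_evolvedMap {t : ℝ} (ht : 0 ≤ t) {x : ℂ} (hx : x ∈ evolvedDomain Ω φ ξ t) :
    deriv (evolvedMap φ ξ t) x =
      Complex.exp (∫ s in 0..t, -2 / evolvedMap φ ξ s x ^ 2) * deriv φ x :=
  (((hasDerivAt_loewnerMap S.continuousOn ht hx.2).comp x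
    (S.differentiableOn.differentiableAt (S.isOpen.mem_nhds hx.1)).hasDerivAt).sub_const
      (ξ t : ℂ)).deriv

lemma sqRadius_eq {t : ℝ} (ht : 0 ≤ t) {x : ℂ} (hx : x ∈ evolvedDomain Ω φ ξ t) :
    sqRadius Ω φ ξ t x = height Ω φ ξ t x ^ 2 *
      Real.exp (-2 * (∫ s in 0..t, -2 / evolvedMap φ ξ s x ^ 2).re) / Complex.normSq (deriv φ x) := by
  rw [sqRadius, S.deriv_evolvedMap ht hx, Complex.normSq_mul, ← Complex.sq_norm (Complex.exp _),
    Complex.norm_exp, ← Real.exp_nat_mul, neg_mul, Real.exp_neg]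
  push_cast
  field_simp

/-- The exponential formula for φ_t' makes the logarithmic derivative explicit: -4/|φ_t|² from the
height and +4(|φ_t|² - 2V²)/|φ_t|⁴ from 1/|φ_t'|², leaving -8V²/|φ_t|⁴. -/
lemma hasDerivWithinAt_sqRadius {T : ℝ} {x : ℂ} (hx : x ∈ evolvedDomain Ω φ ξ T) {t : ℝ}
    (ht : t ∈ Icc 0 T) : HasDerivWithinAt (fun s => sqRadius Ω φ ξ s x)
      (-8 * sqRadius Ω φ ξ t x * (height Ω φ ξ t x ^ 2 / Complex.normSq (evolvedMap φ ξ t x) ^ 2))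
      (Icc 0 T) t := by
  have hT := ht.1.trans ht.2
  have hne : ∀ s ∈ Icc 0 T, evolvedMap φ ξ s x ≠ 0 := fun s hs =>
    S.evolvedMap_ne_zero hs.1 (evolvedDomain_anti hs.2 hx)
  have hk : ContinuousOn (fun s => -2 / evolvedMap φ ξ s x ^ 2) (Icc 0 T) := by
    refine continuousOn_const.div (ContinuousOn.pow ?_ 2) fun s hs => pow_ne_zero 2 (hne s hs)
    exact (isLoewnerTrajectory_loewnerMap S.continuousOn hT hx.2).continuousOn.sub
      (continuousOn_ofReal_driving S.continuousOn)
  have hJ : HasDerivWithinAt (fun s => (∫ r in 0..s, -2 / evolvedMap φ ξ r x ^ 2).re)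
      (-2 / evolvedMap φ ξ t x ^ 2).re (Icc 0 T) t :=
    Complex.reCLM.hasFDerivAt.comp_hasDerivWithinAt t (hasDerivWithinAt_integral hk ht)
  have hV := (S.hasDerivWithinAt_height hx ht).pow 2
  have heq : EqOn (fun s => sqRadius Ω φ ξ s x) (fun s => height Ω φ ξ s x ^ 2 *
      Real.exp (-2 * (∫ r in 0..s, -2 / evolvedMap φ ξ r x ^ 2).re) / Complex.normSq (deriv φ x))
      (Icc 0 T) := fun s hs => S.sqRadius_eq hs.1 (evolvedDomain_anti hs.2 hx)
  refine (((hV.mul (hJ.const_mul (-2)).exp).div_const _).congr heq (heq ht)).congr_deriv ?_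
  rw [S.sqRadius_eq ht.1 (evolvedDomain_anti ht.2 hx), poisson_eq (evolvedDomain_anti ht.2 hx)]
  have hn0 : Complex.normSq (evolvedMap φ ξ t x) ≠ 0 :=
    (Complex.normSq_pos.2 (hne t ht)).ne'
  have hre : (-2 / evolvedMap φ ξ t x ^ 2).re = -2 * (Complex.normSq (evolvedMap φ ξ t x) -
      2 * height Ω φ ξ t x ^ 2) / Complex.normSq (evolvedMap φ ξ t x) ^ 2 := by
    rw [Complex.div_re, height_of_mem (evolvedDomain_anti ht.2 hx), ← evolvedMap_im, map_pow,
      pow_two (evolvedMap φ ξ t x), Complex.mul_re]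
    simp only [Complex.neg_re, Complex.re_ofNat, Complex.neg_im, Complex.im_ofNat, neg_zero,
      zero_mul, zero_div, add_zero]
    congr 2
    rw [Complex.normSq_apply]
    ring
  rw [hre]
  simp only [Nat.cast_ofNat, Nat.add_one_sub_one, pow_one, Pi.pow_apply]
  have := Real.pi_ne_zero
  generalize Real.exp _ = e
  generalize Complex.normSq (evolvedMap φ ξ t x) = n at *
  generalize height Ω φ ξ t x = v at *
  rw [← sub_eq_zero]
  field_simp
  ring

lemma sqRadius_anti {a b : ℝ} (ha : 0 ≤ a) (hab : a ≤ b) (x : ℂ) :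
    sqRadius Ω φ ξ b x ≤ sqRadius Ω φ ξ a x := by
  by_cases hx : x ∈ evolvedDomain Ω φ ξ b
  · have hm : AntitoneOn (fun s => sqRadius Ω φ ξ s x) (Icc 0 b) := by
      refine antitoneOn_of_hasDerivWithinAt_nonpos (convex_Icc 0 b)
        (fun s hs => (S.hasDerivWithinAt_sqRadius hx hs).continuousWithinAt)
        (fun s hs => (S.hasDerivWithinAt_sqRadius hx (interior_subset hs)).mono
          interior_subset) fun s hs => ?_
      have h1 := sqRadius_nonneg Ω φ ξ s x
      have h2 : 0 ≤ height Ω φ ξ s x ^ 2 / Complex.normSq (evolvedMap φ ξ s x) ^ 2 := by positivity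
      nlinarith [mul_nonneg h1 h2]
    exact hm ⟨ha, hab⟩ ⟨ha.trans hab, le_rfl⟩ hab
  · rw [sqRadius_of_notMem hx]
    exact sqRadius_nonneg Ω φ ξ a x

/-- Cauchy's estimate for the inverse map on the disc of radius V/2 about φ_t(x), where it stays
within R of x, gives V/|φ_t'(x)| ≤ 2R. -/
lemma sqRadius_le {t : ℝ} (ht : 0 ≤ t) (x : ℂ) : sqRadius Ω φ ξ t x ≤ 4 * R ^ 2 := by
  by_cases hx : x ∈ evolvedDomain Ω φ ξ t
  swap
  · rw [sqRadius_of_notMem hx]; positivity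
  have hv := S.height_pos ht hx
  set f := evolvedMap φ ξ t
  set D := evolvedDomain Ω φ ξ t
  set V := height Ω φ ξ t x with hV
  have hD := S.isOpen_evolvedDomain ht
  have hf := S.differentiableOn_evolvedMap ht
  have hb := S.bijOn_evolvedMap ht
  have hVim : V = (f x).im := by rw [hV, height_of_mem hx, evolvedMap_im]
  have hsub : closedBall (f x) (V / 2) ⊆ upperHalf := fun y hy => by
    rw [mem_closedBall, dist_eq_norm] at hy
    have := (neg_le_abs _).trans ((Complex.abs_im_le_norm _).trans hy)
    rw [Complex.sub_im, ← hVim] at this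
    change 0 < y.im
    linarith
  have hd : DifferentiableOn ℂ (fun y => Function.invFunOn f D y - x) upperHalf := fun y hy => by
    obtain ⟨z, hz, rfl⟩ := hb.surjOn hy
    exact ((hasDerivAt_invFunOn hD hf hb.injOn hz).differentiableAt.sub_const x).differentiableWithinAt
  have hcl : DiffContOnCl ℂ (fun y => Function.invFunOn f D y - x) (ball (f x) (V / 2)) := by
    refine DifferentiableOn.diffContOnCl (hd.mono ?_)
    exact closure_ball_subset_closedBall.trans hsub
  have h := Complex.norm_deriv_le_of_forall_mem_sphere_norm_le (half_pos hv) hcl (C := R)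
    fun y hy => by
      have := S.subset_ball x hx.1
        (Function.invFunOn_mem (hb.surjOn (hsub (sphere_subset_closedBall hy)))).1
      rw [mem_ball, dist_eq_norm] at this
      exact this.le
  rw [((hasDerivAt_invFunOn hD hf hb.injOn hx).sub_const x).deriv, norm_inv] at h
  have hn : 0 < ‖deriv f x‖ := norm_pos_iff.2 (S.deriv_evolvedMap_ne_zero ht hx)
  rw [inv_le_iff_one_le_mul₀ hn, div_div_eq_mul_div, div_mul_eq_mul_div, le_div_iff₀ hv, one_mul] at h
  change V ^ 2 / Complex.normSq (deriv f x) ≤ 4 * R ^ 2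
  rw [← Complex.sq_norm, div_le_iff₀ (by positivity)]
  nlinarith

end LoewnerSetup

end

end MassiveHadamard

/-! ### Heights of points about to be swallowed. -/

namespace MassiveHadamard

noncomputable section

open Set Filter MeasureTheory Metric InnerProductSpace

lemma det_restrictScalars_toSpanSingleton (c : ℂ) :
    |((ContinuousLinearMap.toSpanSingleton ℂ c).restrictScalars ℝ : ℂ →L[ℝ] ℂ).det| =
      Complex.normSq c := by
  have : ((ContinuousLinearMap.toSpanSingleton ℂ c).restrictScalars ℝ : ℂ →L[ℝ] ℂ).det =
      Complex.normSq c := by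
    simp [ContinuousLinearMap.det, LinearMap.det_restrictScalars, Algebra.norm_complex_apply]
  rw [this, abs_of_nonneg (Complex.normSq_nonneg c)]

/-- The area of a set on which an injective holomorphic map has large derivative. -/
lemma mul_volume_le_volume_image {f : ℂ → ℂ} {A : Set ℂ} (hA : MeasurableSet A)
    (hf : ∀ x ∈ A, HasDerivAt f (deriv f x) x) (hi : InjOn f A) {c : ℝ}
    (hc : ∀ x ∈ A, c ≤ Complex.normSq (deriv f x)) :
    ENNReal.ofReal c * volume A ≤ volume (f '' A) := by
  rw [← lintegral_abs_det_fderiv_eq_addHaar_image volume hA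
    (fun x hx => ((hf x hx).hasFDerivAt.restrictScalars ℝ).hasFDerivWithinAt) hi]
  refine le_trans (setLIntegral_const A _).ge (setLIntegral_mono' hA fun x hx => ?_)
  rw [det_restrictScalars_toSpanSingleton]
  exact ENNReal.ofReal_le_ofReal (hc x hx)

/-- Space-time points at which the height is not small while the distance to the driving point is
comparable to it. -/
def slowSet (Ω : Set ℂ) (φ : ℂ → ℂ) (ξ : ℝ → ℝ) (a b e κ d : ℝ) : Set (ℝ × ℂ) :=
  {p | (p.1 ∈ Icc a b ∧ p.2 ∈ evolvedDomain Ω φ ξ b) ∧ sqRadius Ω φ ξ a p.2 ≤ 2 * d ∧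
    e ≤ (evolvedMap φ ξ p.1 p.2).im ^ 2 ∧ Complex.normSq (evolvedMap φ ξ p.1 p.2) ≤ κ}

namespace LoewnerSetup

variable {Ω : Set ℂ} {φ : ℂ → ℂ} {ξ : ℝ → ℝ} {R : ℝ} (S : LoewnerSetup Ω φ ξ R)

include S

lemma continuousOn_evolvedMap_uncurry {a b : ℝ} (ha : 0 ≤ a) :
    ContinuousOn (fun p : ℝ × ℂ => evolvedMap φ ξ p.1 p.2)
      (Icc a b ×ˢ evolvedDomain Ω φ ξ b) := by
  intro p hp
  have hp1 : 0 ≤ p.1 := ha.trans hp.1.1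
  have h1 := (eventually_mem_and_continuousWithinAt S.continuousOn hp1
    (evolvedDomain_anti hp.1.2 hp.2).2).2
  have h2 : ContinuousWithinAt (fun p : ℝ × ℂ => (p.1, φ p.2)) (Icc a b ×ˢ evolvedDomain Ω φ ξ b) p :=
    continuousWithinAt_fst.prodMk ((S.differentiableOn.continuousOn p.2 hp.2.1).comp
      continuousWithinAt_snd fun q hq => hq.2.1)
  have h3 : ContinuousWithinAt (fun p : ℝ × ℂ => loewnerMap ξ p.1 (φ p.2))
      (Icc a b ×ˢ evolvedDomain Ω φ ξ b) p :=
    ContinuousWithinAt.comp (f := fun p : ℝ × ℂ => (p.1, φ p.2))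
      (g := fun p : ℝ × ℂ => loewnerMap ξ p.1 p.2) h1 h2 fun q hq => ⟨ha.trans hq.1.1, mem_univ _⟩
  refine h3.sub (Complex.continuous_ofReal.continuousAt.comp_continuousWithinAt ?_)
  exact (S.continuousOn p.1 hp1).comp continuousWithinAt_fst fun q hq => ha.trans hq.1.1

lemma measurableSet_slowSet {a b : ℝ} (ha : 0 ≤ a) (hab : a ≤ b) (e κ d : ℝ) :
    MeasurableSet (slowSet Ω φ ξ a b e κ d) := by
  have hD : MeasurableSet (Icc a b ×ˢ evolvedDomain Ω φ ξ b) :=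
    measurableSet_Icc.prod (S.isOpen_evolvedDomain (ha.trans hab)).measurableSet
  have hC : IsClosed {y : ℂ | e ≤ y.im ^ 2 ∧ Complex.normSq y ≤ κ} :=
    (isClosed_le continuous_const (Complex.continuous_im.pow 2)).inter
      (isClosed_le Complex.continuous_normSq continuous_const)
  obtain ⟨u, hu, hue⟩ := continuousOn_iff_isClosed.1
    (S.continuousOn_evolvedMap_uncurry (b := b) ha) _ hC
  have hq : MeasurableSet {p : ℝ × ℂ | sqRadius Ω φ ξ a p.2 ≤ 2 * d} :=
    measurableSet_le ((S.measurable_sqRadius ha).comp measurable_snd) measurable_const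
  have : slowSet Ω φ ξ a b e κ d = (u ∩ Icc a b ×ˢ evolvedDomain Ω φ ξ b) ∩
      {p : ℝ × ℂ | sqRadius Ω φ ξ a p.2 ≤ 2 * d} := by
    rw [← hue]
    ext p
    simp only [slowSet, mem_ofPred_eq, mem_inter_iff, mem_preimage, mem_prod]
    tauto
  rw [this]
  exact (hu.measurableSet.inter hD).inter hq

/-- The radius being nonincreasing, at time r a height of squared size at least e and a squared
radius at most 2d force |φ_r'|² ≥ e/(2d). The image lies in a disc of area πκ, so the slice has area
at most πκ · 2d/e. -/
lemma volume_slowSet_slice_le {a b : ℝ} (ha : 0 ≤ a) (hab : a ≤ b) {e κ d : ℝ} (he : 0 < e)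
    (hκ : 0 ≤ κ) (hd : 0 < d) (r : ℝ) :
    volume {x | (r, x) ∈ slowSet Ω φ ξ a b e κ d} ≤ ENNReal.ofReal (2 * Real.pi * κ * d / e) := by
  by_cases hr : r ∈ Icc a b
  swap
  · have : {x | (r, x) ∈ slowSet Ω φ ξ a b e κ d} = ∅ :=
      eq_empty_of_forall_notMem fun x hx => hr hx.1.1
    rw [this, measure_empty]; exact zero_le
  have hr0 := ha.trans hr.1
  set A := {x | (r, x) ∈ slowSet Ω φ ξ a b e κ d} with hA
  have hAm : MeasurableSet A := measurable_prodMk_left (S.measurableSet_slowSet ha hab e κ d)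
  have hAD : A ⊆ evolvedDomain Ω φ ξ r := fun x hx => evolvedDomain_anti hr.2 hx.1.2
  have h1 := mul_volume_le_volume_image hAm (fun x hx => S.hasDerivAt_evolvedMap hr0 (hAD hx))
    ((S.bijOn_evolvedMap hr0).injOn.mono hAD) (c := e / (2 * d)) fun x hx => by
      have hq := (S.sqRadius_anti ha hr.1 x).trans hx.2.1
      have hn := Complex.normSq_pos.2 (S.deriv_evolvedMap_ne_zero hr0 (hAD hx))
      rw [sqRadius, div_le_iff₀ hn, height_of_mem (hAD hx), ← evolvedMap_im] at hq
      rw [div_le_iff₀ (by positivity)]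
      linarith [hx.2.2.1]
  have h2 : volume (evolvedMap φ ξ r '' A) ≤ ENNReal.ofReal (κ * Real.pi) := by
    refine (measure_mono (t := closedBall 0 (√κ)) ?_).trans ?_
    · rintro _ ⟨x, hx, rfl⟩
      rw [mem_closedBall_zero_iff]
      refine Real.le_sqrt_of_sq_le ?_
      rw [Complex.sq_norm]
      exact hx.2.2.2
    · rw [Complex.volume_closedBall, ← ENNReal.ofReal_pow (Real.sqrt_nonneg _), Real.sq_sqrt hκ,
        ENNReal.ofReal_mul hκ]
      refine mul_le_mul_right (le_of_eq ?_) _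
      rw [← NNReal.coe_real_pi, ENNReal.ofReal_coe_nnreal]
  have h3 : ENNReal.ofReal (2 * d / e) * (ENNReal.ofReal (e / (2 * d)) * volume A) = volume A := by
    rw [← mul_assoc, ← ENNReal.ofReal_mul (by positivity), div_mul_div_cancel₀ he.ne',
      div_self (by positivity), ENNReal.ofReal_one, one_mul]
  calc volume A = _ := h3.symm
    _ ≤ ENNReal.ofReal (2 * d / e) * ENNReal.ofReal (κ * Real.pi) :=
      mul_le_mul_right (h1.trans h2) _
    _ = _ := by
      rw [← ENNReal.ofReal_mul (by positivity)]
      congr 1; ring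

/-- The time spent in the slow set, integrated over space. -/
lemma integral_slowSet_le {a b : ℝ} (ha : 0 ≤ a) (hab : a ≤ b) {e κ d : ℝ} (he : 0 < e)
    (hκ : 0 ≤ κ) (hd : 0 < d) :
    Integrable (fun x => volume.real {r | (r, x) ∈ slowSet Ω φ ξ a b e κ d}) ∧
    ∫ x, volume.real {r | (r, x) ∈ slowSet Ω φ ξ a b e κ d} ≤
      (b - a) * (2 * Real.pi * κ * d / e) := by
  have hA := S.measurableSet_slowSet ha hab e κ d
  set A := slowSet Ω φ ξ a b e κ d
  have hm : Measurable fun x => volume {r | (r, x) ∈ A} := measurable_measure_prodMk_right hA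
  have e1 : ∫⁻ x, volume {r | (r, x) ∈ A} = ∫⁻ r, volume {x | (r, x) ∈ A} :=
    (Measure.prod_apply_symm (μ := volume) (ν := volume) hA).symm.trans (Measure.prod_apply hA)
  have e2 : ∫⁻ r, volume {x | (r, x) ∈ A} ≤
      ENNReal.ofReal ((b - a) * (2 * Real.pi * κ * d / e)) := by
    calc ∫⁻ r, volume {x | (r, x) ∈ A}
        ≤ ∫⁻ r, (Icc a b).indicator (fun _ => ENNReal.ofReal (2 * Real.pi * κ * d / e)) r := by
          refine lintegral_mono fun r => ?_
          by_cases hr : r ∈ Icc a b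
          · rw [indicator_of_mem hr]
            exact S.volume_slowSet_slice_le ha hab he hκ hd r
          · have : {x | (r, x) ∈ A} = ∅ := eq_empty_of_forall_notMem fun x hx => hr hx.1.1
            rw [this, measure_empty]; exact zero_le
      _ = _ := by
          rw [lintegral_indicator measurableSet_Icc, setLIntegral_const, Real.volume_Icc, mul_comm,
            ← ENNReal.ofReal_mul (sub_nonneg.2 hab)]
  have hfin : ∫⁻ x, volume {r | (r, x) ∈ A} ≠ ⊤ := by
    rw [e1]; exact ne_top_of_le_ne_top ENNReal.ofReal_ne_top e2
  refine ⟨integrable_toReal_of_lintegral_ne_top hm.aemeasurable hfin, ?_⟩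
  have e3 : ∫ x, volume.real {r | (r, x) ∈ A} = (∫⁻ x, volume {r | (r, x) ∈ A}).toReal :=
    integral_toReal hm.aemeasurable (ae_lt_top hm hfin)
  rw [e3, e1]
  refine ENNReal.toReal_le_of_le_ofReal ?_ e2
  have := sub_nonneg.2 hab
  positivity

lemma continuousOn_height_time {T : ℝ} {x : ℂ} (hx : x ∈ evolvedDomain Ω φ ξ T) :
    ContinuousOn (fun s => height Ω φ ξ s x) (Icc 0 T) := fun _ hs =>
  (S.hasDerivWithinAt_height hx hs).continuousWithinAt

lemma hasDerivWithinAt_sq_height {T : ℝ} {x : ℂ} (hx : x ∈ evolvedDomain Ω φ ξ T) {t : ℝ}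
    (ht : t ∈ Icc 0 T) : HasDerivWithinAt (fun s => height Ω φ ξ s x ^ 2)
      (-4 * (height Ω φ ξ t x ^ 2 / Complex.normSq (evolvedMap φ ξ t x))) (Icc 0 T) t := by
  have h := (S.hasDerivWithinAt_height hx ht).pow 2
  refine HasDerivWithinAt.congr_deriv (f := fun s => height Ω φ ξ s x ^ 2) h ?_
  rw [poisson_eq (evolvedDomain_anti ht.2 hx)]
  simp only [Nat.cast_ofNat, Nat.add_one_sub_one, pow_one]
  have := Real.pi_ne_zero
  field_simp
  ring

/-- Height of points about to be swallowed whose conformal radius is small. -/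
lemma sq_height_le_of_sqRadius_le {a b t ε M d : ℝ} (ha : 0 ≤ a) (hab : a ≤ b) (hbt : b ≤ t)
    (hε : 4 * (t - b) ≤ ε * (t - a)) (hM : 0 < M) (hat : a < t) {x : ℂ}
    (hx : x ∈ evolvedDomain Ω φ ξ b) (hxt : x ∉ evolvedDomain Ω φ ξ t)
    (hq : sqRadius Ω φ ξ a x ≤ 2 * d) :
    height Ω φ ξ a x ^ 2 ≤ (ε + 16 / M) * (t - a) +
      4 * volume.real {r | (r, x) ∈ slowSet Ω φ ξ a b (ε * (t - a)) (M * (t - a)) d} := by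
  have hτ : 0 < t - a := sub_pos.2 hat
  set Z := {r | (r, x) ∈ slowSet Ω φ ξ a b (ε * (t - a)) (M * (t - a)) d} with hZ
  have hZm : MeasurableSet Z := measurable_prodMk_right (S.measurableSet_slowSet ha hab _ _ d)
  have hZfin : volume Z ≠ ⊤ := by
    refine ne_top_of_le_ne_top ?_ (measure_mono (t := Icc a b) fun r hr => hr.1.1)
    exact isCompact_Icc.measure_lt_top.ne
  have hM' : 0 < 16 / M := by positivity
  have hZ0 : 0 ≤ volume.real Z := measureReal_nonneg
  rcases le_total (height Ω φ ξ a x ^ 2) (ε * (t - a)) with h | h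
  · nlinarith
  have hend : ∀ r ∈ Icc a b, height Ω φ ξ r x ^ 2 ≤ 4 * (t - r) := fun r hr => by
    have := S.sq_height_le (ha.trans hr.1) (hr.2.trans hbt) x
    rwa [height_of_notMem hxt, zero_pow two_ne_zero, zero_add] at this
  have hcont : ContinuousOn (fun s => height Ω φ ξ s x ^ 2) (Icc a b) :=
    ((S.continuousOn_height_time hx).mono (Icc_subset_Icc_left ha)).pow 2
  -- The time at which V² has come down to ε(t - a), found before b because V_b² ≤ 4(t - b) ≤ ε(t -
  -- a). Up to β the height condition of the slow set holds automatically.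
  obtain ⟨β, hβ, hβe⟩ := intermediate_value_Icc' hab hcont
    (⟨(hend b ⟨hab, le_rfl⟩).trans hε, h⟩ : ε * (t - a) ∈ Icc _ _)
  simp only at hβe
  have hsub : Icc a β ⊆ Icc 0 b := Icc_subset_Icc ha hβ.2
  have hne : ∀ r ∈ Icc a β, 0 < Complex.normSq (evolvedMap φ ξ r x) := fun r hr =>
    Complex.normSq_pos.2 (S.evolvedMap_ne_zero (hsub hr).1 (evolvedDomain_anti (hsub hr).2 hx))
  have hsc : ContinuousOn (fun r => height Ω φ ξ r x ^ 2 / Complex.normSq (evolvedMap φ ξ r x))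
      (Icc a β) := by
    refine (hcont.mono (Icc_subset_Icc_right hβ.2)).div ?_ fun r hr => (hne r hr).ne'
    refine Complex.continuous_normSq.comp_continuousOn (ContinuousOn.mono ?_ hsub)
    exact (isLoewnerTrajectory_loewnerMap S.continuousOn (ha.trans hab) hx.2).continuousOn.sub
      (continuousOn_ofReal_driving S.continuousOn)
  have hI : IntervalIntegrable (fun r => -4 * (height Ω φ ξ r x ^ 2 /
      Complex.normSq (evolvedMap φ ξ r x))) volume a β :=
    ContinuousOn.intervalIntegrable_of_Icc hβ.1 (continuousOn_const.mul hsc)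
  have hftc := intervalIntegral.integral_eq_sub_of_hasDerivAt_of_le hβ.1
    (hcont.mono (Icc_subset_Icc_right hβ.2)) (fun r hr =>
      (S.hasDerivWithinAt_sq_height hx (hsub (Ioo_subset_Icc_self hr))).hasDerivAt
        (Icc_mem_nhds (ha.trans_lt hr.1) (hr.2.trans_le hβ.2))) hI
  have hJ : IntervalIntegrable (fun r => 16 / M + Z.indicator (fun _ => (4 : ℝ)) r) volume a β := by
    refine intervalIntegrable_const.add ?_
    exact ((integrable_indicator_iff hZm).2 (integrableOn_const hZfin)).intervalIntegrable
  -- While |φ_r|² ≤ M(t - a) the point is in the slow set and V² falls at rate at most 4. Otherwise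
  -- V_r² ≤ 4(t - a) bounds the rate by 16/M.
  have hmono : ∫ r in a..β, 4 * (height Ω φ ξ r x ^ 2 / Complex.normSq (evolvedMap φ ξ r x)) ≤
      ∫ r in a..β, (16 / M + Z.indicator (fun _ => (4 : ℝ)) r) := by
    refine intervalIntegral.integral_mono_on hβ.1
      (ContinuousOn.intervalIntegrable_of_Icc hβ.1 (continuousOn_const.mul hsc)) hJ fun r hr => ?_
    have hrb : r ∈ Icc a b := ⟨hr.1, hr.2.trans hβ.2⟩
    have hrD := evolvedDomain_anti hrb.2 hx
    by_cases hY : Complex.normSq (evolvedMap φ ξ r x) ≤ M * (t - a)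
    · have hrZ : r ∈ Z := by
        refine ⟨⟨hrb, hx⟩, hq, ?_, hY⟩
        simp only
        rw [evolvedMap_im, ← height_of_mem hrD, ← hβe]
        exact pow_le_pow_left₀ (S.height_nonneg ((hsub ⟨hr.1.trans hr.2, le_rfl⟩).1) x)
          (S.height_anti (hsub hr).1 hr.2 x) 2
      rw [indicator_of_mem hrZ]
      have : height Ω φ ξ r x ^ 2 / Complex.normSq (evolvedMap φ ξ r x) ≤ 1 :=
        div_le_one_of_le₀ (sq_height_le_normSq hrD) (Complex.normSq_nonneg _)
      linarith
    · push Not at hY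
      have h0 : 0 ≤ Z.indicator (fun _ => (4 : ℝ)) r := indicator_nonneg (fun _ _ => by norm_num) r
      have : height Ω φ ξ r x ^ 2 / Complex.normSq (evolvedMap φ ξ r x) ≤ 4 / M := by
        rw [div_le_div_iff₀ (hne r hr) hM]
        have := hend r hrb
        nlinarith [hr.1]
      have e : 16 / M = 4 * (4 / M) := by ring
      linarith
  have hval : ∫ r in a..β, (16 / M + Z.indicator (fun _ => (4 : ℝ)) r) ≤
      16 / M * (t - a) + 4 * volume.real Z := by
    rw [intervalIntegral.integral_add intervalIntegrable_const
      ((integrable_indicator_iff hZm).2 (integrableOn_const hZfin)).intervalIntegrable,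
      intervalIntegral.integral_const, intervalIntegral.integral_of_le hβ.1,
      setIntegral_indicator hZm, setIntegral_const, smul_eq_mul, smul_eq_mul]
    have h1 : volume.real (Ioc a β ∩ Z) ≤ volume.real Z := measureReal_mono inter_subset_right hZfin
    have h2 : β - a ≤ t - a := sub_le_sub_right (hβ.2.trans hbt) a
    nlinarith
  rw [intervalIntegral.integral_const_mul] at hftc hmono
  rw [hβe] at hftc
  linarith

/-- Height of points about to be swallowed whose conformal radius stays large. -/
lemma sq_height_le_of_le_sqRadius {a b t ε M d : ℝ} (ha : 0 ≤ a) (hab : a ≤ b) (hbt : b ≤ t)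
    (hε : 4 * (t - b) ≤ ε * (t - a)) (hM : 0 < M) (hd : 0 < d) (hat : a < t) {x : ℂ}
    (hx : x ∈ evolvedDomain Ω φ ξ b) (hxt : x ∉ evolvedDomain Ω φ ξ t)
    (hq : d ≤ sqRadius Ω φ ξ b x) :
    height Ω φ ξ a x ^ 2 ≤ (ε + 16 / M) * (t - a) +
      M * (t - a) / (2 * d) * (sqRadius Ω φ ξ a x - sqRadius Ω φ ξ b x) := by
  have hτ : 0 < t - a := sub_pos.2 hat
  have hend : ∀ r ∈ Icc a b, height Ω φ ξ r x ^ 2 ≤ 4 * (t - r) := fun r hr => by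
    have := S.sq_height_le (ha.trans hr.1) (hr.2.trans hbt) x
    rwa [height_of_notMem hxt, zero_pow two_ne_zero, zero_add] at this
  have hderiv : ∀ r ∈ Icc a b, HasDerivWithinAt (fun r => height Ω φ ξ r x ^ 2 + 16 / M * r -
      M * (t - a) / (2 * d) * sqRadius Ω φ ξ r x)
      (-4 * (height Ω φ ξ r x ^ 2 / Complex.normSq (evolvedMap φ ξ r x)) + 16 / M * 1 -
        M * (t - a) / (2 * d) * (-8 * sqRadius Ω φ ξ r x *
          (height Ω φ ξ r x ^ 2 / Complex.normSq (evolvedMap φ ξ r x) ^ 2))) (Icc a b) r := by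
    intro r hr
    have hr' : r ∈ Icc 0 b := ⟨ha.trans hr.1, hr.2⟩
    exact ((((S.hasDerivWithinAt_sq_height hx hr').add
      ((hasDerivWithinAt_id r _).const_mul (16 / M))).sub
      ((S.hasDerivWithinAt_sqRadius hx hr').const_mul _)).mono (Icc_subset_Icc_left ha))
  have hm : MonotoneOn (fun r => height Ω φ ξ r x ^ 2 + 16 / M * r -
      M * (t - a) / (2 * d) * sqRadius Ω φ ξ r x) (Icc a b) := by
    refine monotoneOn_of_hasDerivWithinAt_nonneg (convex_Icc a b)
      (fun s hs => (hderiv s hs).continuousWithinAt)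
      (fun s hs => (hderiv s (interior_subset hs)).mono interior_subset) fun r hr => ?_
    have hr' := interior_subset hr
    have hrD := evolvedDomain_anti hr'.2 hx
    have hn := Complex.normSq_pos.2 (S.evolvedMap_ne_zero (ha.trans hr'.1) hrD)
    have hqr := hq.trans (S.sqRadius_anti (ha.trans hr'.1) hr'.2 x)
    have hv := hend r hr'
    generalize Complex.normSq (evolvedMap φ ξ r x) = n at *
    generalize sqRadius Ω φ ξ r x = q at *
    generalize height Ω φ ξ r x = v at *
    have hv0 := sq_nonneg v
    -- The loss of v² is paid for by the drop of the radius when n ≤ M(t - a), since q ≥ d makes the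
    -- coefficient M(t - a)/(2d) large enough, and by the linear term 16/M otherwise.
    have key : 4 * (v ^ 2 / n) ≤ 16 / M + M * (t - a) / (2 * d) * (8 * q * (v ^ 2 / n ^ 2)) := by
      by_cases hY : n ≤ M * (t - a)
      · have h1 : 4 * (v ^ 2 / n) ≤ M * (t - a) / (2 * d) * (8 * q * (v ^ 2 / n ^ 2)) := by
          have e : M * (t - a) / (2 * d) * (8 * q * (v ^ 2 / n ^ 2)) =
            4 * (v ^ 2 / n) * ((M * (t - a) / n) * (q / d)) := by field_simp; ring
          rw [e]
          refine le_mul_of_one_le_right (by positivity) ?_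
          exact one_le_mul_of_one_le_of_one_le ((one_le_div hn).2 hY) ((one_le_div hd).2 hqr)
        have : 0 < 16 / M := by positivity
        linarith
      · push Not at hY
        have h1 : v ^ 2 / n ≤ 4 / M := by
          rw [div_le_div_iff₀ hn hM]
          nlinarith [hr'.1]
        have e : 16 / M = 4 * (4 / M) := by ring
        have h2 : 0 ≤ M * (t - a) / (2 * d) * (8 * q * (v ^ 2 / n ^ 2)) := by
          have := hd.trans_le hqr
          positivity
        linarith
    linarith
  have h := hm ⟨le_rfl, hab⟩ ⟨hab, le_rfl⟩ hab
  simp only at h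
  have hb := hend b ⟨hab, le_rfl⟩
  have h2 : 16 / M * (b - a) ≤ 16 / M * (t - a) := by gcongr
  nlinarith

end LoewnerSetup

end

end MassiveHadamard

/-! ### The swallowed region contributes o(t - a). -/

namespace MassiveHadamard

noncomputable section

open Set Filter MeasureTheory Metric InnerProductSpace

namespace LoewnerSetup

variable {Ω : Set ℂ} {φ : ℂ → ℂ} {ξ : ℝ → ℝ} {R : ℝ} (S : LoewnerSetup Ω φ ξ R)

include S

lemma volume_lt_top : volume Ω < ⊤ := by
  rcases Ω.eq_empty_or_nonempty with rfl | ⟨z, hz⟩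
  · simp
  · exact (isBounded_ball.subset (S.subset_ball z hz)).measure_lt_top

lemma sq_height_le_sub {a t : ℝ} (ha : 0 ≤ a) (hat : a ≤ t) {x : ℂ}
    (hx : x ∉ evolvedDomain Ω φ ξ t) : height Ω φ ξ a x ^ 2 ≤ 4 * (t - a) := by
  have := S.sq_height_le ha hat x
  rwa [height_of_notMem hx, zero_pow two_ne_zero, zero_add] at this

/-- Combines the small-radius and persistently-large-radius estimates with two crude cases, both
resting on V_a² ≤ 4(t - a): a squared radius falling from above 2d to below d is paid for by the
coefficient 4/d, and a point swallowed before b by the indicators. -/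
lemma sq_height_le_of_notMem {a b t ε M d : ℝ} (ha : 0 ≤ a) (hab : a ≤ b) (hbt : b ≤ t)
    (hε0 : 0 ≤ ε) (hε : 4 * (t - b) ≤ ε * (t - a)) (hM : 0 < M) (hd : 0 < d) (hat : a < t) {x : ℂ}
    (hxt : x ∉ evolvedDomain Ω φ ξ t) :
    height Ω φ ξ a x ^ 2 ≤ (ε + 16 / M) * (t - a) +
      4 * volume.real {r | (r, x) ∈ slowSet Ω φ ξ a b (ε * (t - a)) (M * (t - a)) d} +
      (t - a) * ((M / (2 * d) + 4 / d) * (sqRadius Ω φ ξ a x - sqRadius Ω φ ξ b x) +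
        ((evolvedDomain Ω φ ξ a).indicator (fun _ => (4 : ℝ)) x -
          (evolvedDomain Ω φ ξ b).indicator (fun _ => (4 : ℝ)) x)) := by
  have hτ : 0 < t - a := sub_pos.2 hat
  have h1 : 0 ≤ (ε + 16 / M) * (t - a) := by positivity
  have h2 : 0 ≤ volume.real {r | (r, x) ∈ slowSet Ω φ ξ a b (ε * (t - a)) (M * (t - a)) d} :=
    measureReal_nonneg
  have h3 : 0 ≤ sqRadius Ω φ ξ a x - sqRadius Ω φ ξ b x := sub_nonneg.2 (S.sqRadius_anti ha hab x)
  have h4 : (evolvedDomain Ω φ ξ b).indicator (fun _ => (4 : ℝ)) x ≤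
      (evolvedDomain Ω φ ξ a).indicator (fun _ => (4 : ℝ)) x :=
    indicator_le_indicator_of_subset (evolvedDomain_anti hab) (fun _ => by norm_num) x
  have hV := S.sq_height_le_sub ha hat.le hxt
  have h5 : 0 ≤ (t - a) * (M / (2 * d) * (sqRadius Ω φ ξ a x - sqRadius Ω φ ξ b x)) := by positivity
  have h6 : 0 ≤ (t - a) * (4 / d * (sqRadius Ω φ ξ a x - sqRadius Ω φ ξ b x)) := by positivity
  have h7 := mul_nonneg hτ.le (sub_nonneg.2 h4)
  by_cases hxb : x ∈ evolvedDomain Ω φ ξ b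
  · rcases le_or_gt (sqRadius Ω φ ξ a x) (2 * d) with hqa | hqa
    · have := S.sq_height_le_of_sqRadius_le ha hab hbt hε hM hat hxb hxt hqa
      linarith
    rcases le_or_gt d (sqRadius Ω φ ξ b x) with hqb | hqb
    · have := S.sq_height_le_of_le_sqRadius ha hab hbt hε hM hd hat hxb hxt hqb
      have e : M * (t - a) / (2 * d) * (sqRadius Ω φ ξ a x - sqRadius Ω φ ξ b x) =
        (t - a) * (M / (2 * d) * (sqRadius Ω φ ξ a x - sqRadius Ω φ ξ b x)) := by ring
      linarith
    · have h8 : (1 : ℝ) ≤ (sqRadius Ω φ ξ a x - sqRadius Ω φ ξ b x) / d := by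
        rw [one_le_div hd]; linarith
      have e : (t - a) * (4 / d * (sqRadius Ω φ ξ a x - sqRadius Ω φ ξ b x)) =
        4 * (t - a) * ((sqRadius Ω φ ξ a x - sqRadius Ω φ ξ b x) / d) := by ring
      nlinarith
  · by_cases hxa : x ∈ evolvedDomain Ω φ ξ a
    · rw [indicator_of_mem hxa, indicator_of_notMem hxb] at *
      linarith
    · rw [height_of_notMem hxa]
      linarith

/-- A monotone quantity controlling the swallowed area. -/
def _root_.MassiveHadamard.swallowPotential (Ω : Set ℂ) (φ : ℂ → ℂ) (ξ : ℝ → ℝ) (t C r : ℝ) : ℝ :=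
  ∫ x in Ω \ evolvedDomain Ω φ ξ t, (C * sqRadius Ω φ ξ r x +
    (evolvedDomain Ω φ ξ r).indicator (fun _ => (4 : ℝ)) x)

lemma integrableOn_of_abs_le {f : ℂ → ℝ} (hf : Measurable f) {A : Set ℂ} (hA : A ⊆ Ω) (C : ℝ)
    (hC : ∀ x, |f x| ≤ C) : IntegrableOn f A := by
  have hfin : volume A ≠ ⊤ := ne_top_of_le_ne_top S.volume_lt_top.ne (measure_mono hA)
  exact Integrable.mono' (integrableOn_const hfin (C := C)) hf.aestronglyMeasurable
    (ae_of_all _ hC)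

lemma integrableOn_swallowPotential {C r : ℝ} (hr : 0 ≤ r) {A : Set ℂ} (hA : A ⊆ Ω) :
    IntegrableOn (fun x => C * sqRadius Ω φ ξ r x +
      (evolvedDomain Ω φ ξ r).indicator (fun _ => (4 : ℝ)) x) A := by
  refine IntegrableOn.add ?_ ?_
  · refine Integrable.const_mul (S.integrableOn_of_abs_le (S.measurable_sqRadius hr) hA (4 * R ^ 2)
      fun x => ?_) C
    rw [abs_of_nonneg (sqRadius_nonneg _ _ _ _ _)]
    exact S.sqRadius_le hr x
  · refine S.integrableOn_of_abs_le (measurable_const.indicator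
      (S.isOpen_evolvedDomain hr).measurableSet) hA 4 fun x => ?_
    by_cases hx : x ∈ evolvedDomain Ω φ ξ r
    · rw [indicator_of_mem hx]; norm_num
    · rw [indicator_of_notMem hx]; norm_num

lemma swallowPotential_anti {t C : ℝ} (hC : 0 ≤ C) {a b : ℝ} (ha : 0 ≤ a)
    (hab : a ≤ b) : swallowPotential Ω φ ξ t C b ≤ swallowPotential Ω φ ξ t C a := by
  refine integral_mono (S.integrableOn_swallowPotential (ha.trans hab) sdiff_subset)
    (S.integrableOn_swallowPotential ha sdiff_subset) fun x => ?_
  have h1 := S.sqRadius_anti ha hab x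
  exact add_le_add (mul_le_mul_of_nonneg_left h1 hC)
    (indicator_le_indicator_of_subset (evolvedDomain_anti hab) (fun _ => by norm_num) x)

omit S in
lemma swallowPotential_nonneg {t C : ℝ} (hC : 0 ≤ C) (r : ℝ) :
    0 ≤ swallowPotential Ω φ ξ t C r :=
  integral_nonneg fun x => add_nonneg (mul_nonneg hC (sqRadius_nonneg _ _ _ _ _))
    (indicator_nonneg (fun _ _ => by norm_num) x)

lemma integrableOn_sq_height {a t : ℝ} (ha : 0 ≤ a) (hat : a ≤ t) :
    IntegrableOn (fun x => height Ω φ ξ a x ^ 2) (Ω \ evolvedDomain Ω φ ξ t) := by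
  have hE : MeasurableSet (Ω \ evolvedDomain Ω φ ξ t) :=
    S.isOpen.measurableSet.diff (S.isOpen_evolvedDomain (ha.trans hat)).measurableSet
  have hfin : volume (Ω \ evolvedDomain Ω φ ξ t) ≠ ⊤ :=
    ne_top_of_le_ne_top S.volume_lt_top.ne (measure_mono sdiff_subset)
  refine Integrable.mono' (integrableOn_const hfin (C := 4 * (t - a)))
    ((S.measurable_height ha).pow_const 2).aestronglyMeasurable ?_
  refine (ae_restrict_iff' hE).2 (ae_of_all _ fun x hx => ?_)
  rw [Real.norm_of_nonneg (sq_nonneg _)]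
  exact S.sq_height_le_sub ha hat hx.2

/-- Integrating the pointwise bound: the slow-set term is controlled by the area estimate, and
everything not made small by ε, M and d is an increment of the monotone `swallowPotential`. -/
lemma integral_sq_height_le {a b t ε M d : ℝ} (ha : 0 ≤ a) (hab : a ≤ b) (hbt : b ≤ t)
    (hε0 : 0 < ε) (hε : 4 * (t - b) ≤ ε * (t - a)) (hM : 0 < M) (hd : 0 < d) (hat : a < t) :
    ∫ x in Ω \ evolvedDomain Ω φ ξ t, height Ω φ ξ a x ^ 2 ≤
      (t - a) * ((ε + 16 / M) * volume.real Ω + 8 * Real.pi * M * d / ε +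
        (swallowPotential Ω φ ξ t (M / (2 * d) + 4 / d) a -
          swallowPotential Ω φ ξ t (M / (2 * d) + 4 / d) b)) := by
  have hτ : 0 < t - a := sub_pos.2 hat
  have ht : 0 ≤ t := ha.trans hat.le
  set E := Ω \ evolvedDomain Ω φ ξ t with hE
  set C := M / (2 * d) + 4 / d
  have hEm : MeasurableSet E :=
    S.isOpen.measurableSet.diff (S.isOpen_evolvedDomain ht).measurableSet
  have hfin : volume E ≠ ⊤ := ne_top_of_le_ne_top S.volume_lt_top.ne (measure_mono sdiff_subset)
  obtain ⟨hα, hαle⟩ := S.integral_slowSet_le ha hab (e := ε * (t - a)) (κ := M * (t - a)) (d := d)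
    (by positivity) (by positivity) hd
  set α : ℂ → ℝ := fun x =>
    volume.real {r | (r, x) ∈ slowSet Ω φ ξ a b (ε * (t - a)) (M * (t - a)) d} with hαdef
  have hα0 : ∀ x, 0 ≤ α x := fun x => measureReal_nonneg
  have hαE : ∫ x in E, α x ≤ (t - a) * (2 * Real.pi * M * d / ε) := by
    refine (setIntegral_le_integral hα (ae_of_all _ hα0)).trans (hαle.trans ?_)
    have e : 2 * Real.pi * (M * (t - a)) * d / (ε * (t - a)) = 2 * Real.pi * M * d / ε := by
      field_simp
    rw [e]
    have : b - a ≤ t - a := by linarith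
    gcongr
  have hPa := S.integrableOn_swallowPotential (C := C) ha (A := E) sdiff_subset
  have hPb := S.integrableOn_swallowPotential (C := C) (ha.trans hab) (A := E) sdiff_subset
  have hc : IntegrableOn (fun _ : ℂ => (ε + 16 / M) * (t - a)) E := integrableOn_const hfin
  have hα4 : IntegrableOn (fun x => 4 * α x) E := (hα.const_mul 4).integrableOn
  have hcα : IntegrableOn (fun x => (ε + 16 / M) * (t - a) + 4 * α x) E := hc.add hα4
  have hPP : IntegrableOn (fun x => (t - a) * ((C * sqRadius Ω φ ξ a x +
      (evolvedDomain Ω φ ξ a).indicator (fun _ => (4 : ℝ)) x) - (C * sqRadius Ω φ ξ b x +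
      (evolvedDomain Ω φ ξ b).indicator (fun _ => (4 : ℝ)) x))) E := (hPa.sub hPb).const_mul _
  calc ∫ x in E, height Ω φ ξ a x ^ 2
      ≤ ∫ x in E, (((ε + 16 / M) * (t - a) + 4 * α x) + (t - a) * ((C * sqRadius Ω φ ξ a x +
      (evolvedDomain Ω φ ξ a).indicator (fun _ => (4 : ℝ)) x) - (C * sqRadius Ω φ ξ b x +
      (evolvedDomain Ω φ ξ b).indicator (fun _ => (4 : ℝ)) x))) := by
        refine setIntegral_mono_on (S.integrableOn_sq_height ha hat.le) (hcα.add hPP) hEm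
          fun x hx => ?_
        refine (S.sq_height_le_of_notMem ha hab hbt hε0.le hε hM hd hat hx.2).trans (le_of_eq ?_)
        simp only [hαdef, C]
        ring
    _ = (ε + 16 / M) * (t - a) * volume.real E + 4 * (∫ x in E, α x) + (t - a) *
        (swallowPotential Ω φ ξ t C a - swallowPotential Ω φ ξ t C b) := by
        rw [integral_add hcα hPP, integral_add hc hα4, setIntegral_const, smul_eq_mul,
          integral_const_mul, integral_const_mul, integral_sub hPa hPb, swallowPotential,
          swallowPotential]
        ring
    _ ≤ _ := by
        have h1 : volume.real E ≤ volume.real Ω := measureReal_mono sdiff_subset S.volume_lt_top.ne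
        have h2 : (ε + 16 / M) * (t - a) * volume.real E ≤ (ε + 16 / M) * (t - a) * volume.real Ω := by
          gcongr
        have e : (t - a) * (8 * Real.pi * M * d / ε) = 4 * ((t - a) * (2 * Real.pi * M * d / ε)) := by
          ring
        linarith

/-- The squared height of the region swallowed between times `a` and `t` is `o(t - a)` in mean. -/
lemma tendsto_integral_sq_height {t : ℝ} (ht : 0 < t) :
    Tendsto (fun a => (t - a)⁻¹ * ∫ x in Ω \ evolvedDomain Ω φ ξ t, height Ω φ ξ a x ^ 2)
      (𝓝[<] t) (𝓝 0) := by
  rw [Metric.tendsto_nhds]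
  intro η hη
  have hπ := Real.pi_pos
  set v := volume.real Ω with hv
  have hv0 : 0 ≤ v := measureReal_nonneg
  -- The parameters are fixed in the order ε, M, d so that three error terms are at most η/8, η/8
  -- and η/4; the potential contributes another η/4. The bound ε ≤ 4 ensures a ≤ b below.
  set ε := min 4 (η / (8 * (v + 1))) with hεdef
  have hε : 0 < ε := by positivity
  set M := 128 * (v + 1) / η with hMdef
  have hM : 0 < M := by positivity
  set d := η * ε / (32 * Real.pi * M) with hddef
  have hd : 0 < d := by positivity
  set C := M / (2 * d) + 4 / d with hC
  have hC0 : 0 ≤ C := by positivity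
  set Ψ := swallowPotential Ω φ ξ t C with hΨ
  have hbdd : BddBelow (Ψ '' Ico 0 t) := ⟨0, by
    rintro _ ⟨r, -, rfl⟩; exact swallowPotential_nonneg hC0 r⟩
  have hne : (Ψ '' Ico 0 t).Nonempty := ⟨_, 0, ⟨le_rfl, ht⟩, rfl⟩
  -- A monotone function bounded below has small increments near t, provided both times stay
  -- strictly before t; this is why b < t was introduced.
  obtain ⟨_, ⟨a₀, ha₀, rfl⟩, hlt⟩ := exists_lt_of_csInf_lt hne
    (lt_add_of_pos_right (sInf (Ψ '' Ico 0 t)) (by positivity : 0 < η / 4))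
  filter_upwards [Ioo_mem_nhdsLT ha₀.2] with a haa
  have ha : 0 ≤ a := ha₀.1.trans haa.1.le
  have hat := haa.2
  have hτ : 0 < t - a := sub_pos.2 hat
  set b := t - ε * (t - a) / 4 with hb
  have hε4 : ε ≤ 4 := min_le_left _ _
  have hab : a ≤ b := by
    have : ε * (t - a) ≤ 4 * (t - a) := by gcongr
    linarith
  have hbt : b < t := by
    have : 0 < ε * (t - a) / 4 := by positivity
    linarith
  have h := S.integral_sq_height_le ha hab hbt.le hε (by rw [hb]; linarith) hM hd hat
  have h1 : Ψ a - Ψ b < η / 4 := by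
    have e1 := S.swallowPotential_anti hC0 (t := t) ha₀.1 haa.1.le
    have e2 := csInf_le hbdd ⟨b, ⟨ha.trans hab, hbt⟩, rfl⟩
    linarith
  have h2 : ε * v ≤ η / 8 := by
    have : ε ≤ η / (8 * (v + 1)) := min_le_right _ _
    calc ε * v ≤ η / (8 * (v + 1)) * (v + 1) := by gcongr; linarith
      _ = η / 8 := by field_simp
  have h3 : 16 / M * v ≤ η / 8 := by
    calc 16 / M * v ≤ 16 / M * (v + 1) := by gcongr; linarith
      _ = η / 8 := by rw [hMdef]; field_simp; norm_num
  have h4 : 8 * Real.pi * M * d / ε = η / 4 := by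
    rw [hddef]; field_simp; norm_num
  have hnn : 0 ≤ ∫ x in Ω \ evolvedDomain Ω φ ξ t, height Ω φ ξ a x ^ 2 :=
    integral_nonneg fun x => sq_nonneg _
  rw [Real.dist_eq, sub_zero, abs_of_nonneg (by positivity), inv_mul_lt_iff₀ hτ, mul_comm]
  refine h.trans_lt ?_
  rw [mul_comm]
  refine mul_lt_mul_of_pos_right ?_ hτ
  rw [h4]
  nlinarith

/-- A weighted version of `tendsto_integral_sq_height`. -/
lemma tendsto_integral_sq_height_mul {t : ℝ} (ht : 0 < t) {W : ℂ → ℝ} (hW : IntegrableOn W Ω)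
    (hW0 : ∀ x ∈ Ω, 0 ≤ W x) :
    Tendsto (fun a => (t - a)⁻¹ * ∫ x in Ω \ evolvedDomain Ω φ ξ t, height Ω φ ξ a x ^ 2 * W x)
      (𝓝[<] t) (𝓝 0) := by
  set E := Ω \ evolvedDomain Ω φ ξ t with hE
  have hEm : MeasurableSet E :=
    S.isOpen.measurableSet.diff (S.isOpen_evolvedDomain ht.le).measurableSet
  have hWE : IntegrableOn W E := hW.mono_set sdiff_subset
  -- The weight is truncated at level k: the bounded part uses the unweighted limit, and the tail
  -- only needs V_a² ≤ 4(t - a).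
  have htr : Tendsto (fun k : ℕ => ∫ x in E, max (W x - k) 0) atTop (𝓝 0) := by
    have := tendsto_integral_of_dominated_convergence (μ := volume.restrict E)
      (F := fun (k : ℕ) x => max (W x - k) 0) (f := fun _ => (0 : ℝ)) (fun x => |W x|)
      (fun k => (hWE.aestronglyMeasurable.sub aestronglyMeasurable_const).sup
        aestronglyMeasurable_const) hWE.abs
      (fun k => ae_of_all _ fun x => by
        rw [Real.norm_of_nonneg (le_max_right _ _)]
        refine max_le ?_ (abs_nonneg _)
        have : (0 : ℝ) ≤ k := Nat.cast_nonneg k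
        linarith [le_abs_self (W x)])
      (ae_of_all _ fun x => by
        refine tendsto_const_nhds.congr' ?_
        obtain ⟨n, hn⟩ := exists_nat_ge (W x)
        filter_upwards [eventually_ge_atTop n] with k hk
        have : (n : ℝ) ≤ k := Nat.cast_le.2 hk
        rw [max_eq_right (by linarith)])
    simpa using this
  rw [Metric.tendsto_nhds]
  intro η hη
  obtain ⟨k, hk⟩ := (htr.eventually (gt_mem_nhds (by positivity : 0 < η / 8))).exists
  have h1 := (S.tendsto_integral_sq_height ht).const_mul (k : ℝ)
  rw [mul_zero] at h1
  filter_upwards [h1.eventually (gt_mem_nhds (half_pos hη)), Ioo_mem_nhdsLT ht] with a hka ha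
  have hτ : 0 < t - a := sub_pos.2 ha.2
  have hi1 := S.integrableOn_sq_height ha.1.le ha.2.le (t := t)
  have hi2 : IntegrableOn (fun x => max (W x - k) 0) E := by
    have hfin : volume E ≠ ⊤ := ne_top_of_le_ne_top S.volume_lt_top.ne (measure_mono sdiff_subset)
    have : IntegrableOn (fun _ => (k : ℝ)) E := integrableOn_const hfin
    exact (hWE.sub this).pos_part
  have hi3 : IntegrableOn (fun x => (k : ℝ) * height Ω φ ξ a x ^ 2 +
      4 * (t - a) * max (W x - k) 0) E := (hi1.const_mul _).add (hi2.const_mul _)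
  have hle : ∀ x ∈ E, height Ω φ ξ a x ^ 2 * W x ≤
      k * height Ω φ ξ a x ^ 2 + 4 * (t - a) * max (W x - k) 0 := fun x hx => by
    have e1 := S.sq_height_le_sub ha.1.le ha.2.le hx.2
    have e2 := le_max_left (W x - k) 0
    have e3 := le_max_right (W x - k) 0
    have e4 := sq_nonneg (height Ω φ ξ a x)
    nlinarith [mul_le_mul_of_nonneg_left e2 e4, mul_le_mul_of_nonneg_right e1 e3]
  have hnn : ∀ x ∈ E, 0 ≤ height Ω φ ξ a x ^ 2 * W x := fun x hx =>
    mul_nonneg (sq_nonneg _) (hW0 x hx.1)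
  have hi4 : IntegrableOn (fun x => height Ω φ ξ a x ^ 2 * W x) E := by
    refine Integrable.mono' hi3 ((((S.measurable_height ha.1.le).pow_const 2).aestronglyMeasurable).mul
      hWE.aestronglyMeasurable) ((ae_restrict_iff' hEm).2 (ae_of_all _ fun x hx => ?_))
    rw [Real.norm_of_nonneg (hnn x hx)]
    exact hle x hx
  have hint : ∫ x in E, height Ω φ ξ a x ^ 2 * W x ≤
      k * (∫ x in E, height Ω φ ξ a x ^ 2) + 4 * (t - a) * ∫ x in E, max (W x - k) 0 := by
    rw [← integral_const_mul, ← integral_const_mul,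
      ← integral_add (hi1.const_mul _) (hi2.const_mul _)]
    exact setIntegral_mono_on hi4 hi3 hEm hle
  have h0 : 0 ≤ ∫ x in E, height Ω φ ξ a x ^ 2 * W x := setIntegral_nonneg hEm hnn
  rw [Real.dist_eq, sub_zero, abs_of_nonneg (by positivity)]
  calc (t - a)⁻¹ * ∫ x in E, height Ω φ ξ a x ^ 2 * W x
      ≤ (t - a)⁻¹ * (k * (∫ x in E, height Ω φ ξ a x ^ 2) +
        4 * (t - a) * ∫ x in E, max (W x - k) 0) := by gcongr
    _ = k * ((t - a)⁻¹ * ∫ x in E, height Ω φ ξ a x ^ 2) + 4 * ∫ x in E, max (W x - k) 0 := by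
      field_simp
    _ < η := by linarith

end LoewnerSetup

end

end MassiveHadamard

/-! ### The decrement of the massive Green function. -/

namespace MassiveHadamard

noncomputable section

open Set Filter MeasureTheory Metric InnerProductSpace

/-- An integrable majorant of products of two logarithmic kernels. -/
def logWeight (R : ℝ) (y w x : ℂ) : ℝ := 4 + logKernel R (y - x) ^ 4 + logKernel R (w - x) ^ 4

/-- Fourth powers separate the two poles, so the integral of the weight is bounded uniformly in both
of them even when they coincide. -/
lemma mul_le_logWeight (R : ℝ) (y w x : ℂ) :
    (1 + logKernel R (y - x)) * (1 + logKernel R (w - x)) ≤ logWeight R y w x := by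
  rw [logWeight]
  generalize logKernel R (y - x) = α
  generalize logKernel R (w - x) = β
  nlinarith [sq_nonneg (α - β), sq_nonneg (α - 1), sq_nonneg (β - 1), sq_nonneg (α ^ 2 - 1),
    sq_nonneg (β ^ 2 - 1)]

lemma logWeight_nonneg (R : ℝ) (y w x : ℂ) : 0 ≤ logWeight R y w x := by
  rw [logWeight]; positivity

/-- The source term of the resolvent equation for the decrement of the massive Green function. -/
def greenSource (m : ℝ) (Ω : Set ℂ) (φ : ℂ → ℂ) (ξ : ℝ → ℝ) (a b : ℝ) (w y : ℂ) : ℝ :=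
  (evolvedGreen Ω φ ξ a w y - evolvedGreen Ω φ ξ b w y) -
    m ^ 2 * ∫ x in evolvedDomain Ω φ ξ a, (evolvedGreen Ω φ ξ a x y - evolvedGreen Ω φ ξ b x y) *
      massiveGreen m (evolvedDomain Ω φ ξ a) w x

namespace LoewnerSetup

variable {Ω : Set ℂ} {φ : ℂ → ℂ} {ξ : ℝ → ℝ} {R : ℝ} (S : LoewnerSetup Ω φ ξ R)

include S

lemma integrableOn_logWeight {y w : ℂ} (hy : y ∈ Ω) (hw : w ∈ Ω) :
    IntegrableOn (logWeight R y w) Ω := by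
  have hc : IntegrableOn (fun _ : ℂ => (4 : ℝ)) Ω := integrableOn_const S.volume_lt_top.ne
  exact (hc.add (integrableOn_logKernel_pow (S.subset_ball y hy))).add
    (integrableOn_logKernel_pow (S.subset_ball w hw))

lemma integral_logWeight_le {y w : ℂ} (hy : y ∈ Ω) (hw : w ∈ Ω) : ∫ x in Ω, logWeight R y w x ≤
    4 * volume.real Ω + 2 * ∫ y in ball 0 R, logKernel R y ^ 4 := by
  have hc : IntegrableOn (fun _ : ℂ => (4 : ℝ)) Ω := integrableOn_const S.volume_lt_top.ne
  have h1 := integrableOn_logKernel_pow (S.subset_ball y hy)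
  have h2 := integrableOn_logKernel_pow (S.subset_ball w hw)
  have h3 : IntegrableOn (fun x => 4 + logKernel R (y - x) ^ 4) Ω := hc.add h1
  have e : ∫ x in Ω, logWeight R y w x = 4 * volume.real Ω + (∫ x in Ω, logKernel R (y - x) ^ 4) +
      ∫ x in Ω, logKernel R (w - x) ^ 4 := by
    simp only [logWeight]
    rw [integral_add h3 h2, integral_add hc h1, setIntegral_const, smul_eq_mul, mul_comm]
  rw [e]
  linarith [integral_logKernel_pow_le (S.subset_ball y hy),
    integral_logKernel_pow_le (S.subset_ball w hw)]

lemma measurable_evolvedGreen {t : ℝ} (ht : 0 ≤ t) {y : ℂ} (hy : y ∈ evolvedDomain Ω φ ξ t) :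
    Measurable (evolvedGreen Ω φ ξ t y) := by
  have hD := S.isOpen_evolvedDomain ht
  refine measurable_of_continuousOn_of_eq_zero
    (hD.measurableSet.diff (measurableSet_singleton y)) ((S.greenKernel ht).green y hy).continuousOn
    fun x hx => ?_
  by_cases hxD : x ∈ evolvedDomain Ω φ ξ t
  · have : x = y := by
      by_contra h
      exact hx ⟨hxD, h⟩
    rw [this, (S.greenKernel ht).diag]
  · rw [(S.greenKernel ht).symm, evolvedGreen, conformalGreen_of_notMem hxD]

variable (m : ℝ)

lemma massiveGreen_nonneg {t : ℝ} (ht : 0 ≤ t) {w x : ℂ} (hw : w ∈ evolvedDomain Ω φ ξ t)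
    (hx : x ∈ evolvedDomain Ω φ ξ t) (hxw : x ≠ w) :
    0 ≤ massiveGreen m (evolvedDomain Ω φ ξ t) w x :=
  (S.greenKernel ht).massiveGreen_nonneg m hw hx hxw

lemma massiveGreen_le {t : ℝ} (ht : 0 ≤ t) {w x : ℂ} (hw : w ∈ evolvedDomain Ω φ ξ t)
    (hx : x ∈ evolvedDomain Ω φ ξ t) (hxw : x ≠ w) :
    massiveGreen m (evolvedDomain Ω φ ξ t) w x ≤
      2 * (1 + logKernel R (w - x)) * height Ω φ ξ t x / height Ω φ ξ t w := by
  refine ((S.greenKernel ht).massiveGreen_le m hw hx hxw).trans ?_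
  rw [(S.greenKernel ht).symm, logKernel_sub_comm]
  exact S.evolvedGreen_le ht hx hw

lemma sub_mul_massiveGreen_nonneg {a b : ℝ} (ha : 0 ≤ a) (hab : a ≤ b) {w x : ℂ} (y : ℂ)
    (hw : w ∈ evolvedDomain Ω φ ξ a) (hx : x ∈ evolvedDomain Ω φ ξ a) (hxw : x ≠ w) :
    0 ≤ (evolvedGreen Ω φ ξ a x y - evolvedGreen Ω φ ξ b x y) *
      massiveGreen m (evolvedDomain Ω φ ξ a) w x :=
  mul_nonneg (sub_nonneg.2 (S.evolvedGreen_anti ha hab x y)) (S.massiveGreen_nonneg m ha hw hx hxw)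

/-- One factor supplies V_a - V_b and the other V_a at the same point x, and (V_a - V_b)V_a ≤ V_a² -
V_b², which is at most 4(b - a) without any boundary singularity. -/
lemma sub_mul_massiveGreen_le {a b : ℝ} (ha : 0 ≤ a) (hab : a ≤ b) {w x y : ℂ}
    (hw : w ∈ evolvedDomain Ω φ ξ a) (hx : x ∈ evolvedDomain Ω φ ξ a) (hxw : x ≠ w)
    (hy : y ∈ evolvedDomain Ω φ ξ b) :
    (evolvedGreen Ω φ ξ a x y - evolvedGreen Ω φ ξ b x y) *
      massiveGreen m (evolvedDomain Ω φ ξ a) w x ≤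
      4 / (height Ω φ ξ b y * height Ω φ ξ a w) *
        ((height Ω φ ξ a x ^ 2 - height Ω φ ξ b x ^ 2) * logWeight R y w x) := by
  have hb := ha.trans hab
  have h1 := S.evolvedGreen_sub_le ha hab hx hy
  have h2 := S.massiveGreen_le m ha hw hx hxw
  have h0 := S.massiveGreen_nonneg m ha hw hx hxw
  have hvy := S.height_pos hb hy
  have hvw := S.height_pos ha hw
  have hvx := S.height_nonneg ha x
  have hvb := S.height_nonneg hb x
  have hm := S.height_anti ha hab x
  have hl1 := S.logKernel_nonneg_of_mem hy.1 hx.1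
  have hl2 := S.logKernel_nonneg_of_mem hw.1 hx.1
  rw [logKernel_sub_comm] at h1
  have hd : 0 ≤ height Ω φ ξ a x - height Ω φ ξ b x := sub_nonneg.2 hm
  have hprod : (height Ω φ ξ a x - height Ω φ ξ b x) * height Ω φ ξ a x ≤
      height Ω φ ξ a x ^ 2 - height Ω φ ξ b x ^ 2 := by nlinarith
  calc (evolvedGreen Ω φ ξ a x y - evolvedGreen Ω φ ξ b x y) *
      massiveGreen m (evolvedDomain Ω φ ξ a) w x
      ≤ (2 * (1 + logKernel R (y - x)) * (height Ω φ ξ a x - height Ω φ ξ b x) / height Ω φ ξ b y) *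
        (2 * (1 + logKernel R (w - x)) * height Ω φ ξ a x / height Ω φ ξ a w) :=
        mul_le_mul h1 h2 h0 (by positivity)
    _ = 4 / (height Ω φ ξ b y * height Ω φ ξ a w) *
        (((height Ω φ ξ a x - height Ω φ ξ b x) * height Ω φ ξ a x) *
          ((1 + logKernel R (y - x)) * (1 + logKernel R (w - x)))) := by field_simp; ring
    _ ≤ _ := by
        gcongr
        · exact (mul_nonneg hd hvx).trans hprod
        · exact mul_le_logWeight R y w x

lemma sub_mul_massiveGreen_le' {a b : ℝ} (ha : 0 ≤ a) (hab : a ≤ b) {w x y : ℂ}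
    (hw : w ∈ evolvedDomain Ω φ ξ a) (hx : x ∈ evolvedDomain Ω φ ξ a) (hxw : x ≠ w)
    (hy : y ∈ evolvedDomain Ω φ ξ b) :
    (evolvedGreen Ω φ ξ a x y - evolvedGreen Ω φ ξ b x y) *
      massiveGreen m (evolvedDomain Ω φ ξ a) w x ≤
      (b - a) * (16 / (height Ω φ ξ b y * height Ω φ ξ a w) * logWeight R y w x) := by
  refine (S.sub_mul_massiveGreen_le m ha hab hw hx hxw hy).trans ?_
  have h1 := S.sq_height_le ha hab x
  have h2 := logWeight_nonneg R y w x
  have hvy := S.height_pos (ha.trans hab) hy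
  have hvw := S.height_pos ha hw
  calc _ ≤ 4 / (height Ω φ ξ b y * height Ω φ ξ a w) * ((4 * (b - a)) * logWeight R y w x) := by
        gcongr; linarith
    _ = _ := by ring

lemma aestronglyMeasurable_sub_mul {a b : ℝ} (ha : 0 ≤ a) (hab : a ≤ b) {w y : ℂ}
    (hw : w ∈ evolvedDomain Ω φ ξ a) (hy : y ∈ evolvedDomain Ω φ ξ b) :
    AEStronglyMeasurable (fun x => (evolvedGreen Ω φ ξ a x y - evolvedGreen Ω φ ξ b x y) *
      massiveGreen m (evolvedDomain Ω φ ξ a) w x) (volume.restrict (evolvedDomain Ω φ ξ a)) := by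
  have h1 := (S.measurable_evolvedGreen ha (evolvedDomain_anti hab hy)).sub
    (S.measurable_evolvedGreen (ha.trans hab) hy)
  have h2 : Measurable fun x => evolvedGreen Ω φ ξ a x y - evolvedGreen Ω φ ξ b x y := by
    convert h1 using 1
    ext x
    rw [Pi.sub_apply, (S.greenKernel ha).symm, (S.greenKernel (ha.trans hab)).symm]
  exact h2.aestronglyMeasurable.mul ((S.greenKernel ha).memLp_massiveGreen m hw).aestronglyMeasurable

omit S in
lemma _root_.MassiveHadamard.evolvedDomain_subset (t : ℝ) : evolvedDomain Ω φ ξ t ⊆ Ω :=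
  fun _ hx => hx.1

lemma integrableOn_sub_mul {a b : ℝ} (ha : 0 ≤ a) (hab : a ≤ b) {w y : ℂ}
    (hw : w ∈ evolvedDomain Ω φ ξ a) (hy : y ∈ evolvedDomain Ω φ ξ b) :
    IntegrableOn (fun x => (evolvedGreen Ω φ ξ a x y - evolvedGreen Ω φ ξ b x y) *
      massiveGreen m (evolvedDomain Ω φ ξ a) w x) (evolvedDomain Ω φ ξ a) := by
  refine Integrable.mono' ((((S.integrableOn_logWeight hy.1 hw.1).mono_set
    (evolvedDomain_subset a)).const_mul (16 / (height Ω φ ξ b y * height Ω φ ξ a w))).const_mul (b - a))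
    (S.aestronglyMeasurable_sub_mul m ha hab hw hy) ?_
  filter_upwards [(S.greenKernel ha).ae_ne w] with x hx
  rw [Real.norm_of_nonneg (S.sub_mul_massiveGreen_nonneg m ha hab y hw hx.1 hx.2)]
  exact S.sub_mul_massiveGreen_le' m ha hab hw hx.1 hx.2 hy

/-- The source term is of the order of the time increment. -/
lemma abs_greenSource_le {a b : ℝ} (ha : 0 ≤ a) (hab : a ≤ b) {w y : ℂ}
    (hw : w ∈ evolvedDomain Ω φ ξ b) (hy : y ∈ evolvedDomain Ω φ ξ b) :
    |greenSource m Ω φ ξ a b w y| ≤ (b - a) * (4 + 16 * m ^ 2 *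
      (4 * volume.real Ω + 2 * ∫ y in ball 0 R, logKernel R y ^ 4)) /
        (height Ω φ ξ b y * height Ω φ ξ a w) := by
  set L := 4 * volume.real Ω + 2 * ∫ y in ball 0 R, logKernel R y ^ 4
  have hwa := evolvedDomain_anti hab hw
  have hvy := S.height_pos (ha.trans hab) hy
  have hvw := S.height_pos ha hwa
  have hba := sub_nonneg.2 hab
  have h1 : evolvedGreen Ω φ ξ a w y - evolvedGreen Ω φ ξ b w y ≤
      (b - a) * (4 / (height Ω φ ξ b y * height Ω φ ξ a w)) := by
    refine (S.evolvedGreen_sub_le_of_mem ha hab hw hy).trans ?_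
    have e1 := S.sq_height_le ha hab w
    have e2 := S.height_anti ha hab w
    have e3 := S.height_nonneg (ha.trans hab) w
    have e4 : (height Ω φ ξ a w - height Ω φ ξ b w) * height Ω φ ξ a w ≤ 4 * (b - a) := by nlinarith
    rw [← mul_div_assoc, div_le_div_iff₀ hvy (by positivity)]
    nlinarith
  have h0 := sub_nonneg.2 (S.evolvedGreen_anti ha hab w y)
  have hD := (S.isOpen_evolvedDomain ha).measurableSet
  have h2 : 0 ≤ ∫ x in evolvedDomain Ω φ ξ a, (evolvedGreen Ω φ ξ a x y -
      evolvedGreen Ω φ ξ b x y) * massiveGreen m (evolvedDomain Ω φ ξ a) w x := by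
    refine integral_nonneg_of_ae ?_
    filter_upwards [(S.greenKernel ha).ae_ne w] with x hx using
      S.sub_mul_massiveGreen_nonneg m ha hab y hwa hx.1 hx.2
  have hWi := S.integrableOn_logWeight hy.1 hw.1
  have h3 : ∫ x in evolvedDomain Ω φ ξ a, (evolvedGreen Ω φ ξ a x y -
      evolvedGreen Ω φ ξ b x y) * massiveGreen m (evolvedDomain Ω φ ξ a) w x ≤
      (b - a) * (16 / (height Ω φ ξ b y * height Ω φ ξ a w) * L) := by
    calc _ ≤ ∫ x in evolvedDomain Ω φ ξ a, (b - a) *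
          (16 / (height Ω φ ξ b y * height Ω φ ξ a w) * logWeight R y w x) := by
          refine integral_mono_ae (S.integrableOn_sub_mul m ha hab hwa hy)
            (((hWi.mono_set (evolvedDomain_subset a)).const_mul _).const_mul _) ?_
          filter_upwards [(S.greenKernel ha).ae_ne w] with x hx using
            S.sub_mul_massiveGreen_le' m ha hab hwa hx.1 hx.2 hy
      _ ≤ _ := by
          rw [integral_const_mul, integral_const_mul]
          have : ∫ x in evolvedDomain Ω φ ξ a, logWeight R y w x ≤ L :=
            (setIntegral_mono_set hWi (ae_of_all _ fun x => logWeight_nonneg R y w x)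
              (evolvedDomain_subset a).eventuallyLE).trans (S.integral_logWeight_le hy.1 hw.1)
          gcongr
  have hm2 := sq_nonneg m
  have h4 := mul_le_mul_of_nonneg_left h3 hm2
  have h5 := mul_nonneg hm2 h2
  have e : (b - a) * (4 + 16 * m ^ 2 * L) / (height Ω φ ξ b y * height Ω φ ξ a w) =
      (b - a) * (4 / (height Ω φ ξ b y * height Ω φ ξ a w)) +
      m ^ 2 * ((b - a) * (16 / (height Ω φ ξ b y * height Ω φ ξ a w) * L)) := by
    field_simp
  rw [e, greenSource, abs_le]
  have h6 : 0 ≤ (b - a) * (4 / (height Ω φ ξ b y * height Ω φ ξ a w)) := by positivity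
  constructor <;> linarith

/-- The resolvent equation for the decrement of the massive Green function. -/
lemma massiveGreen_sub_add {a b : ℝ} (ha : 0 ≤ a) (hab : a ≤ b) {w y : ℂ}
    (hw : w ∈ evolvedDomain Ω φ ξ b) (hy : y ∈ evolvedDomain Ω φ ξ b) (hyw : y ≠ w) :
    (massiveGreen m (evolvedDomain Ω φ ξ a) w y - massiveGreen m (evolvedDomain Ω φ ξ b) w y) +
      m ^ 2 * greenOp (evolvedDomain Ω φ ξ b) (evolvedGreen Ω φ ξ b) (fun x =>
        massiveGreen m (evolvedDomain Ω φ ξ a) w x - massiveGreen m (evolvedDomain Ω φ ξ b) w x) y =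
      greenSource m Ω φ ξ a b w y := by
  have hb := ha.trans hab
  have hsub : evolvedDomain Ω φ ξ b ⊆ evolvedDomain Ω φ ξ a := evolvedDomain_anti hab
  have hGa := S.greenKernel ha
  have hGb := S.greenKernel hb
  have hMa := hGa.memLp_massiveGreen m (hsub hw)
  have hMb := hGb.memLp_massiveGreen m hw
  have hMab : MemLp (massiveGreen m (evolvedDomain Ω φ ξ a) w) 2
      (volume.restrict (evolvedDomain Ω φ ξ b)) := hMa.mono_measure (Measure.restrict_mono_set _ hsub)
  have e1 := hGa.massiveGreen_add m (hsub hw) (hsub hy) hyw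
  have e2 := hGb.massiveGreen_add m hw hy hyw
  have i1 := hGb.integrable_mul hy hMab
  have i2 := hGb.integrable_mul hy hMb
  have i3 := hGa.integrable_mul (hsub hy) hMa
  -- Extension by zero lets the operator on Ω_b be read as an integral over Ω_a, so that the two
  -- resolvent equations can be subtracted.
  have hz : ∀ x, x ∉ evolvedDomain Ω φ ξ b → evolvedGreen Ω φ ξ b y x = 0 := fun x hx => by
    rw [hGb.symm, evolvedGreen, conformalGreen_of_notMem hx]
  have e3 : ∫ x in evolvedDomain Ω φ ξ a, evolvedGreen Ω φ ξ b y x *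
      massiveGreen m (evolvedDomain Ω φ ξ a) w x = ∫ x in evolvedDomain Ω φ ξ b,
      evolvedGreen Ω φ ξ b y x * massiveGreen m (evolvedDomain Ω φ ξ a) w x :=
    setIntegral_eq_of_subset_of_forall_sdiff_eq_zero hGa.isOpen.measurableSet hsub fun x hx => by
      rw [hz x hx.2, zero_mul]
  have i4 : IntegrableOn (fun x => evolvedGreen Ω φ ξ b y x *
      massiveGreen m (evolvedDomain Ω φ ξ a) w x) (evolvedDomain Ω φ ξ a) :=
    i1.of_forall_sdiff_eq_zero hGa.isOpen.measurableSet fun x hx => by rw [hz x hx.2, zero_mul]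
  have e4 : ∫ x in evolvedDomain Ω φ ξ a, (evolvedGreen Ω φ ξ a x y - evolvedGreen Ω φ ξ b x y) *
      massiveGreen m (evolvedDomain Ω φ ξ a) w x =
      (∫ x in evolvedDomain Ω φ ξ a, evolvedGreen Ω φ ξ a y x *
        massiveGreen m (evolvedDomain Ω φ ξ a) w x) - ∫ x in evolvedDomain Ω φ ξ b,
        evolvedGreen Ω φ ξ b y x * massiveGreen m (evolvedDomain Ω φ ξ a) w x := by
    rw [← e3, ← integral_sub i3 i4]
    congr 1 with x
    rw [hGa.symm x y, hGb.symm x y]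
    ring
  have e5 : greenOp (evolvedDomain Ω φ ξ b) (evolvedGreen Ω φ ξ b) (fun x =>
      massiveGreen m (evolvedDomain Ω φ ξ a) w x - massiveGreen m (evolvedDomain Ω φ ξ b) w x) y =
      (∫ x in evolvedDomain Ω φ ξ b, evolvedGreen Ω φ ξ b y x *
        massiveGreen m (evolvedDomain Ω φ ξ a) w x) - ∫ x in evolvedDomain Ω φ ξ b,
        evolvedGreen Ω φ ξ b y x * massiveGreen m (evolvedDomain Ω φ ξ b) w x := by
    rw [← integral_sub i1 i2, greenOp]
    congr 1 with x
    ring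
  rw [greenSource, e4, e5, ← e1, ← e2, greenOp, greenOp]
  ring

lemma memLp_massiveGreen_sub {a b : ℝ} (ha : 0 ≤ a) (hab : a ≤ b) {w : ℂ}
    (hw : w ∈ evolvedDomain Ω φ ξ b) : MemLp (fun x =>
      massiveGreen m (evolvedDomain Ω φ ξ a) w x - massiveGreen m (evolvedDomain Ω φ ξ b) w x) 2
      (volume.restrict (evolvedDomain Ω φ ξ b)) :=
  (((S.greenKernel ha).memLp_massiveGreen m (evolvedDomain_anti hab hw)).mono_measure
    (Measure.restrict_mono_set _ (evolvedDomain_anti hab))).sub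
    ((S.greenKernel (ha.trans hab)).memLp_massiveGreen m hw)

/-- Read off from the resolvent equation: the pointwise bound on the source involves 1/V_b and does
not give square integrability. -/
lemma memLp_greenSource {a b : ℝ} (ha : 0 ≤ a) (hab : a ≤ b) {w : ℂ}
    (hw : w ∈ evolvedDomain Ω φ ξ b) :
    MemLp (greenSource m Ω φ ξ a b w) 2 (volume.restrict (evolvedDomain Ω φ ξ b)) := by
  have hG := S.greenKernel (ha.trans hab)
  have h := S.memLp_massiveGreen_sub m ha hab hw
  refine (h.add ((hG.memLp_greenOp h).const_mul (m ^ 2))).ae_eq ?_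
  filter_upwards [hG.ae_ne w] with y hy using S.massiveGreen_sub_add m ha hab hw hy.1 hy.2

/-- The decrement of the massive Green function in terms of its source. -/
lemma massiveGreen_sub_eq {a b : ℝ} (ha : 0 ≤ a) (hab : a ≤ b) {w z : ℂ}
    (hw : w ∈ evolvedDomain Ω φ ξ b) (hz : z ∈ evolvedDomain Ω φ ξ b) (hzw : z ≠ w) :
    massiveGreen m (evolvedDomain Ω φ ξ a) w z - massiveGreen m (evolvedDomain Ω φ ξ b) w z =
      greenSource m Ω φ ξ a b w z - m ^ 2 * ∫ y in evolvedDomain Ω φ ξ b,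
        massiveGreen m (evolvedDomain Ω φ ξ b) z y * greenSource m Ω φ ξ a b w y := by
  have hG := S.greenKernel (ha.trans hab)
  have h := S.memLp_massiveGreen_sub m ha hab hw
  have e1 := S.massiveGreen_sub_add m ha hab hw hz hzw
  have e2 := hG.integral_massiveGreen_mul_add m h hz
  have e3 : ∫ y in evolvedDomain Ω φ ξ b, massiveGreen m (evolvedDomain Ω φ ξ b) z y *
      greenSource m Ω φ ξ a b w y = greenOp (evolvedDomain Ω φ ξ b) (evolvedGreen Ω φ ξ b) (fun x =>
      massiveGreen m (evolvedDomain Ω φ ξ a) w x - massiveGreen m (evolvedDomain Ω φ ξ b) w x) z := by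
    rw [← e2]
    refine integral_congr_ae ?_
    filter_upwards [hG.ae_ne w] with y hy
    rw [S.massiveGreen_sub_add m ha hab hw hy.1 hy.2]
  rw [e3]
  linarith

/-- The factor 1/V_b(y) in the bound on the source is cancelled by the boundary decay V_b(y) of the
massive Green function. -/
lemma abs_massiveGreen_mul_greenSource_le {a b : ℝ} (ha : 0 ≤ a) (hab : a ≤ b) {w y z : ℂ}
    (hw : w ∈ evolvedDomain Ω φ ξ b) (hz : z ∈ evolvedDomain Ω φ ξ b)
    (hy : y ∈ evolvedDomain Ω φ ξ b) (hyz : y ≠ z) :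
    |massiveGreen m (evolvedDomain Ω φ ξ b) z y * greenSource m Ω φ ξ a b w y| ≤
      (b - a) * (2 * (4 + 16 * m ^ 2 *
      (4 * volume.real Ω + 2 * ∫ y in ball 0 R, logKernel R y ^ 4)) /
        (height Ω φ ξ b z * height Ω φ ξ a w) * logWeight R z z y) := by
  have hb := ha.trans hab
  set L := 4 * volume.real Ω + 2 * ∫ y in ball 0 R, logKernel R y ^ 4 with hLdef
  have hL : 0 ≤ L := by
    have : 0 ≤ ∫ y in ball (0 : ℂ) R, logKernel R y ^ 4 := integral_nonneg fun _ => by positivity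
    positivity
  have hvy := S.height_pos hb hy
  have hvz := S.height_pos hb hz
  have hvw := S.height_pos ha (evolvedDomain_anti hab hw)
  have h1 := S.abs_greenSource_le m ha hab hw hy
  have h2 := S.massiveGreen_le m hb hz hy hyz
  have h0 := S.massiveGreen_nonneg m hb hz hy hyz
  have hl := S.logKernel_nonneg_of_mem hz.1 hy.1
  have hba := sub_nonneg.2 hab
  rw [abs_mul, abs_of_nonneg h0]
  calc massiveGreen m (evolvedDomain Ω φ ξ b) z y * |greenSource m Ω φ ξ a b w y|
      ≤ (2 * (1 + logKernel R (z - y)) * height Ω φ ξ b y / height Ω φ ξ b z) *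
        ((b - a) * (4 + 16 * m ^ 2 * L) / (height Ω φ ξ b y * height Ω φ ξ a w)) :=
        mul_le_mul h2 h1 (abs_nonneg _) (by positivity)
    _ = (b - a) * (2 * (4 + 16 * m ^ 2 * L) / (height Ω φ ξ b z * height Ω φ ξ a w) *
        (1 + logKernel R (z - y))) := by field_simp
    _ ≤ _ := by
        gcongr
        refine le_trans ?_ (mul_le_logWeight R z z y)
        nlinarith

/-- Continuity of the massive Green function in the time variable. -/
lemma abs_massiveGreen_sub_le {a b : ℝ} (ha : 0 ≤ a) (hab : a ≤ b) {w z : ℂ}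
    (hw : w ∈ evolvedDomain Ω φ ξ b) (hz : z ∈ evolvedDomain Ω φ ξ b) (hzw : z ≠ w) :
    |massiveGreen m (evolvedDomain Ω φ ξ a) w z - massiveGreen m (evolvedDomain Ω φ ξ b) w z| ≤
      (b - a) * ((1 + 2 * m ^ 2 * (4 * volume.real Ω + 2 * ∫ y in ball 0 R, logKernel R y ^ 4)) *
        (4 + 16 * m ^ 2 * (4 * volume.real Ω + 2 * ∫ y in ball 0 R, logKernel R y ^ 4)) /
        (height Ω φ ξ b z * height Ω φ ξ a w)) := by
  have hb := ha.trans hab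
  set L := 4 * volume.real Ω + 2 * ∫ y in ball 0 R, logKernel R y ^ 4 with hLdef
  have hL : 0 ≤ L := by
    have : 0 ≤ ∫ y in ball (0 : ℂ) R, logKernel R y ^ 4 := integral_nonneg fun _ => by positivity
    positivity
  have hvz := S.height_pos hb hz
  have hvw := S.height_pos ha (evolvedDomain_anti hab hw)
  have hba := sub_nonneg.2 hab
  have h1 := S.abs_greenSource_le m ha hab hw hz
  have hWi := S.integrableOn_logWeight hz.1 hz.1
  have h2 : |∫ y in evolvedDomain Ω φ ξ b, massiveGreen m (evolvedDomain Ω φ ξ b) z y *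
      greenSource m Ω φ ξ a b w y| ≤ (b - a) * (2 * (4 + 16 * m ^ 2 * L) /
        (height Ω φ ξ b z * height Ω φ ξ a w) * L) := by
    rw [← Real.norm_eq_abs]
    refine (norm_integral_le_of_norm_le (((hWi.mono_set (evolvedDomain_subset b)).const_mul
      (2 * (4 + 16 * m ^ 2 * L) / (height Ω φ ξ b z * height Ω φ ξ a w))).const_mul (b - a)) ?_).trans ?_
    · filter_upwards [(S.greenKernel hb).ae_ne z] with y hy
      exact S.abs_massiveGreen_mul_greenSource_le m ha hab hw hz hy.1 hy.2
    · rw [integral_const_mul, integral_const_mul]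
      have : ∫ x in evolvedDomain Ω φ ξ b, logWeight R z z x ≤ L :=
        (setIntegral_mono_set hWi (ae_of_all _ fun x => logWeight_nonneg R z z x)
          (evolvedDomain_subset b).eventuallyLE).trans (S.integral_logWeight_le hz.1 hz.1)
      gcongr
  rw [S.massiveGreen_sub_eq m ha hab hw hz hzw]
  refine (abs_sub _ _).trans ?_
  rw [abs_mul, abs_of_nonneg (sq_nonneg m)]
  have h3 := mul_le_mul_of_nonneg_left h2 (sq_nonneg m)
  refine (add_le_add h1 h3).trans (le_of_eq ?_)
  field_simp
  ring

end LoewnerSetup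

end

end MassiveHadamard

/-! ### Differentiation in time. -/

namespace MassiveHadamard

noncomputable section

open Set Filter MeasureTheory Metric InnerProductSpace

/-- With a = min s t and b = max s t, estimates stated for a ≤ b treat both one-sided derivatives at
once. -/
lemma sub_div_min_max (f : ℝ → ℝ) (s t : ℝ) :
    (f (min s t) - f (max s t)) / (max s t - min s t) = -slope f t s := by
  rw [slope_def_field]
  rcases le_total s t with h | h
  · rw [min_eq_left h, max_eq_right h, ← neg_sub s, div_neg]
  · rw [min_eq_right h, max_eq_left h, ← neg_sub (f s), neg_div]

lemma eventually_nonneg_ne_lt {t T : ℝ} (h : t < T) :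
    ∀ᶠ s in 𝓝[Ici 0 \ {t}] t, 0 ≤ s ∧ s ≠ t ∧ s < T := by
  filter_upwards [self_mem_nhdsWithin, mem_nhdsWithin_of_mem_nhds (Iio_mem_nhds h)] with s hs hsT
  exact ⟨hs.1, hs.2, hsT⟩

lemma tendsto_min_nhdsWithin {t : ℝ} (ht : 0 ≤ t) :
    Tendsto (fun s => min s t) (𝓝[Ici 0 \ {t}] t) (𝓝[Ici 0] t) := by
  refine tendsto_nhdsWithin_iff.2 ⟨?_, ?_⟩
  · have : Tendsto (fun s => min s t) (𝓝 t) (𝓝 (min t t)) :=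
      (continuous_id.min continuous_const).tendsto t
    rw [min_self] at this
    exact this.mono_left nhdsWithin_le_nhds
  · filter_upwards [self_mem_nhdsWithin] with s hs using le_min hs.1 ht

lemma tendsto_max_nhdsWithin {t : ℝ} (ht : 0 ≤ t) :
    Tendsto (fun s => max s t) (𝓝[Ici 0 \ {t}] t) (𝓝[Ici 0] t) := by
  refine tendsto_nhdsWithin_iff.2 ⟨?_, ?_⟩
  · have : Tendsto (fun s => max s t) (𝓝 t) (𝓝 (max t t)) :=
      (continuous_id.max continuous_const).tendsto t
    rw [max_self] at this
    exact this.mono_left nhdsWithin_le_nhds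
  · exact Eventually.of_forall fun s => ht.trans (le_max_right s t)

namespace LoewnerSetup

variable {Ω : Set ℂ} {φ : ℂ → ℂ} {ξ : ℝ → ℝ} {R : ℝ} (S : LoewnerSetup Ω φ ξ R)

include S

lemma exists_gt_mem_evolvedDomain {t : ℝ} (ht : 0 ≤ t) {x y : ℂ}
    (hx : x ∈ evolvedDomain Ω φ ξ t) (hy : y ∈ evolvedDomain Ω φ ξ t) :
    ∃ T, t < T ∧ x ∈ evolvedDomain Ω φ ξ T ∧ y ∈ evolvedDomain Ω φ ξ T := by
  obtain ⟨T₁, h1, hx1⟩ := exists_gt_mem_loewnerDomain S.continuousOn ht hx.2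
  obtain ⟨T₂, h2, hy2⟩ := exists_gt_mem_loewnerDomain S.continuousOn ht hy.2
  exact ⟨min T₁ T₂, lt_min h1 h2, ⟨hx.1, loewnerDomain_anti (min_le_left _ _) hx1⟩,
    ⟨hy.1, loewnerDomain_anti (min_le_right _ _) hy2⟩⟩

lemma tendsto_evolvedGreen_sub_div {t : ℝ} (ht : 0 ≤ t) {x y : ℂ}
    (hx : x ∈ evolvedDomain Ω φ ξ t) (hy : y ∈ evolvedDomain Ω φ ξ t) (hxy : x ≠ y) :
    Tendsto (fun s => (evolvedGreen Ω φ ξ (min s t) x y - evolvedGreen Ω φ ξ (max s t) x y) /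
      (max s t - min s t)) (𝓝[Ici 0 \ {t}] t)
      (𝓝 (2 * Real.pi * (poisson (evolvedMap φ ξ t) x * poisson (evolvedMap φ ξ t) y))) := by
  obtain ⟨T, hT, hxT, hyT⟩ := S.exists_gt_mem_evolvedDomain ht hx hy
  have h := hasDerivWithinAt_iff_tendsto_slope.1
    (S.hasDerivWithinAt_evolvedGreen hxT hyT hxy ⟨ht, hT.le⟩)
  have hl : 𝓝[Ici 0 \ {t}] t ≤ 𝓝[Icc 0 T \ {t}] t := by
    refine nhdsWithin_le_iff.2 ?_
    filter_upwards [eventually_nonneg_ne_lt hT] with s hs using ⟨⟨hs.1, hs.2.2.le⟩, hs.2.1⟩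
  have h' := (h.mono_left hl).neg
  rw [neg_mul, neg_mul, neg_neg] at h'
  refine h'.congr fun s => ?_
  rw [sub_div_min_max (fun s => evolvedGreen Ω φ ξ s x y)]

variable (m : ℝ)

/-- The two-time bound is Lipschitz in time. Its constant is made uniform by a time T > t at which
both points still survive, whose heights bound all the denominators from below. -/
lemma tendsto_massiveGreen {t : ℝ} (ht : 0 ≤ t) {w z : ℂ}
    (hw : w ∈ evolvedDomain Ω φ ξ t) (hz : z ∈ evolvedDomain Ω φ ξ t) (hzw : z ≠ w) :
    Tendsto (fun s => massiveGreen m (evolvedDomain Ω φ ξ s) w z) (𝓝[Ici 0] t)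
      (𝓝 (massiveGreen m (evolvedDomain Ω φ ξ t) w z)) := by
  obtain ⟨T, hT, hwT, hzT⟩ := S.exists_gt_mem_evolvedDomain ht hw hz
  set L := 4 * volume.real Ω + 2 * ∫ y in ball 0 R, logKernel R y ^ 4 with hLdef
  have hL : 0 ≤ L := by
    have : 0 ≤ ∫ y in ball (0 : ℂ) R, logKernel R y ^ 4 := integral_nonneg fun _ => by positivity
    positivity
  have h0T := ht.trans hT.le
  have hvz := S.height_pos h0T hzT
  have hvw := S.height_pos h0T hwT
  set C := (1 + 2 * m ^ 2 * L) * (4 + 16 * m ^ 2 * L) / (height Ω φ ξ T z * height Ω φ ξ T w)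
  have key : ∀ a b : ℝ, 0 ≤ a → a ≤ b → b ≤ T →
      |massiveGreen m (evolvedDomain Ω φ ξ a) w z - massiveGreen m (evolvedDomain Ω φ ξ b) w z| ≤
        (b - a) * C := by
    intro a b ha hab hbT
    refine (S.abs_massiveGreen_sub_le m ha hab (evolvedDomain_anti hbT hwT)
      (evolvedDomain_anti hbT hzT) hzw).trans ?_
    refine mul_le_mul_of_nonneg_left ?_ (sub_nonneg.2 hab)
    have e1 := S.height_anti (ha.trans hab) hbT z
    have e2 := S.height_anti ha (hab.trans hbT) w
    exact div_le_div_of_nonneg_left (by positivity) (by positivity)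
      (mul_le_mul e1 e2 hvw.le (hvz.le.trans e1))
  refine tendsto_iff_norm_sub_tendsto_zero.2 ?_
  have hlim : Tendsto (fun s => |s - t| * C) (𝓝[Ici 0] t) (𝓝 0) := by
    have : Tendsto (fun s => |s - t| * C) (𝓝 t) (𝓝 (|t - t| * C)) :=
      (((continuous_id.sub continuous_const).abs).mul continuous_const).tendsto t
    rw [sub_self, abs_zero, zero_mul] at this
    exact this.mono_left nhdsWithin_le_nhds
  refine squeeze_zero' (Eventually.of_forall fun _ => norm_nonneg _) ?_ hlim
  filter_upwards [self_mem_nhdsWithin, mem_nhdsWithin_of_mem_nhds (Iio_mem_nhds hT)] with s hs hsT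
  rw [Real.norm_eq_abs]
  rcases le_total s t with h | h
  · rw [abs_of_nonpos (sub_nonpos.2 h), neg_sub]
    exact key s t hs h hT.le
  · rw [abs_sub_comm, abs_of_nonneg (sub_nonneg.2 h)]
    exact key t s ht h (le_of_lt hsT)

lemma continuousOn_poisson {t : ℝ} (ht : 0 ≤ t) :
    ContinuousOn (poisson (evolvedMap φ ξ t)) (evolvedDomain Ω φ ξ t) := by
  refine continuousOn_const.mul (Complex.continuous_im.comp_continuousOn ?_)
  exact continuousOn_const.div (S.differentiableOn_evolvedMap ht).continuousOn
    fun x hx => S.evolvedMap_ne_zero ht hx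

/-- The possible blow-up 1/V of the Poisson kernel is cancelled by the factor V in the decay of the
Green function. -/
lemma integrableOn_poisson_mul_massiveGreen {t : ℝ} (ht : 0 ≤ t) {w : ℂ}
    (hw : w ∈ evolvedDomain Ω φ ξ t) :
    IntegrableOn (fun x => poisson (evolvedMap φ ξ t) x *
      massiveGreen m (evolvedDomain Ω φ ξ t) w x) (evolvedDomain Ω φ ξ t) := by
  have hD := (S.isOpen_evolvedDomain ht).measurableSet
  refine Integrable.mono' (((S.integrableOn_logWeight hw.1 hw.1).mono_set
    (evolvedDomain_subset t)).const_mul (2 / (Real.pi * height Ω φ ξ t w)))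
    (((S.continuousOn_poisson ht).aestronglyMeasurable hD).mul
      ((S.greenKernel ht).memLp_massiveGreen m hw).aestronglyMeasurable) ?_
  filter_upwards [(S.greenKernel ht).ae_ne w] with x hx
  have h0 := S.poisson_nonneg ht hx.1
  have h1 := S.poisson_le ht hx.1
  have h2 := S.massiveGreen_nonneg m ht hw hx.1 hx.2
  have h3 := S.massiveGreen_le m ht hw hx.1 hx.2
  have hvx := S.height_pos ht hx.1
  have hvw := S.height_pos ht hw
  have hl := S.logKernel_nonneg_of_mem hw.1 hx.1.1
  have hpi := Real.pi_pos
  rw [Real.norm_of_nonneg (mul_nonneg h0 h2)]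
  calc _ ≤ (Real.pi * height Ω φ ξ t x)⁻¹ *
        (2 * (1 + logKernel R (w - x)) * height Ω φ ξ t x / height Ω φ ξ t w) :=
        mul_le_mul h1 h3 h2 (by positivity)
    _ = 2 / (Real.pi * height Ω φ ξ t w) * (1 + logKernel R (w - x)) := by field_simp
    _ ≤ _ := by
        gcongr
        refine le_trans ?_ (mul_le_logWeight R w w x)
        nlinarith

lemma poisson_mul_massiveGreen_ae_eq {t : ℝ} (ht : 0 ≤ t) {w : ℂ}
    (hw : w ∈ evolvedDomain Ω φ ξ t) :
    (fun x => poisson (evolvedMap φ ξ t) x * massiveGreen m (evolvedDomain Ω φ ξ t) w x)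
      =ᵐ[volume.restrict (evolvedDomain Ω φ ξ t)]
    fun x => poisson (evolvedMap φ ξ t) x * massiveGreen m (evolvedDomain Ω φ ξ t) x w := by
  filter_upwards [(S.greenKernel ht).ae_ne w] with x hx
  rw [(S.greenKernel ht).massiveGreen_symm m hw hx.1 hx.2]

/-- By symmetry the integration variable may be moved out of the pole slot, where all the estimates
are available. -/
lemma massivePoisson_eq {t : ℝ} (ht : 0 ≤ t) {w : ℂ} (hw : w ∈ evolvedDomain Ω φ ξ t) :
    massivePoisson m (evolvedDomain Ω φ ξ t) (evolvedMap φ ξ t) w =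
      poisson (evolvedMap φ ξ t) w - m ^ 2 * ∫ x in evolvedDomain Ω φ ξ t,
        poisson (evolvedMap φ ξ t) x * massiveGreen m (evolvedDomain Ω φ ξ t) w x := by
  rw [massivePoisson, integral_congr_ae (S.poisson_mul_massiveGreen_ae_eq m ht hw)]

/-- The contribution of the fixed domain to the rescaled source term. -/
lemma tendsto_setIntegral_sub_mul_div {t : ℝ} (ht : 0 ≤ t) {w y : ℂ}
    (hw : w ∈ evolvedDomain Ω φ ξ t) (hy : y ∈ evolvedDomain Ω φ ξ t) :
    Tendsto (fun s => (max s t - min s t)⁻¹ * ∫ x in evolvedDomain Ω φ ξ t,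
      (evolvedGreen Ω φ ξ (min s t) x y - evolvedGreen Ω φ ξ (max s t) x y) *
        massiveGreen m (evolvedDomain Ω φ ξ (min s t)) w x) (𝓝[Ici 0 \ {t}] t)
      (𝓝 (2 * Real.pi * poisson (evolvedMap φ ξ t) y * ∫ x in evolvedDomain Ω φ ξ t,
        poisson (evolvedMap φ ξ t) x * massiveGreen m (evolvedDomain Ω φ ξ t) w x)) := by
  obtain ⟨T, hT, hwT, hyT⟩ := S.exists_gt_mem_evolvedDomain ht hw hy
  have h0T := ht.trans hT.le
  have hvy := S.height_pos h0T hyT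
  have hvw := S.height_pos h0T hwT
  simp_rw [← integral_const_mul]
  refine tendsto_integral_filter_of_dominated_convergence
    (fun x => 16 / (height Ω φ ξ T y * height Ω φ ξ T w) * logWeight R y w x) ?_ ?_
    (((S.integrableOn_logWeight hy.1 hw.1).mono_set (evolvedDomain_subset t)).const_mul _) ?_
  · filter_upwards [eventually_nonneg_ne_lt hT] with s hs
    have ha : 0 ≤ min s t := le_min hs.1 ht
    refine AEStronglyMeasurable.const_mul ?_ _
    exact (S.aestronglyMeasurable_sub_mul m ha min_le_max
      (evolvedDomain_anti (min_le_right s t) hw)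
      (evolvedDomain_anti (max_le hs.2.2.le hT.le) hyT)).mono_measure
      (Measure.restrict_mono_set _ (evolvedDomain_anti (min_le_right s t)))
  · filter_upwards [eventually_nonneg_ne_lt hT] with s hs
    filter_upwards [(S.greenKernel ht).ae_ne w] with x hx
    have ha : 0 ≤ min s t := le_min hs.1 ht
    have hbT : max s t ≤ T := max_le hs.2.2.le hT.le
    have hwa := evolvedDomain_anti (min_le_right s t) hw
    have hxa := evolvedDomain_anti (min_le_right s t) hx.1
    have hd : 0 < max s t - min s t := by
      rw [max_sub_min_eq_abs]; exact abs_pos.2 (sub_ne_zero.2 hs.2.1.symm)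
    have h0 := S.sub_mul_massiveGreen_nonneg m ha (min_le_max (b := t)) y hwa hxa hx.2
    have h1 := S.sub_mul_massiveGreen_le' m ha (min_le_max (b := t)) hwa hxa hx.2
      (evolvedDomain_anti hbT hyT)
    rw [Real.norm_of_nonneg (mul_nonneg (inv_nonneg.2 hd.le) h0), inv_mul_le_iff₀ hd]
    refine h1.trans (mul_le_mul_of_nonneg_left ?_ hd.le)
    have e1 := S.height_anti (ha.trans min_le_max) hbT y
    have e2 := S.height_anti ha ((min_le_max).trans hbT) w
    have e3 := logWeight_nonneg R y w x
    have e4 := hvy.le.trans e1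
    gcongr
  · filter_upwards [(S.greenKernel ht).ae_ne w, (S.greenKernel ht).ae_ne y] with x hx hx'
    have h1 := S.tendsto_evolvedGreen_sub_div ht hx.1 hy hx'.2
    have h2 := (S.tendsto_massiveGreen m ht hw hx.1 hx.2).comp (tendsto_min_nhdsWithin ht)
    convert h1.mul h2 using 2
    · simp only [Function.comp_apply]; ring
    · ring

/-- The contribution of the swallowed region to the rescaled source term. -/
lemma tendsto_setIntegral_diff_sub_mul_div {t : ℝ} (ht : 0 ≤ t) {w y : ℂ}
    (hw : w ∈ evolvedDomain Ω φ ξ t) (hy : y ∈ evolvedDomain Ω φ ξ t) :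
    Tendsto (fun s => (max s t - min s t)⁻¹ *
      ∫ x in evolvedDomain Ω φ ξ (min s t) \ evolvedDomain Ω φ ξ t,
      (evolvedGreen Ω φ ξ (min s t) x y - evolvedGreen Ω φ ξ (max s t) x y) *
        massiveGreen m (evolvedDomain Ω φ ξ (min s t)) w x) (𝓝[Ici 0 \ {t}] t) (𝓝 0) := by
  -- Only times before t see a swallowed region; after t the set difference is empty.
  have hset : Ici 0 \ {t} = Ico 0 t ∪ Ioi t := by
    ext s
    simp only [Set.mem_sdiff, mem_Ici, mem_singleton_iff, mem_union, mem_Ico, mem_Ioi]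
    constructor
    · rintro ⟨h1, h2⟩
      exact (lt_or_gt_of_ne h2).imp (fun h => ⟨h1, h⟩) id
    · rintro (h | h)
      exacts [⟨h.1, h.2.ne⟩, ⟨ht.trans h.le, h.ne'⟩]
  rw [hset, nhdsWithin_union, tendsto_sup]
  constructor
  · rcases ht.eq_or_lt with rfl | ht0
    · rw [Ico_self, nhdsWithin_empty]; exact tendsto_bot
    have hD := (S.isOpen_evolvedDomain ht).measurableSet
    have hvy := S.height_pos ht hy
    have hvw := S.height_pos ht hw
    have hWi := S.integrableOn_logWeight hy.1 hw.1
    have hlim := ((S.tendsto_integral_sq_height_mul ht0 hWi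
      fun x _ => logWeight_nonneg R y w x).mono_left (nhdsWithin_mono t (Ico_subset_Iio_self (a := (0 : ℝ))))).const_mul
      (4 / (height Ω φ ξ t y * height Ω φ ξ t w))
    rw [mul_zero] at hlim
    refine squeeze_zero' ?_ ?_ hlim
    · filter_upwards [self_mem_nhdsWithin] with s hs
      rw [min_eq_left hs.2.le, max_eq_right hs.2.le]
      refine mul_nonneg (inv_nonneg.2 (sub_nonneg.2 hs.2.le)) (integral_nonneg_of_ae ?_)
      refine ae_mono (Measure.restrict_mono_set _ sdiff_subset) ?_
      filter_upwards [(S.greenKernel hs.1).ae_ne w] with x hx using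
        S.sub_mul_massiveGreen_nonneg m hs.1 hs.2.le y (evolvedDomain_anti hs.2.le hw) hx.1 hx.2
    · filter_upwards [self_mem_nhdsWithin] with s hs
      have hst := hs.2.le
      rw [min_eq_left hst, max_eq_right hst, mul_left_comm]
      refine mul_le_mul_of_nonneg_left ?_ (inv_nonneg.2 (sub_nonneg.2 hst))
      have hwa := evolvedDomain_anti hst hw
      have hDs := (S.isOpen_evolvedDomain hs.1).measurableSet
      have hVi : IntegrableOn (fun x => height Ω φ ξ s x ^ 2 * logWeight R y w x)
          (Ω \ evolvedDomain Ω φ ξ t) := by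
        refine Integrable.mono' ((hWi.mono_set sdiff_subset).const_mul (4 * (t - s)))
          (((S.measurable_height hs.1).pow_const 2).aestronglyMeasurable.mul
            (hWi.mono_set sdiff_subset).aestronglyMeasurable) ?_
        refine ae_restrict_of_forall_mem (S.isOpen.measurableSet.diff hD) fun x hx => ?_
        have h1 := S.sq_height_le_sub hs.1 hst hx.2
        have h2 := logWeight_nonneg R y w x
        rw [Real.norm_of_nonneg (by positivity)]
        gcongr
      rw [← integral_const_mul]
      have hsub : evolvedDomain Ω φ ξ s \ evolvedDomain Ω φ ξ t ⊆ Ω \ evolvedDomain Ω φ ξ t :=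
        sdiff_subset_sdiff_left (evolvedDomain_subset s)
      calc _ ≤ ∫ x in evolvedDomain Ω φ ξ s \ evolvedDomain Ω φ ξ t,
            4 / (height Ω φ ξ t y * height Ω φ ξ t w) *
              (height Ω φ ξ s x ^ 2 * logWeight R y w x) := by
            refine integral_mono_ae ((S.integrableOn_sub_mul m hs.1 hst hwa hy).mono_set sdiff_subset)
              ((hVi.mono_set hsub).const_mul _) ?_
            filter_upwards [ae_mono (Measure.restrict_mono_set volume sdiff_subset)
              ((S.greenKernel hs.1).ae_ne w), ae_restrict_mem (hDs.diff hD)] with x hx hx'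
            refine (S.sub_mul_massiveGreen_le m hs.1 hst hwa hx.1 hx.2 hy).trans ?_
            have e1 := S.height_anti hs.1 hst w
            have e2 := logWeight_nonneg R y w x
            rw [height_of_notMem hx'.2]
            norm_num
            gcongr
        _ ≤ _ := by
            refine setIntegral_mono_set (hVi.const_mul _) (ae_of_all _ fun x => ?_)
              hsub.eventuallyLE
            have e2 := logWeight_nonneg R y w x
            exact mul_nonneg (by positivity) (mul_nonneg (sq_nonneg _) e2)
  · refine tendsto_const_nhds.congr' ?_
    filter_upwards [self_mem_nhdsWithin] with s hs
    rw [min_eq_right (le_of_lt hs), Set.sdiff_self, setIntegral_empty, mul_zero]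

/-- The first variation of the source term. -/
lemma tendsto_greenSource_div {t : ℝ} (ht : 0 ≤ t) {w y : ℂ}
    (hw : w ∈ evolvedDomain Ω φ ξ t) (hy : y ∈ evolvedDomain Ω φ ξ t) (hwy : w ≠ y) :
    Tendsto (fun s => (max s t - min s t)⁻¹ * greenSource m Ω φ ξ (min s t) (max s t) w y)
      (𝓝[Ici 0 \ {t}] t) (𝓝 (2 * Real.pi * poisson (evolvedMap φ ξ t) y *
        massivePoisson m (evolvedDomain Ω φ ξ t) (evolvedMap φ ξ t) w)) := by
  obtain ⟨T, hT, hwT, hyT⟩ := S.exists_gt_mem_evolvedDomain ht hw hy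
  have h := (S.tendsto_evolvedGreen_sub_div ht hw hy hwy).sub
    (((S.tendsto_setIntegral_sub_mul_div m ht hw hy).add
      (S.tendsto_setIntegral_diff_sub_mul_div m ht hw hy)).const_mul (m ^ 2))
  have e : 2 * Real.pi * poisson (evolvedMap φ ξ t) y *
      massivePoisson m (evolvedDomain Ω φ ξ t) (evolvedMap φ ξ t) w =
      2 * Real.pi * (poisson (evolvedMap φ ξ t) w * poisson (evolvedMap φ ξ t) y) -
      m ^ 2 * (2 * Real.pi * poisson (evolvedMap φ ξ t) y * (∫ x in evolvedDomain Ω φ ξ t,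
        poisson (evolvedMap φ ξ t) x * massiveGreen m (evolvedDomain Ω φ ξ t) w x) + 0) := by
    rw [S.massivePoisson_eq m ht hw]; ring
  rw [e]
  refine h.congr' ?_
  filter_upwards [eventually_nonneg_ne_lt hT] with s hs
  have ha : 0 ≤ min s t := le_min hs.1 ht
  have hwa := evolvedDomain_anti (min_le_right s t) hw
  have hi := S.integrableOn_sub_mul m ha (min_le_max (b := t)) hwa
    (evolvedDomain_anti (max_le hs.2.2.le hT.le) hyT)
  have hsub := evolvedDomain_anti (Ω := Ω) (φ := φ) (ξ := ξ) (min_le_right s t)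
  -- Split the earlier domain into Ω_t, handled by dominated convergence, and the region swallowed
  -- by time t.
  rw [greenSource, ← integral_inter_add_sdiff (S.isOpen_evolvedDomain ht).measurableSet hi,
    inter_eq_self_of_subset_right hsub]
  ring

/-- The later domain varies with s; indicators transfer the integral to Ω_t. Each fixed point of Ω_t
survives slightly beyond t, so its indicator is eventually one. -/
lemma tendsto_setIntegral_massiveGreen_mul_greenSource_div {t : ℝ} (ht : 0 ≤ t) {w z : ℂ}
    (hw : w ∈ evolvedDomain Ω φ ξ t) (hz : z ∈ evolvedDomain Ω φ ξ t) :
    Tendsto (fun s => (max s t - min s t)⁻¹ * ∫ y in evolvedDomain Ω φ ξ (max s t),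
      massiveGreen m (evolvedDomain Ω φ ξ (max s t)) z y *
        greenSource m Ω φ ξ (min s t) (max s t) w y) (𝓝[Ici 0 \ {t}] t)
      (𝓝 (2 * Real.pi * massivePoisson m (evolvedDomain Ω φ ξ t) (evolvedMap φ ξ t) w *
        ∫ y in evolvedDomain Ω φ ξ t,
          poisson (evolvedMap φ ξ t) y * massiveGreen m (evolvedDomain Ω φ ξ t) z y)) := by
  obtain ⟨T, hT, hwT, hzT⟩ := S.exists_gt_mem_evolvedDomain ht hw hz
  have h0T := ht.trans hT.le
  have hvz := S.height_pos h0T hzT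
  have hvw := S.height_pos h0T hwT
  set L := 4 * volume.real Ω + 2 * ∫ y in ball 0 R, logKernel R y ^ 4 with hLdef
  have hL : 0 ≤ L := by
    have : 0 ≤ ∫ y in ball (0 : ℂ) R, logKernel R y ^ 4 := integral_nonneg fun _ => by positivity
    positivity
  have hb : ∀ s, 0 ≤ max s t := fun s => ht.trans (le_max_right s t)
  have hDb : ∀ s, MeasurableSet (evolvedDomain Ω φ ξ (max s t)) :=
    fun s => (S.isOpen_evolvedDomain (hb s)).measurableSet
  have hsub : ∀ s, evolvedDomain Ω φ ξ (max s t) ⊆ evolvedDomain Ω φ ξ t :=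
    fun s => evolvedDomain_anti (le_max_right s t)
  have hind : ∀ s, (max s t - min s t)⁻¹ * ∫ y in evolvedDomain Ω φ ξ (max s t),
      massiveGreen m (evolvedDomain Ω φ ξ (max s t)) z y *
        greenSource m Ω φ ξ (min s t) (max s t) w y =
      ∫ y in evolvedDomain Ω φ ξ t, (evolvedDomain Ω φ ξ (max s t)).indicator (fun y =>
        (max s t - min s t)⁻¹ * (massiveGreen m (evolvedDomain Ω φ ξ (max s t)) z y *
        greenSource m Ω φ ξ (min s t) (max s t) w y)) y := fun s => by
    rw [setIntegral_indicator (hDb s), inter_eq_self_of_subset_right (hsub s), integral_const_mul]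
  simp_rw [hind]
  rw [← integral_const_mul]
  refine tendsto_integral_filter_of_dominated_convergence
    (fun y => 2 * (4 + 16 * m ^ 2 * L) / (height Ω φ ξ T z * height Ω φ ξ T w) *
      logWeight R z z y) ?_ ?_
    (((S.integrableOn_logWeight hz.1 hz.1).mono_set (evolvedDomain_subset t)).const_mul _) ?_
  · filter_upwards [eventually_nonneg_ne_lt hT] with s hs
    have ha : 0 ≤ min s t := le_min hs.1 ht
    have hbT : max s t ≤ T := max_le hs.2.2.le hT.le
    rw [aestronglyMeasurable_indicator_iff (hDb s), Measure.restrict_restrict (hDb s),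
      inter_eq_self_of_subset_left (hsub s)]
    exact (((S.greenKernel (hb s)).memLp_massiveGreen m
      (evolvedDomain_anti hbT hzT)).aestronglyMeasurable.mul
      (S.memLp_greenSource m ha min_le_max
        (evolvedDomain_anti hbT hwT)).aestronglyMeasurable).const_mul _
  · filter_upwards [eventually_nonneg_ne_lt hT] with s hs
    filter_upwards [(S.greenKernel ht).ae_ne z] with y hy
    have ha : 0 ≤ min s t := le_min hs.1 ht
    have hbT : max s t ≤ T := max_le hs.2.2.le hT.le
    have hd : 0 < max s t - min s t := by
      rw [max_sub_min_eq_abs]; exact abs_pos.2 (sub_ne_zero.2 hs.2.1.symm)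
    have e3 := logWeight_nonneg R z z y
    by_cases hyb : y ∈ evolvedDomain Ω φ ξ (max s t)
    · rw [indicator_of_mem hyb, norm_mul, Real.norm_of_nonneg (inv_nonneg.2 hd.le),
        Real.norm_eq_abs, inv_mul_le_iff₀ hd]
      refine (S.abs_massiveGreen_mul_greenSource_le m ha min_le_max
        (evolvedDomain_anti hbT hwT) (evolvedDomain_anti hbT hzT) hyb hy.2).trans
        (mul_le_mul_of_nonneg_left ?_ hd.le)
      have e1 := S.height_anti (hb s) hbT z
      have e2 := S.height_anti ha ((min_le_max).trans hbT) w
      have e4 := hvz.le.trans e1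
      gcongr
    · rw [indicator_of_notMem hyb, norm_zero]
      positivity
  · filter_upwards [(S.greenKernel ht).ae_ne z, (S.greenKernel ht).ae_ne w] with y hy hy'
    have h1 := S.tendsto_greenSource_div m ht hw hy.1 hy'.2.symm
    have h2 := (S.tendsto_massiveGreen m ht hz hy.1 hy.2).comp (tendsto_max_nhdsWithin ht)
    have h3 := h2.mul h1
    have e : 2 * Real.pi * massivePoisson m (evolvedDomain Ω φ ξ t) (evolvedMap φ ξ t) w *
        (poisson (evolvedMap φ ξ t) y * massiveGreen m (evolvedDomain Ω φ ξ t) z y) =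
        massiveGreen m (evolvedDomain Ω φ ξ t) z y * (2 * Real.pi * poisson (evolvedMap φ ξ t) y *
        massivePoisson m (evolvedDomain Ω φ ξ t) (evolvedMap φ ξ t) w) := by ring
    rw [e]
    refine h3.congr' ?_
    obtain ⟨T', hT', hyT', -⟩ := S.exists_gt_mem_evolvedDomain ht hy.1 hy.1
    filter_upwards [eventually_nonneg_ne_lt hT'] with s hs
    rw [indicator_of_mem (evolvedDomain_anti (max_le hs.2.2.le hT'.le) hyT')]
    simp only [Function.comp_apply]
    ring

/-- Hadamard's variational formula for the massive Green function. -/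
lemma hasDerivWithinAt_massiveGreen {t : ℝ} (ht : 0 ≤ t) {w z : ℂ}
    (hw : w ∈ evolvedDomain Ω φ ξ t) (hz : z ∈ evolvedDomain Ω φ ξ t) (hwz : w ≠ z) :
    HasDerivWithinAt (fun s => massiveGreen m (evolvedDomain Ω φ ξ s) w z)
      (-2 * Real.pi * massivePoisson m (evolvedDomain Ω φ ξ t) (evolvedMap φ ξ t) w *
        massivePoisson m (evolvedDomain Ω φ ξ t) (evolvedMap φ ξ t) z) (Ici 0) t := by
  obtain ⟨T, hT, hwT, hzT⟩ := S.exists_gt_mem_evolvedDomain ht hw hz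
  rw [hasDerivWithinAt_iff_tendsto_slope]
  have h := ((S.tendsto_greenSource_div m ht hw hz hwz).sub
    ((S.tendsto_setIntegral_massiveGreen_mul_greenSource_div m ht hw hz).const_mul (m ^ 2))).neg
  have e : -2 * Real.pi * massivePoisson m (evolvedDomain Ω φ ξ t) (evolvedMap φ ξ t) w *
        massivePoisson m (evolvedDomain Ω φ ξ t) (evolvedMap φ ξ t) z =
      -(2 * Real.pi * poisson (evolvedMap φ ξ t) z *
        massivePoisson m (evolvedDomain Ω φ ξ t) (evolvedMap φ ξ t) w -
        m ^ 2 * (2 * Real.pi * massivePoisson m (evolvedDomain Ω φ ξ t) (evolvedMap φ ξ t) w *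
        ∫ y in evolvedDomain Ω φ ξ t,
          poisson (evolvedMap φ ξ t) y * massiveGreen m (evolvedDomain Ω φ ξ t) z y)) := by
    rw [S.massivePoisson_eq m ht hz]; ring
  rw [e]
  refine h.congr' ?_
  filter_upwards [eventually_nonneg_ne_lt hT] with s hs
  have hbT : max s t ≤ T := max_le hs.2.2.le hT.le
  rw [← neg_eq_iff_eq_neg.2 (sub_div_min_max (fun s => massiveGreen m (evolvedDomain Ω φ ξ s) w z)
      s t),
    S.massiveGreen_sub_eq m (le_min hs.1 ht) min_le_max (evolvedDomain_anti hbT hwT)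
      (evolvedDomain_anti hbT hzT) hwz.symm]
  ring

end LoewnerSetup

end

end MassiveHadamard

theorem lemma4p5
    (Ω : Set ℂ) (hΩ : IsOpen Ω) (hΩb : Bornology.IsBounded Ω)
    (φ : ℂ → ℂ) (hφ : DifferentiableOn ℂ φ Ω) (hφb : Set.BijOn φ Ω MassiveHadamard.upperHalf)
    (ξ : ℝ → ℝ) (hξ : ContinuousOn ξ (Set.Ici 0))
    (m : ℝ) (t : ℝ) (ht : 0 ≤ t) :
    (∀ w ∈ MassiveHadamard.evolvedDomain Ω φ ξ t,
      MassiveHadamard.IsMassiveGreen m (MassiveHadamard.evolvedDomain Ω φ ξ t) w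
        (MassiveHadamard.massiveGreen m (MassiveHadamard.evolvedDomain Ω φ ξ t) w)) ∧
    (∀ z ∈ MassiveHadamard.evolvedDomain Ω φ ξ t,
      MeasureTheory.IntegrableOn
        (fun w => MassiveHadamard.poisson (MassiveHadamard.evolvedMap φ ξ t) w *
          MassiveHadamard.massiveGreen m (MassiveHadamard.evolvedDomain Ω φ ξ t) w z)
        (MassiveHadamard.evolvedDomain Ω φ ξ t) MeasureTheory.volume) ∧
    (∀ w ∈ MassiveHadamard.evolvedDomain Ω φ ξ t,
      ∀ z ∈ MassiveHadamard.evolvedDomain Ω φ ξ t, w ≠ z →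
        HasDerivWithinAt
          (fun s => MassiveHadamard.massiveGreen m (MassiveHadamard.evolvedDomain Ω φ ξ s) w z)
          (-2 * Real.pi *
            MassiveHadamard.massivePoisson m (MassiveHadamard.evolvedDomain Ω φ ξ t)
              (MassiveHadamard.evolvedMap φ ξ t) w *
            MassiveHadamard.massivePoisson m (MassiveHadamard.evolvedDomain Ω φ ξ t)
              (MassiveHadamard.evolvedMap φ ξ t) z)
          (Set.Ici 0) t) := by
  -- One more than the diameter, because the containing balls are open.
  have S : MassiveHadamard.LoewnerSetup Ω φ ξ (Metric.diam Ω + 1) :=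
    { isOpen := hΩ
      differentiableOn := hφ
      bijOn := hφb
      continuousOn := hξ
      pos := add_pos_of_nonneg_of_pos Metric.diam_nonneg one_pos
      subset_ball := fun z hz x hx =>
        (Metric.dist_le_diam_of_mem hΩb hx hz).trans_lt (lt_add_one _) }
  exact ⟨fun w hw => (S.greenKernel ht).isMassiveGreen m hw,
    fun z hz => (S.integrableOn_poisson_mul_massiveGreen m ht hz).congr
      (S.poisson_mul_massiveGreen_ae_eq m ht hz),
    fun w hw z hz hwz => S.hasDerivWithinAt_massiveGreen m ht hw hz hwz⟩
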